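/- Let $k$ be a field, $S=k[x_1,\dots,x_n]$, $\mathfrak m=(x_1,\dots,x_n)$, and $1\le p\le q$. *Conventions.* For a complex $\mathbf G=(\cdots\to G_1\to G_0)$ of finite free modules with chosen bases over a polynomial ring $R$ over $k$, a *subcomplex* of $\mathbf G$ is a complex $\mathbf F$ of finite free $R$-modules with a morphism of complexes $\varphi:\mathbf F\to\mathbf G$ all of whose components $\varphi_i:F_i\to G_i$ are split injective. Its rank sequence is $(\operatorname{rank}F_0,\operatorname{rank}F_1,\dots)$. Let $\mathrm{RS}(\mathbf G)$ be the set of rank sequences of all subcomplexes of $\mathbf G$, and $\mathrm{RS}_k(\mathbf G)\subseteq \mathrm{RS}(\mathbf G)$ the set of rank sequences of those subcomplexes for which, in suitable bases of the $F_i$ and the given bases of the $G_i$, every $\varphi_i$ is a matrix with entries in $k$ (of full column rank). Sums of sets of sequences are taken elementwise, and $a\,\mathrm{RS}(\mathbf G)$ is the $a$-fold sum $\mathrm{RS}(\mathbf G)+\dots+\mathrm{RS}(\mathbf G)$ (which is $\{0\}$ for $a=0$). $\mathbf{EN}(Z)$ is the Eagon–Northcott complex of a matrix $Z$, with its standard bases,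 $\mathbf K_{(m)}$ is the Koszul complex on the $m$ variables of $k[x_1,\dots,x_m]$, and $M^{c,p}$ is the $p\times(c+p-1)$ matrix over $k[x_1,\dots,x_c]$ whose $i$-th row is $(0,\dots,0,x_1,\dots,x_c,0,\dots,0)$ with $i-1$ leading zeros. **Theorem.** Let $Z$ be a $p\times q$ matrix with entries in $\mathfrak m\subset S$ such that the ideal $I$ generated by its maximal minors has codimension $q-p+1$ and $S/I$ is Cohen–Macaulay. Put $$\Sigma=\sum_{j=0}^{q-p}\binom{q-j-1}{p-1}\,\mathrm{RS}(\mathbf K_{(q-p-j)}).$$ 1. $\mathrm{RS}_k(\mathbf{EN}(Z))\subseteq \mathrm{RS}_k(\mathbf{EN}(M^{q-p+1,p}))$, and every $r\in \mathrm{RS}_k(\mathbf{EN}(Z))$ has the form $(0,r')$ or $(1,r')$ with $r'\in\Sigma$. 2. If the entries of $Z$ are homogeneous of one common degree (for instance linear forms), then also $\mathrm{RS}(\mathbf{EN}(Z))\subseteq \mathrm{RS}(\mathbf{EN}(M^{q-p+1,p}))$, and every $r\in \mathrm{RS}(\mathbf{EN}(Z))$ has the form $(0,r')$ or $(1,r')$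 with $r'\in\Sigma$. The same holds for every $r\in\mathrm{RS}(\mathbf F)$, where $\mathbf F$ is any minimal free resolution of $S/I$, that is, a free resolution of $S/I$ by finite free modules with chosen bases in which all entries of the differentials lie in $\mathfrak m$. -/

import Mathlib

open Finset
open scoped Pointwise

/-- A complex `⋯ → F₂ → F₁ → F₀` of finite free `R`-modules with chosen bases: `F i` is free on
the finite type `ι i`, and the differential `F (i + 1) → F i` is the matrix `d i`. -/
structure FreeComplex (R : Type*) [CommRing R] where
  ι : ℕ → Type
  fin : ∀ i, Fintype (ι i)
  d : ∀ i, Matrix (ι i) (ι (i + 1)) R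
  d_comp_d : ∀ i, d i * d (i + 1) = 0

attribute [instance] FreeComplex.fin

/-- The rank sequences of the subcomplexes of `G`. A subcomplex is a complex of finite free modules
`F i = R ^ (r i)`, with differentials `f i : F (i + 1) → F i`, and a morphism of complexes
`φ : F → G` that is split injective in each degree, `ρ i` being a left inverse of `φ i`.

The ring `A` says where the entries of `φ` and `ρ` are taken from. For `A = R` this is the general
notion of a subcomplex; for `R` an algebra over a field `A = k`, the `φ i` are the matrices with
entries in `k` and full column rank. -/
def rankSequences (A : Type*) [CommRing A] {R : Type*} [CommRing R] [Algebra A R]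
    (G : FreeComplex R) : Set (ℕ → ℕ) :=
  {r | ∃ (f : ∀ i, Matrix (Fin (r i)) (Fin (r (i + 1))) R)
      (φ : ∀ i, Matrix (G.ι i) (Fin (r i)) A) (ρ : ∀ i, Matrix (Fin (r i)) (G.ι i) A),
      (∀ i, f i * f (i + 1) = 0) ∧
      (∀ i, ρ i * φ i = 1) ∧
      ∀ i, (φ i).map (algebraMap A R) * f i = G.d i * (φ (i + 1)).map (algebraMap A R)}

/-- The sign `(-1) ^ (i - 1)` of the `i`-th smallest element `s` of `T` (with `i` starting at 1). -/
def posSign (R : Type*) [CommRing R] {m : ℕ} (T : Finset (Fin m)) (s : Fin m) : R :=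
  (-1) ^ #{t ∈ T | t < s}

theorem posSign_swap (R : Type*) [CommRing R] {m : ℕ} {T : Finset (Fin m)} {s t : Fin m}
    (hs : s ∈ T) (hst : s < t) :
    posSign R T s * posSign R (T.erase s) t = - (posSign R T t * posSign R (T.erase t) s) := by
  have h1 : ({u ∈ T.erase t | u < s} : Finset (Fin m)) = {u ∈ T | u < s} := by
    ext u; simp only [mem_filter, mem_erase]
    constructor
    · rintro ⟨⟨_, h⟩, h'⟩; exact ⟨h, h'⟩
    · rintro ⟨h, h'⟩; exact ⟨⟨(h'.trans hst).ne, h⟩, h'⟩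
  have h2 : ({u ∈ T.erase s | u < t} : Finset (Fin m)) = ({u ∈ T | u < t} : Finset _).erase s := by
    ext u; simp only [mem_filter, mem_erase]; tauto
  have h3 : s ∈ ({u ∈ T | u < t} : Finset (Fin m)) := by simp [hs, hst]
  unfold posSign
  rw [h1, h2, ← Finset.card_erase_add_one h3, pow_succ]
  ring

theorem sum_sum_erase_eq_zero {R : Type*} [CommRing R] {m : ℕ} (T : Finset (Fin m))
    (g : Fin m → Fin m → R) (hg : ∀ s ∈ T, ∀ t ∈ T, s < t → g s t = - g t s) :
    ∑ s ∈ T, ∑ t ∈ T.erase s, g s t = 0 := by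
  have h : ∀ s ∈ T, ∑ t ∈ T.erase s, g s t
      = ∑ t ∈ T, (if s < t then g s t else 0) + ∑ t ∈ T, (if t < s then g s t else 0) := by
    intro s hs
    rw [← Finset.sum_add_distrib, ← Finset.sum_erase_add _ _ hs]
    simp only [lt_self_iff_false, if_false, add_zero]
    refine Finset.sum_congr rfl fun t ht => ?_
    rcases lt_or_gt_of_ne (Finset.ne_of_mem_erase ht) with h | h
    · simp [h, h.not_gt]
    · simp [h, h.not_gt]
  rw [Finset.sum_congr rfl h, Finset.sum_add_distrib]
  rw [Finset.sum_comm (f := fun s t => if t < s then g s t else 0), ← Finset.sum_add_distrib]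
  refine Finset.sum_eq_zero fun s hs => ?_
  rw [← Finset.sum_add_distrib]
  refine Finset.sum_eq_zero fun t ht => ?_
  split_ifs with hst
  · rw [hg s hs t ht hst]; ring
  · ring

/-- The matrix of the Koszul differential: `e_T` is sent to `∑ (-1) ^ (j - 1) f_{i_j} e_{T ∖ i_j}`
for `T = {i_1 < ⋯ < i_d}`. -/
def koszulEntry {R : Type*} [CommRing R] {m : ℕ} (f : Fin m → R) (T' T : Finset (Fin m)) : R :=
  ∑ s ∈ T, if T' = T.erase s then posSign R T s * f s else 0

theorem koszul_comp {R : Type*} [CommRing R] {m : ℕ} (f : Fin m → R) (i : ℕ)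
    (U T : Finset (Fin m)) (hT : #T = i + 1) :
    ∑ V ∈ powersetCard i univ, koszulEntry f U V * koszulEntry f V T = 0 := by
  have key : ∀ V ∈ powersetCard i (univ : Finset (Fin m)),
      koszulEntry f U V * koszulEntry f V T =
      ∑ s ∈ T, if V = T.erase s then
        koszulEntry f U (T.erase s) * (posSign R T s * f s) else 0 := by
    intro V _
    conv_lhs => rw [koszulEntry.eq_def f V T, Finset.mul_sum]
    refine Finset.sum_congr rfl fun s _ => ?_
    split_ifs with h
    · rw [h]
    · simp
  rw [Finset.sum_congr rfl key, Finset.sum_comm]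
  have step : ∀ s ∈ T, (∑ V ∈ powersetCard i (univ : Finset (Fin m)), if V = T.erase s then
        koszulEntry f U (T.erase s) * (posSign R T s * f s) else 0) =
      ∑ t ∈ T.erase s, if U = (T.erase s).erase t then
        (posSign R T s * posSign R (T.erase s) t) * (f s * f t) else 0 := by
    intro s hs
    rw [Finset.sum_ite_eq', if_pos (by
      rw [mem_powersetCard]; exact ⟨subset_univ _, by rw [card_erase_of_mem hs, hT]; simp⟩),
      koszulEntry, Finset.sum_mul]
    refine Finset.sum_congr rfl fun t _ => ?_
    split_ifs
    · ring
    · simp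
  rw [Finset.sum_congr rfl step]
  refine sum_sum_erase_eq_zero T _ fun s hs t ht hst => ?_
  rw [Finset.erase_right_comm, posSign_swap R hs hst, mul_comm (f s)]
  split_ifs <;> simp

/-- The Koszul complex of a sequence `f₁, …, f_m` of elements of `R`; its term in degree `i` has
as basis the subsets of size `i` of the index set. -/
def koszulComplex {R : Type*} [CommRing R] {m : ℕ} (f : Fin m → R) : FreeComplex R where
  ι i := ↥(powersetCard i (univ : Finset (Fin m)))
  fin i := inferInstance
  d i := Matrix.of fun T' T => koszulEntry f T'.1 T.1
  d_comp_d i := by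
    ext U T
    rw [Matrix.mul_apply, Matrix.zero_apply]
    simp only [Matrix.of_apply]
    rw [Finset.sum_coe_sort (powersetCard (i + 1) (univ : Finset (Fin m)))
      (fun V => koszulEntry f U.1 V * koszulEntry f V T.1)]
    exact koszul_comp f (i + 1) U.1 T.1 (mem_powersetCard.1 T.2).2

/-- The Koszul complex on the variables of the polynomial ring in `m` variables. -/
noncomputable def variableKoszul (k : Type*) [Field k] (m : ℕ) :
    FreeComplex (MvPolynomial (Fin m) k) :=
  koszulComplex fun i => MvPolynomial.X i

/-- The basis of `(Sym_k G)^* ⊗ Λ^{p+k} F` for `G = R ^ p`, `F = R ^ q`: pairs of an exponent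
vector `a` with `|a| = k` and a set `T` of `p + k` column indices. -/
def enBasis (p q k : ℕ) : Finset ((Fin p → ℕ) × Finset (Fin q)) :=
  piAntidiag univ k ×ˢ powersetCard (p + k) univ

/-- The matrix of the differential
`(ε^a)^* ⊗ e_T ↦ ∑_{s ∈ T} ± ∑_j A_{j,s} (ε^{a - ε_j})^* ⊗ e_{T ∖ s}` of the Eagon–Northcott
complex, where the terms with `a j = 0` are omitted. -/
def enEntry {R : Type*} [CommRing R] {p q : ℕ} (A : Matrix (Fin p) (Fin q) R)
    (y x : (Fin p → ℕ) × Finset (Fin q)) : R :=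
  ∑ s ∈ x.2, ∑ j, if y.2 = x.2.erase s ∧ x.1 = y.1 + Pi.single j 1 then
    posSign R x.2 s * A j s else 0

/-- The maximal minor of `A` on the columns in `T`, in increasing order. -/
def maximalMinor {R : Type*} [CommRing R] {p q : ℕ} (A : Matrix (Fin p) (Fin q) R)
    (T : Finset (Fin q)) (hT : #T = p) : R :=
  (A.submatrix id (T.orderEmbOfFin hT)).det

theorem enBasis_card {p q k : ℕ} {x : (Fin p → ℕ) × Finset (Fin q)} (hx : x ∈ enBasis p q k) :
    #x.2 = p + k :=
  (mem_powersetCard.1 (mem_product.1 hx).2).2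

theorem enBasis_sum {p q k : ℕ} {x : (Fin p → ℕ) × Finset (Fin q)} (hx : x ∈ enBasis p q k) :
    ∑ j, x.1 j = k :=
  (mem_piAntidiag.1 (mem_product.1 hx).1).1

theorem mem_enBasis {p q k : ℕ} {x : (Fin p → ℕ) × Finset (Fin q)} (h1 : ∑ j, x.1 j = k)
    (h2 : #x.2 = p + k) : x ∈ enBasis p q k :=
  mem_product.2 ⟨mem_piAntidiag.2 ⟨h1, by simp⟩, mem_powersetCard.2 ⟨subset_univ _, h2⟩⟩

theorem en_comp {R : Type*} [CommRing R] {p q : ℕ} (A : Matrix (Fin p) (Fin q) R) (k : ℕ)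
    {z x : (Fin p → ℕ) × Finset (Fin q)} (hz : z ∈ enBasis p q k)
    (hx : x ∈ enBasis p q (k + 2)) :
    ∑ y ∈ enBasis p q (k + 1), enEntry A z y * enEntry A y x = 0 := by
  have key : ∀ y ∈ enBasis p q (k + 1), enEntry A z y * enEntry A y x =
      ∑ s ∈ x.2, ∑ t ∈ x.2.erase s, ∑ i, ∑ j, if y = (z.1 + Pi.single j 1, x.2.erase s) then
        (if z.2 = (x.2.erase s).erase t ∧ x.1 = z.1 + Pi.single j 1 + Pi.single i 1 then
          (posSign R x.2 s * posSign R (x.2.erase s) t) * (A i s * A j t) else 0) else 0 := by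
    intro y _
    conv_lhs => rw [enEntry.eq_def A y x, Finset.mul_sum]
    refine Finset.sum_congr rfl fun s _ => ?_
    rw [Finset.mul_sum, Finset.sum_comm]
    refine Finset.sum_congr rfl fun i _ => ?_
    by_cases hy : y.2 = x.2.erase s
    · rw [enEntry, hy, Finset.sum_mul]
      refine Finset.sum_congr rfl fun t _ => ?_
      rw [Finset.sum_mul]
      refine Finset.sum_congr rfl fun j _ => ?_
      by_cases h1 : y.1 = z.1 + Pi.single j 1
      · have : y = (z.1 + Pi.single j 1, x.2.erase s) := Prod.ext h1 hy
        simp only [this, if_true, true_and, and_true]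
        by_cases h2 : z.2 = (x.2.erase s).erase t <;>
          by_cases h3 : x.1 = z.1 + Pi.single j 1 + Pi.single i 1 <;> simp [h2, h3]
        ring
      · have : ¬ y = (z.1 + Pi.single j 1, x.2.erase s) := fun h => h1 (by rw [h])
        simp [h1, this]
    · have : ∀ j, ¬ y = (z.1 + Pi.single j 1, x.2.erase s) := fun j h => hy (by rw [h])
      simp [hy, this]
  rw [Finset.sum_congr rfl key, Finset.sum_comm]
  have step : ∀ s ∈ x.2, (∑ y ∈ enBasis p q (k + 1), ∑ t ∈ x.2.erase s, ∑ i, ∑ j,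
      if y = (z.1 + Pi.single j 1, x.2.erase s) then
        (if z.2 = (x.2.erase s).erase t ∧ x.1 = z.1 + Pi.single j 1 + Pi.single i 1 then
          (posSign R x.2 s * posSign R (x.2.erase s) t) * (A i s * A j t) else 0) else 0) =
      ∑ t ∈ x.2.erase s, ∑ i, ∑ j,
        (if z.2 = (x.2.erase s).erase t ∧ x.1 = z.1 + Pi.single j 1 + Pi.single i 1 then
          (posSign R x.2 s * posSign R (x.2.erase s) t) * (A i s * A j t) else 0) := by
    intro s hs
    rw [Finset.sum_comm]
    refine Finset.sum_congr rfl fun t _ => ?_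
    rw [Finset.sum_comm]
    refine Finset.sum_congr rfl fun i _ => ?_
    rw [Finset.sum_comm]
    refine Finset.sum_congr rfl fun j _ => ?_
    rw [Finset.sum_ite_eq', if_pos]
    refine mem_enBasis ?_ ?_
    · simp [Finset.sum_add_distrib, enBasis_sum hz]
    · simp only
      rw [card_erase_of_mem hs, enBasis_card hx]; rfl
  rw [Finset.sum_congr rfl step]
  refine sum_sum_erase_eq_zero x.2 _ fun s hs t ht hst => ?_
  rw [Finset.sum_comm, ← Finset.sum_neg_distrib]
  refine Finset.sum_congr rfl fun i _ => ?_
  rw [← Finset.sum_neg_distrib]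
  refine Finset.sum_congr rfl fun j _ => ?_
  rw [Finset.erase_right_comm, posSign_swap R hs hst, mul_comm (A _ s),
    add_right_comm z.1]
  split_ifs <;> simp

theorem minor_laplace {R : Type*} [CommRing R] {p q : ℕ} (A : Matrix (Fin p) (Fin q) R)
    (j : Fin p) (T : Finset (Fin q)) (hT : #T = p + 1) :
    ∑ s ∈ T.attach, posSign R T s.1 * A j s.1 *
      maximalMinor A (T.erase s.1) (by rw [card_erase_of_mem s.2, hT]; rfl) = 0 := by
  let e := T.orderEmbOfFin hT
  let B : Matrix (Fin (p + 1)) (Fin (p + 1)) R :=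
    Matrix.of fun a b => (Fin.cons (A j) A : Fin (p + 1) → Fin q → R) a (e b)
  have hB : B.det = 0 := by
    refine Matrix.det_zero_of_row_eq (i := 0) (j := j.succ) (Fin.succ_ne_zero j).symm ?_
    funext b
    rfl
  rw [Matrix.det_succ_row_zero] at hB
  rw [← hB]
  symm
  refine Finset.sum_bij (fun i _ => (⟨e i, T.orderEmbOfFin_mem hT i⟩ : {s // s ∈ T}))
    (fun _ _ => mem_attach _ _) ?_ ?_ ?_
  · intro a _ b _ h
    exact e.injective (congrArg Subtype.val h)
  · rintro ⟨s, hs⟩ _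
    have : s ∈ Set.range e := by rw [T.range_orderEmbOfFin hT]; exact hs
    obtain ⟨i, hi⟩ := this
    exact ⟨i, mem_univ _, Subtype.ext hi⟩
  · intro i _
    have hsign : ({t ∈ T | t < e i} : Finset (Fin q)) = (Finset.Iio i).map e.toEmbedding := by
      ext t
      simp only [mem_filter, mem_map, mem_Iio]
      constructor
      · rintro ⟨h, h'⟩
        have : t ∈ Set.range e := by rw [T.range_orderEmbOfFin hT]; exact h
        obtain ⟨l, rfl⟩ := this
        exact ⟨l, e.lt_iff_lt.1 h', rfl⟩
      · rintro ⟨l, hl, rfl⟩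
        exact ⟨T.orderEmbOfFin_mem hT l, e.lt_iff_lt.2 hl⟩
    have hc : #(T.erase (e i)) = p := by
      rw [card_erase_of_mem (T.orderEmbOfFin_mem hT i), hT]; rfl
    have hminor : (fun a => e (i.succAbove a)) = (T.erase (e i)).orderEmbOfFin hc := by
      refine orderEmbOfFin_unique hc (fun a => ?_) ?_
      · refine mem_erase.2 ⟨fun h => ?_, T.orderEmbOfFin_mem hT _⟩
        exact Fin.succAbove_ne i a (e.injective h)
      · exact e.strictMono.comp (Fin.strictMono_succAbove i)
    have hdet : (B.submatrix Fin.succ i.succAbove) =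
        A.submatrix id ((T.erase (e i)).orderEmbOfFin hc) := by
      ext a b
      rw [← hminor]
      rfl
    simp only [posSign, maximalMinor, hsign, hdet, card_map, Fin.card_Iio]
    rfl

theorem en_comp_zero {R : Type*} [CommRing R] {p q : ℕ} (A : Matrix (Fin p) (Fin q) R)
    {x : (Fin p → ℕ) × Finset (Fin q)} (hx : x ∈ enBasis p q 1) :
    ∑ y : ↥(enBasis p q 0), maximalMinor A y.1.2 (enBasis_card y.2) * enEntry A y.1 x = 0 := by
  have hc := enBasis_card hx
  have key : ∀ y : ↥(enBasis p q 0),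
      maximalMinor A y.1.2 (enBasis_card y.2) * enEntry A y.1 x =
      ∑ j, ∑ s ∈ x.2.attach, if y = ⟨(0, x.2.erase s.1), mem_enBasis (by simp) (by
          simp only
          rw [card_erase_of_mem s.2, hc]; rfl)⟩ then
        (if x.1 = Pi.single j 1 then posSign R x.2 s.1 * A j s.1 *
          maximalMinor A (x.2.erase s.1) (by rw [card_erase_of_mem s.2, hc]; rfl) else 0)
        else 0 := by
    rintro ⟨⟨b, T'⟩, hy⟩
    have hb : b = 0 := by
      have := enBasis_sum hy
      funext j
      exact (Finset.sum_eq_zero_iff.1 this) j (mem_univ j)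
    subst hb
    rw [enEntry, ← Finset.sum_attach, Finset.mul_sum, Finset.sum_comm]
    refine Finset.sum_congr rfl fun s _ => ?_
    rw [Finset.mul_sum]
    refine Finset.sum_congr rfl fun j _ => ?_
    by_cases h : T' = x.2.erase s.1
    · subst h
      simp only [zero_add, true_and, if_true]
      split_ifs
      · ring
      · simp
    · simp [h]
  rw [Finset.sum_congr rfl fun y _ => key y, Finset.sum_comm]
  refine Finset.sum_eq_zero fun j _ => ?_
  rw [Finset.sum_comm]
  simp only [Finset.sum_ite_eq', mem_univ, if_true]
  split_ifs
  · exact minor_laplace A j x.2 hc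
  · simp

/-- The basis of the `i`-th term of the Eagon–Northcott complex of a `p × q` matrix: one element
in degree `0`, and the basis of `(Sym_k G)^* ⊗ Λ^{p+k} F` in degree `k + 1`. -/
def ENIndex (p q : ℕ) : ℕ → Type
  | 0 => Unit
  | k + 1 => ↥(enBasis p q k)

/-- The differentials of the Eagon–Northcott complex. The one to degree `0` is the row of the
maximal minors. -/
def enDifferential {R : Type*} [CommRing R] {p q : ℕ} (A : Matrix (Fin p) (Fin q) R) :
    ∀ i, Matrix (ENIndex p q i) (ENIndex p q (i + 1)) R
  | 0 => Matrix.of fun (_ : Unit) (x : ↥(enBasis p q 0)) => maximalMinor A x.1.2 (enBasis_card x.2)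
  | k + 1 => Matrix.of fun (y : ↥(enBasis p q k)) (x : ↥(enBasis p q (k + 1))) =>
      enEntry A y.1 x.1

/-- The Eagon–Northcott complex of a `p × q` matrix. -/
def eagonNorthcott {R : Type*} [CommRing R] {p q : ℕ} (A : Matrix (Fin p) (Fin q) R) :
    FreeComplex R where
  ι := ENIndex p q
  fin
    | 0 => inferInstanceAs (Fintype Unit)
    | k + 1 => inferInstanceAs (Fintype ↥(enBasis p q k))
  d := enDifferential A
  d_comp_d
    | 0 => by
      ext u x
      exact en_comp_zero A x.2
    | k + 1 => by
      ext z x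
      exact (Finset.sum_coe_sort (enBasis p q (k + 1))
        (fun y => enEntry A z.1 y * enEntry A y x.1)).trans (en_comp A k z.2 x.2)

/-- The ideal generated by the maximal minors of a `p × q` matrix. -/
def maximalMinorIdeal {R : Type*} [CommRing R] {p q : ℕ} (A : Matrix (Fin p) (Fin q) R) :
    Ideal R :=
  Ideal.span {m | ∃ (T : Finset (Fin q)) (hT : #T = p), m = maximalMinor A T hT}

/-- The `d × (n + d - 1)` matrix `M^{n,d}` over `k[x_1, …, x_n]` whose `i`-th row is
`(0, …, 0, x_1, …, x_n, 0, …, 0)`, with `i - 1` zeros in front of `x_1`. -/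
noncomputable def powerMatrix (k : Type*) [Field k] (n d : ℕ) :
    Matrix (Fin d) (Fin (n + d - 1)) (MvPolynomial (Fin n) k) :=
  Matrix.of fun i j =>
    if h : i.val ≤ j.val ∧ j.val - i.val < n then MvPolynomial.X ⟨j.val - i.val, h.2⟩ else 0

/-- A ring is Cohen–Macaulay if it is noetherian and each localization at a maximal ideal has a
regular sequence (in its maximal ideal) whose length is the dimension. -/
def IsCohenMacaulay (R : Type*) [CommRing R] : Prop :=
  IsNoetherianRing R ∧ ∀ (P : Ideal R) [P.IsMaximal],
    ∃ rs : List (Localization.AtPrime P),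
      RingTheory.Sequence.IsRegular (Localization.AtPrime P) rs ∧
      (rs.length : WithBot ℕ∞) = ringKrullDim (Localization.AtPrime P)

/-- `G` is a minimal free resolution of `S ⧸ I`, for `S` a polynomial ring: it is exact in positive
degrees, its homology in degree `0` is isomorphic to `S ⧸ I`, and the entries of its differentials
lie in the ideal generated by the variables. (No grading is asked for, so this covers the minimal
graded free resolution of `S ⧸ I` for a homogeneous ideal `I`.) -/
def IsMinimalFreeResolution {k : Type*} [Field k] {n : ℕ}
    (G : FreeComplex (MvPolynomial (Fin n) k)) (I : Ideal (MvPolynomial (Fin n) k)) : Prop :=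
  (∀ i, LinearMap.ker (G.d i).mulVecLin = LinearMap.range (G.d (i + 1)).mulVecLin) ∧
  Nonempty (((G.ι 0 → MvPolynomial (Fin n) k) ⧸ LinearMap.range (G.d 0).mulVecLin)
    ≃ₗ[MvPolynomial (Fin n) k] (MvPolynomial (Fin n) k ⧸ I)) ∧
  ∀ i a b, MvPolynomial.constantCoeff (G.d i a b) = 0

/-- The set `∑_{j=0}^{q-p} C(q-j-1, p-1) RS(K_{(q-p-j)})` of sequences, where `K_{(m)}` is the
Koszul complex on `m` variables, sums of sets are taken elementwise, and `a RS(K)` is the `a`-fold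
sum `RS(K) + ⋯ + RS(K)`. -/
def koszulSum (k : Type*) [Field k] (p q : ℕ) : Set (ℕ → ℕ) :=
  ∑ j ∈ range (q - p + 1), ∑ _i ∈ range ((q - j - 1).choose (p - 1)),
    rankSequences (MvPolynomial (Fin (q - p - j)) k) (variableKoszul k (q - p - j))

universe u v

/-! ### Acyclicity of complexes whose homology is torsion -/

/-! Put c = q - p + 1 and M = M^{c,p}. A subcomplex of EN(Z) with constant bases is carried over to
EN(M) without changing its ranks, and the ranks of subcomplexes of EN(M) are then bounded by
filtering constant vectors.

Exactness. A power of each maximal minor kills the positive homology of EN(Z), by explicit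
homotopies built from an adjugate matrix (`exists_enDifferential_eq_minor_pow_smul`). The
codimension provides n - c elements that together with the minors define the origin locally. Taking
mapping cones over them lengthens the complex to at most n and makes its homology supported at the
origin; an acyclicity lemma for the regular sequence of variables applies, and Nakayama removes the
cones again (`acyclic_of_mem_radical`). If the differentials are homogeneous, exactness at the
origin is exactness everywhere.

Transfer. In positive degrees the differentials of EN(Z) are linear in the entries of Z, so an
additive map L on the entries that respects scalars carries subcomplexes with constant bases along.
In degree zero the rank is 0 or 1: rank 0 forces the whole subcomplex to vanish, and rank 1 means
that it fills degree zero, where nothing has to be checked. `exists_linearization` sends monomials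
to linear forms in c variables, over the infinite field k(t), such that the minors of L(Z) still
define the origin. These minors are linearly independent, and a dimension count shows that they span
all forms of degree p; the same holds for M. Hence EN(L(Z)) and EN(M) are minimal resolutions of the
same module, and a comparison map is split injective at the origin. Its constant terms give a
subcomplex of EN(M) over k(t) (`mem_rankSequences_of_constantCoeff`), which extends over k[t] by
saturating lattices and specializes at t = 0.

Tails. Write D_l for the coefficient matrices of X_l in the linear part of EN(M); they generate an
action of the exterior algebra. Sending v to the family of the d_0(D_J v), J running over sets of
indices, embeds constant vectors of each degree into families of forms of degree p. Filter by the
lexicographic order of monomials. The relation d_0 d_1 = 0 forces the leading coefficients at a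
monomial u to live on sets of indices before the last variable of u
(`FreeComplex.coeff_cofreeEmbedding_eq_zero`), so the graded piece at u is a subcomplex of the
Koszul complex on those m earlier variables. There are binom(m+p-1, p-1) such u, and m = q-p-j gives
Σ.

If the entries of Z are forms of one degree, taking constant terms reduces arbitrary subcomplexes of
EN(Z), and via a comparison map those of any minimal resolution, to subcomplexes over k. -/

theorem mem_smul_top_iff_exists {A : Type*} [CommRing A] {M : Type*} [AddCommGroup M] [Module A M]
    (x : A) (m : M) : m ∈ x • (⊤ : Submodule A M) ↔ ∃ m', x • m' = m := by
  rw [Submodule.mem_smul_pointwise_iff_exists]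
  simp

/-- A complex of length at most the length of a weakly regular sequence is acyclic if the
members of the sequence act nilpotently on the classes in positive degrees. -/
theorem acyclic_of_isWeaklyRegular {A : Type v} [CommRing A] (xs : List A) :
    ∀ (C : ℕ → Type u) [∀ i, AddCommGroup (C i)] [∀ i, Module A (C i)]
      (d : ∀ i, C (i + 1) →ₗ[A] C i)
      (_ : ∀ i z, d i (d (i + 1) z) = 0)
      (_ : ∀ i, RingTheory.Sequence.IsWeaklyRegular (C i) xs)
      (_ : ∀ i, xs.length < i → Subsingleton (C i))
      (_ : ∀ x ∈ xs, ∀ i (z : C (i + 1)), d i z = 0 → ∃ N : ℕ, ∃ w, x ^ N • z = d (i + 1) w)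
      (i : ℕ) (z : C (i + 1)), d i z = 0 → ∃ w, z = d (i + 1) w := by
  induction xs with
  | nil =>
    intro C _ _ d _ _ hlen _ i z _
    have := hlen (i + 1) (by simp)
    exact ⟨0, Subsingleton.elim _ _⟩
  | cons y xs ih =>
    intro C _ _ d hdd hreg hlen htor i z hz
    have hy : ∀ i, IsSMulRegular (C i) y := fun i =>
      ((RingTheory.Sequence.isWeaklyRegular_cons_iff (C i) y xs).1 (hreg i)).1
    have hexact : ∀ j (w : C (j + 2)), (∃ t, d (j + 1) w = y • t) →
        ∃ u w', w = d (j + 2) u + y • w' := by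
      intro j w hw
      -- Reduce modulo `y` and drop the term of degree zero, so that the length of the complex
      -- shrinks along with the sequence. Exactness of `C / y C` in degrees at least 2 is all that
      -- is used below.
      have := ih (fun i => QuotSMulTop y (C (i + 1))) (fun i => QuotSMulTop.map y (d (i + 1)))
        ?_ ?_ ?_ ?_ j (Submodule.Quotient.mk w) ?_
      · obtain ⟨u, hu⟩ := this
        obtain ⟨u, rfl⟩ := Submodule.Quotient.mk_surjective _ u
        rw [QuotSMulTop.map_apply_mk, Submodule.Quotient.eq, mem_smul_top_iff_exists] at hu
        obtain ⟨w', hw'⟩ := hu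
        exact ⟨u, w', by rw [hw']; abel⟩
      · intro i z
        obtain ⟨z, rfl⟩ := Submodule.Quotient.mk_surjective _ z
        rw [QuotSMulTop.map_apply_mk, QuotSMulTop.map_apply_mk, hdd, Submodule.Quotient.mk_zero]
      · intro i
        exact ((RingTheory.Sequence.isWeaklyRegular_cons_iff _ y xs).1 (hreg (i + 1))).2
      · intro i hi
        have := hlen (i + 1) (by simpa using hi)
        exact (Submodule.Quotient.mk_surjective _).subsingleton
      · intro x hx i z hz
        obtain ⟨z, rfl⟩ := Submodule.Quotient.mk_surjective _ z
        rw [QuotSMulTop.map_apply_mk, Submodule.Quotient.mk_eq_zero, mem_smul_top_iff_exists] at hz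
        obtain ⟨t, ht⟩ := hz
        -- Nilpotency modulo `y` takes two rounds: first a power of `x` makes `t` a boundary `d v`,
        -- then `x ^ N • z - y • v` is an honest cycle and a further power makes it a boundary.
        have hdt : d i t = 0 := by
          apply hy i
          simp only [smul_zero]
          rw [← map_smul, ht, hdd]
        obtain ⟨N, v, hv⟩ := htor x (List.mem_cons_of_mem _ hx) i t hdt
        have hc : d (i + 1) (x ^ N • z - y • v) = 0 := by
          rw [map_sub, map_smul, map_smul, ← hv, ← ht, smul_comm, sub_self]
        obtain ⟨N', v', hv'⟩ := htor x (List.mem_cons_of_mem _ hx) (i + 1) _ hc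
        refine ⟨N' + N, Submodule.Quotient.mk v', ?_⟩
        rw [QuotSMulTop.map_apply_mk, ← Submodule.Quotient.mk_smul, Submodule.Quotient.eq,
          mem_smul_top_iff_exists]
        refine ⟨x ^ N' • v, ?_⟩
        rw [← hv', pow_add, mul_smul, smul_sub, smul_comm y]
        abel
      · obtain ⟨t, ht⟩ := hw
        rw [QuotSMulTop.map_apply_mk, Submodule.Quotient.mk_eq_zero, mem_smul_top_iff_exists]
        exact ⟨t, ht.symm⟩
    -- Multiplication by `y` is injective on positive homology. Since it is also nilpotent on the
    -- class of `z`, that class is zero.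
    have hinj : ∀ (z : C (i + 1)), (∃ w, y • z = d (i + 1) w) → ∃ w, z = d (i + 1) w := by
      rintro z ⟨w, hw⟩
      obtain ⟨u, w', rfl⟩ := hexact i w ⟨z, hw.symm⟩
      refine ⟨w', hy (i + 1) ?_⟩
      simp only
      rw [hw, map_add, hdd, zero_add, map_smul]
    obtain ⟨N, hN⟩ := htor y List.mem_cons_self i z hz
    induction N with
    | zero => simpa using hN
    | succ N ihN =>
      apply ihN
      apply hinj
      rwa [smul_smul, ← pow_succ']

/-- The terms of the mapping cone of multiplication by an element on a complex. -/
def ConeTerm (C : ℕ → Type u) : ℕ → Type u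
  | 0 => C 0
  | i + 1 => C (i + 1) × C i

instance coneTermAddCommGroup (C : ℕ → Type u) [∀ i, AddCommGroup (C i)] :
    ∀ i, AddCommGroup (ConeTerm C i)
  | 0 => inferInstanceAs (AddCommGroup (C 0))
  | i + 1 => inferInstanceAs (AddCommGroup (C (i + 1) × C i))

instance coneTermModule {A : Type v} [CommRing A] (C : ℕ → Type u) [∀ i, AddCommGroup (C i)]
    [∀ i, Module A (C i)] : ∀ i, Module A (ConeTerm C i)
  | 0 => inferInstanceAs (Module A (C 0))
  | i + 1 => inferInstanceAs (Module A (C (i + 1) × C i))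

theorem coneTerm_free {A : Type v} [CommRing A] (C : ℕ → Type u) [∀ i, AddCommGroup (C i)]
    [∀ i, Module A (C i)] [∀ i, Module.Free A (C i)] : ∀ i, Module.Free A (ConeTerm C i)
  | 0 => inferInstanceAs (Module.Free A (C 0))
  | i + 1 => inferInstanceAs (Module.Free A (C (i + 1) × C i))

theorem coneTerm_finite {A : Type v} [CommRing A] (C : ℕ → Type u) [∀ i, AddCommGroup (C i)]
    [∀ i, Module A (C i)] [∀ i, Module.Finite A (C i)] : ∀ i, Module.Finite A (ConeTerm C i)
  | 0 => inferInstanceAs (Module.Finite A (C 0))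
  | i + 1 => inferInstanceAs (Module.Finite A (C (i + 1) × C i))

/-- The differential of the mapping cone of multiplication by `g`. -/
def coneDifferential {A : Type v} [CommRing A] {C : ℕ → Type u} [∀ i, AddCommGroup (C i)]
    [∀ i, Module A (C i)] (d : ∀ i, C (i + 1) →ₗ[A] C i) (g : A) :
    ∀ i, ConeTerm C (i + 1) →ₗ[A] ConeTerm C i
  | 0 => (LinearMap.coprod (d 0) (g • LinearMap.id) : C 1 × C 0 →ₗ[A] C 0)
  | i + 1 => (LinearMap.prod (LinearMap.coprod (d (i + 1)) (g • LinearMap.id))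
      (-(d i ∘ₗ LinearMap.snd A _ _)) : C (i + 2) × C (i + 1) →ₗ[A] C (i + 1) × C i)

section Cone

variable {A : Type v} [CommRing A] {C : ℕ → Type u} [∀ i, AddCommGroup (C i)]
    [∀ i, Module A (C i)] (d : ∀ i, C (i + 1) →ₗ[A] C i) (g : A)

theorem coneDifferential_zero_apply (a : C 1) (b : C 0) :
    coneDifferential d g 0 ((a, b) : C 1 × C 0) = (d 0 a + g • b : C 0) := rfl

theorem coneDifferential_succ_apply (i : ℕ) (a : C (i + 2)) (b : C (i + 1)) :
    coneDifferential d g (i + 1) ((a, b) : C (i + 2) × C (i + 1)) =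
      ((d (i + 1) a + g • b, - d i b) : C (i + 1) × C i) := rfl

theorem coneDifferential_comp (hdd : ∀ i z, d i (d (i + 1) z) = 0) :
    ∀ i z, coneDifferential d g i (coneDifferential d g (i + 1) z) = 0
  | 0, (a, b) => by
    rw [coneDifferential_succ_apply, coneDifferential_zero_apply, map_add, hdd, map_smul]
    simp
    rfl
  | i + 1, (a, b) => by
    rw [coneDifferential_succ_apply, coneDifferential_succ_apply, map_add, hdd, map_smul, map_neg,
      hdd]
    refine Prod.ext ?_ ?_ <;> simp <;> rfl

/-- The ideal of the elements that multiply `z` into the boundaries. -/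
def boundaryColon {M N : Type*} [AddCommGroup M] [Module A M] [AddCommGroup N] [Module A N]
    (f : N →ₗ[A] M) (z : M) : Ideal A :=
  (LinearMap.range f).comap (LinearMap.toSpanSingleton A M z)

theorem mem_boundaryColon {M N : Type*} [AddCommGroup M] [Module A M] [AddCommGroup N] [Module A N]
    (f : N →ₗ[A] M) (z : M) (a : A) : a ∈ boundaryColon f z ↔ ∃ w, f w = a • z := by
  simp [boundaryColon]

/-- For a cycle `(a, b)` of the cone, a power of `r ∈ I` turns `b` into a boundary `d w`; then `r ^
N • a + g • w` is a cycle of the original complex, and a further power of `r` kills it. The element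
`g` acts as zero on the homology of the cone, the homotopy being `(a, b) ↦ (0, a)`. -/
theorem mem_boundaryColon_cone_succ {I : Ideal A} (i : ℕ)
    (h1 : ∀ z : C (i + 1), d i z = 0 → I ≤ (boundaryColon (d (i + 1)) z).radical)
    (a : C (i + 1)) (b : C i) (hb : I ≤ (boundaryColon (d i) b).radical)
    (hab : d i a + g • b = 0) :
    I ⊔ Ideal.span {g} ≤
      (boundaryColon (coneDifferential d g (i + 1)) ((a, b) : C (i + 1) × C i)).radical := by
  refine sup_le (fun r hr => ?_) ?_
  · obtain ⟨N, hN⟩ := hb hr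
    obtain ⟨w, hw⟩ := (mem_boundaryColon _ _ _).1 hN
    have hc : d i (r ^ N • a + g • w) = 0 := by
      rw [map_add, map_smul, map_smul, hw, smul_comm g, ← smul_add, hab, smul_zero]
    obtain ⟨M, hM⟩ := h1 _ hc hr
    obtain ⟨v, hv⟩ := (mem_boundaryColon _ _ _).1 hM
    refine ⟨M + N, (mem_boundaryColon _ _ _).2
      ⟨((v, - (r ^ M • w)) : C (i + 2) × C (i + 1)), ?_⟩⟩
    rw [coneDifferential_succ_apply]
    refine Prod.ext ?_ ?_
    · change d (i + 1) v + g • -(r ^ M • w) = r ^ (M + N) • a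
      rw [hv, pow_add, smul_add, mul_smul, smul_neg, smul_comm g]
      abel
    · change - d i (-(r ^ M • w)) = r ^ (M + N) • b
      rw [map_neg, neg_neg, map_smul, hw, pow_add, mul_smul]
  · rw [Ideal.span_singleton_le_iff_mem]
    refine ⟨1, (mem_boundaryColon _ _ _).2 ⟨((0, a) : C (i + 2) × C (i + 1)), ?_⟩⟩
    rw [coneDifferential_succ_apply, pow_one]
    refine Prod.ext ?_ ?_
    · change d (i + 1) 0 + g • a = g • a
      rw [map_zero, zero_add]
    · change - d i a = g • b
      rw [neg_eq_iff_add_eq_zero, hab]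

end Cone

theorem isWeaklyRegular_of_flat_module {A : Type v} [CommRing A] {xs : List A}
    (h : RingTheory.Sequence.IsWeaklyRegular A xs) (M : Type u) [AddCommGroup M] [Module A M]
    [Module.Flat A M] : RingTheory.Sequence.IsWeaklyRegular M xs :=
  ((TensorProduct.rid A M).isWeaklyRegular_congr xs).1 (h.isWeaklyRegular_lTensor (M₂ := M))

/-- A complex of free modules of length `c` over a noetherian local ring is acyclic if its homology
is supported on `V(I)`, and `g₁, …, g_s` in the maximal ideal are such that some
weakly regular sequence of length `c + s` lies in the radical of `I + (g₁, …, g_s)`. -/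
theorem acyclic_of_mem_radical {A : Type v} [CommRing A] [IsLocalRing A] [IsNoetherianRing A]
    {xs : List A} (hxs : RingTheory.Sequence.IsWeaklyRegular A xs) (gs : List A) :
    ∀ (I : Ideal A) (_ : ∀ x ∈ xs, x ∈ (I ⊔ Ideal.ofList gs).radical)
      (_ : ∀ g ∈ gs, g ∈ IsLocalRing.maximalIdeal A)
      (C : ℕ → Type u) [∀ i, AddCommGroup (C i)] [∀ i, Module A (C i)]
      [∀ i, Module.Free A (C i)] [∀ i, Module.Finite A (C i)]
      (d : ∀ i, C (i + 1) →ₗ[A] C i)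
      (_ : ∀ i z, d i (d (i + 1) z) = 0)
      (_ : ∀ i, xs.length < i + gs.length → Subsingleton (C i))
      (_ : ∀ z : C 0, I ≤ (boundaryColon (d 0) z).radical)
      (_ : ∀ i (z : C (i + 1)), d i z = 0 → I ≤ (boundaryColon (d (i + 1)) z).radical)
      (i : ℕ) (z : C (i + 1)), d i z = 0 → ∃ w, z = d (i + 1) w := by
  induction gs with
  | nil =>
    intro I hx _ C _ _ _ _ d hdd hlen _ h1
    refine acyclic_of_isWeaklyRegular xs C d hdd (fun i => isWeaklyRegular_of_flat_module hxs _)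
      (fun i hi => hlen i (by simpa using hi)) ?_
    intro x hxs i z hz
    have h2 : x ∈ I.radical := by simpa using hx x hxs
    have h3 : x ∈ (boundaryColon (d (i + 1)) z).radical := by
      have := Ideal.radical_mono (h1 i z hz) h2
      rwa [Ideal.radical_idem] at this
    obtain ⟨N, hN⟩ := h3
    obtain ⟨w, hw⟩ := (mem_boundaryColon _ _ _).1 hN
    exact ⟨N, w, hw.symm⟩
  | cons g gs ih =>
    intro I hx hg C _ _ _ _ d hdd hlen h0 h1 i z hz
    have := coneTerm_free (A := A) C
    have := coneTerm_finite (A := A) C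
    have hcone := ih (I ⊔ Ideal.span {g}) (fun x hx' => by
        have := hx x hx'
        rwa [Ideal.ofList_cons, ← sup_assoc] at this)
      (fun g' hg' => hg g' (List.mem_cons_of_mem _ hg')) (ConeTerm C) (coneDifferential d g)
      (coneDifferential_comp d g hdd) ?_ ?_ ?_
    -- The cycle `(z, 0)` of the cone bounds some `(w, z')`. This says that `g` is surjective on the
    -- homology of `C` in this degree, which therefore vanishes by Nakayama.
    · have key : ∀ z : C (i + 1), d i z = 0 → ∃ z' w, d i z' = 0 ∧ z = d (i + 1) w + g • z' := by
        intro z hz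
        have hz' : coneDifferential d g (i + 1) ((0, z) : C (i + 2) × C (i + 1)) =
          ((g • z, 0) : C (i + 1) × C i) := by
          rw [coneDifferential_succ_apply, map_zero, zero_add, hz, neg_zero]
        have hc : coneDifferential d g i ((z, 0) : C (i + 1) × C i) = 0 := by
          cases i with
          | zero => rw [coneDifferential_zero_apply, hz, smul_zero, zero_add]; rfl
          | succ i =>
            rw [coneDifferential_succ_apply, hz, smul_zero, zero_add, map_zero, neg_zero]; rfl
        obtain ⟨⟨w, z'⟩, hw⟩ := hcone i _ hc
        rw [coneDifferential_succ_apply] at hw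
        refine ⟨z', w, ?_, congrArg Prod.fst hw⟩
        have := congrArg Prod.snd hw
        simpa using this.symm
      have hle : LinearMap.ker (d i) ≤ LinearMap.range (d (i + 1)) := by
        refine Submodule.le_of_le_smul_of_le_jacobson_bot (I := Ideal.span {g})
          (IsNoetherian.noetherian _) ?_ ?_
        · rw [IsLocalRing.jacobson_eq_maximalIdeal _ bot_ne_top, Ideal.span_singleton_le_iff_mem]
          exact hg g List.mem_cons_self
        · intro z hz
          obtain ⟨z', w, hz', rfl⟩ := key z hz
          refine Submodule.add_mem_sup ⟨w, rfl⟩ ?_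
          exact Submodule.smul_mem_smul (Ideal.mem_span_singleton_self g) hz'
      obtain ⟨w, hw⟩ := hle hz
      exact ⟨w, hw.symm⟩
    · intro j hj
      cases j with
      | zero => exact hlen 0 (by simp only [List.length_cons]; omega)
      | succ j =>
        have h1 := hlen (j + 1) (by simp only [List.length_cons]; omega)
        have h2 := hlen j (by simp only [List.length_cons]; omega)
        exact inferInstanceAs (Subsingleton (C (j + 1) × C j))
    · intro z
      refine sup_le (fun r hr => ?_) ?_
      · obtain ⟨N, hN⟩ := h0 z hr
        obtain ⟨w, hw⟩ := (mem_boundaryColon _ _ _).1 hN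
        refine ⟨N, (mem_boundaryColon _ _ _).2 ⟨((w, 0) : C 1 × C 0), ?_⟩⟩
        rw [coneDifferential_zero_apply, smul_zero, add_zero, hw]; rfl
      · rw [Ideal.span_singleton_le_iff_mem]
        refine ⟨1, (mem_boundaryColon _ _ _).2 ⟨((0, z) : C 1 × C 0), ?_⟩⟩
        exact (coneDifferential_zero_apply d g 0 z).trans (by rw [map_zero, zero_add, pow_one]; rfl)
    · rintro j ⟨a, b⟩ hab
      cases j with
      | zero => exact mem_boundaryColon_cone_succ d g 0 (h1 0) a b (h0 b) hab
      | succ j =>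
        rw [coneDifferential_succ_apply] at hab
        refine mem_boundaryColon_cone_succ d g (j + 1) (h1 (j + 1)) a b (h1 j b ?_)
          (congrArg Prod.fst hab)
        have := congrArg Prod.snd hab
        exact neg_eq_zero.1 this

/-! ### Contraction and exterior multiplication in coordinates -/

section Contraction

variable {A : Type v} [CommRing A] {q : ℕ}

/-- Contraction of an element of the exterior algebra on `A ^ q`, given by its coordinates,
against a linear form. -/
def contract (f : Fin q → A) : (Finset (Fin q) → A) →ₗ[A] (Finset (Fin q) → A) where
  toFun x T := ∑ s ∈ Tᶜ, posSign A (insert s T) s * f s * x (insert s T)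
  map_add' x y := by
    ext T; simp only [Pi.add_apply, mul_add, sum_add_distrib]
  map_smul' r x := by
    ext T; simp only [Pi.smul_apply, smul_eq_mul, RingHom.id_apply, mul_sum]
    exact sum_congr rfl fun s _ => by ring

/-- Exterior multiplication by a vector, in coordinates. -/
def wedge (b : Fin q → A) : (Finset (Fin q) → A) →ₗ[A] (Finset (Fin q) → A) where
  toFun x T := ∑ s ∈ T, posSign A T s * b s * x (T.erase s)
  map_add' x y := by
    ext T; simp only [Pi.add_apply, mul_add, sum_add_distrib]
  map_smul' r x := by
    ext T; simp only [Pi.smul_apply, smul_eq_mul, RingHom.id_apply, mul_sum]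
    exact sum_congr rfl fun s _ => by ring

theorem contract_apply (f : Fin q → A) (x : Finset (Fin q) → A) (T : Finset (Fin q)) :
    contract f x T = ∑ s ∈ Tᶜ, posSign A (insert s T) s * f s * x (insert s T) := rfl

theorem wedge_apply (b : Fin q → A) (x : Finset (Fin q) → A) (T : Finset (Fin q)) :
    wedge b x T = ∑ s ∈ T, posSign A T s * b s * x (T.erase s) := rfl

theorem posSign_mul_self (T : Finset (Fin q)) (s : Fin q) : posSign A T s * posSign A T s = 1 := by
  rw [posSign, ← mul_pow]; simp

theorem posSign_mul_posSign {U : Finset (Fin q)} {s t : Fin q} (hs : s ∈ U) (ht : t ∈ U)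
    (hst : s ≠ t) :
    posSign A U s * posSign A U t = - (posSign A (U.erase t) s * posSign A (U.erase s) t) := by
  have key : posSign A U s * posSign A (U.erase s) t =
      - (posSign A U t * posSign A (U.erase t) s) := by
    rcases lt_or_gt_of_ne hst with h | h
    · exact posSign_swap A hs h
    · rw [posSign_swap A ht h, neg_neg]
  calc posSign A U s * posSign A U t = posSign A U s * posSign A (U.erase s) t *
        (posSign A (U.erase s) t * posSign A U t) := by
          linear_combination (- posSign A U s * posSign A U t) *
            posSign_mul_self (A := A) (U.erase s) t
    _ = - (posSign A (U.erase t) s * posSign A (U.erase s) t) *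
        (posSign A U t * posSign A U t) := by rw [key]; ring
    _ = _ := by rw [posSign_mul_self, mul_one]

theorem contract_contract_self (f : Fin q → A) (x : Finset (Fin q) → A) :
    contract f (contract f x) = 0 := by
  ext T
  rw [contract_apply]
  have : ∀ s ∈ Tᶜ, posSign A (insert s T) s * f s * contract f x (insert s T) =
      ∑ t ∈ Tᶜ.erase s, posSign A (insert s T) s * posSign A (insert t (insert s T)) t *
        (f s * f t * x (insert t (insert s T))) := by
    intro s hs
    rw [contract_apply, mul_sum]
    refine sum_congr ?_ fun t _ => by ring
    ext t; simp
  rw [sum_congr rfl this]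
  refine sum_sum_erase_eq_zero _ _ fun s hs t ht hst => ?_
  rw [mem_compl] at hs ht
  have h := posSign_swap A (T := insert t (insert s T)) (s := s) (t := t) (by simp) hst
  have e1 : (insert t (insert s T)).erase t = insert s T := by
    rw [erase_insert]; simp [hst.ne', ht]
  have e2 : (insert t (insert s T)).erase s = insert t T := by
    rw [Finset.insert_comm, erase_insert]; simp [hst.ne, hs]
  rw [e1, e2] at h
  have h' : posSign A (insert s T) s * posSign A (insert t (insert s T)) t =
      - (posSign A (insert t T) t * posSign A (insert t (insert s T)) s) := by
    linear_combination h
  rw [h', Finset.insert_comm s t]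
  ring

theorem contract_add (f g : Fin q → A) : contract (f + g) = contract f + contract g := by
  refine LinearMap.ext fun x => funext fun T => ?_
  rw [LinearMap.add_apply, Pi.add_apply]
  simp only [contract_apply, Pi.add_apply, ← sum_add_distrib]
  exact sum_congr rfl fun s _ => by ring

theorem contract_contract (f g : Fin q → A) (x : Finset (Fin q) → A) :
    contract f (contract g x) = - contract g (contract f x) := by
  have h := contract_contract_self (f + g) x
  rw [contract_add] at h
  simp only [LinearMap.add_apply, map_add, contract_contract_self, zero_add, add_zero] at h
  rw [eq_neg_iff_add_eq_zero, add_comm, ← h, add_comm]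

/-- Contraction is an antiderivation. The terms that add and remove the same index sum to the
pairing of `f` and `b`; the remaining ones cancel by `posSign_mul_posSign`. -/
theorem contract_wedge (f b : Fin q → A) (y : Finset (Fin q) → A) :
    contract f (wedge b y) = (∑ s, f s * b s) • y - wedge b (contract f y) := by
  rw [eq_sub_iff_add_eq]
  ext T
  rw [Pi.add_apply, contract_apply, wedge_apply, Pi.smul_apply, smul_eq_mul]
  have h1 : ∀ s ∈ Tᶜ, posSign A (insert s T) s * f s * wedge b y (insert s T) =
      f s * b s * y T + ∑ t ∈ T, posSign A (insert s T) s * posSign A (insert s T) t *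
        (f s * b t * y ((insert s T).erase t)) := by
    intro s hs
    rw [mem_compl] at hs
    rw [wedge_apply, sum_insert hs, erase_insert hs, mul_add, mul_sum]
    congr 1
    · linear_combination (f s * b s * y T) * posSign_mul_self (A := A) (insert s T) s
    · exact sum_congr rfl fun t _ => by ring
  have h2 : ∀ t ∈ T, posSign A T t * b t * contract f y (T.erase t) =
      f t * b t * y T + ∑ s ∈ Tᶜ, posSign A T t * posSign A (insert s (T.erase t)) s *
        (f s * b t * y (insert s (T.erase t))) := by
    intro t ht
    have : (T.erase t)ᶜ = insert t Tᶜ := by ext s; simp; try tauto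
    rw [contract_apply, this, sum_insert (by simpa using ht), insert_erase ht, mul_add, mul_sum]
    congr 1
    · linear_combination (f t * b t * y T) * posSign_mul_self (A := A) T t
    · exact sum_congr rfl fun s _ => by ring
  rw [sum_congr rfl h1, sum_congr rfl h2, sum_add_distrib, sum_add_distrib,
    sum_comm (s := T) (t := Tᶜ)]
  have h3 : ∑ s ∈ Tᶜ, ∑ t ∈ T, posSign A (insert s T) s * posSign A (insert s T) t *
        (f s * b t * y ((insert s T).erase t)) = - ∑ s ∈ Tᶜ, ∑ t ∈ T,
        posSign A T t * posSign A (insert s (T.erase t)) s *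
        (f s * b t * y (insert s (T.erase t))) := by
    rw [← sum_neg_distrib]
    refine sum_congr rfl fun s hs => ?_
    rw [← sum_neg_distrib]
    refine sum_congr rfl fun t ht => ?_
    rw [mem_compl] at hs
    have hst : s ≠ t := fun h => hs (h ▸ ht)
    rw [posSign_mul_posSign (mem_insert_self s T) (mem_insert_of_mem ht) hst,
      erase_insert hs, erase_insert_of_ne hst]
    ring
  rw [h3, ← sum_add_sum_compl T, add_mul, sum_mul, sum_mul]
  ring

/-- The successive contractions against the members of a list, the first one first. -/
def contractList : List (Fin q → A) → (Finset (Fin q) → A) → (Finset (Fin q) → A)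
  | [], x => x
  | f :: l, x => contractList l (contract f x)

theorem contractList_zero (l : List (Fin q → A)) : contractList l 0 = 0 := by
  induction l with
  | nil => rfl
  | cons f l ih => rw [contractList, map_zero, ih]

theorem maximalMinor_succ {m : ℕ} (B : Matrix (Fin (m + 1)) (Fin q) A) (T : Finset (Fin q))
    (hT : #T = m + 1) :
    maximalMinor B T hT = ∑ s ∈ T.attach, posSign A T s.1 * B 0 s.1 *
      maximalMinor (B.submatrix Fin.succ id) (T.erase s.1)
        (by rw [card_erase_of_mem s.2, hT]; rfl) := by
  let e := T.orderEmbOfFin hT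
  rw [maximalMinor, Matrix.det_succ_row_zero]
  refine Finset.sum_bij (fun i _ => (⟨e i, T.orderEmbOfFin_mem hT i⟩ : {s // s ∈ T}))
    (fun _ _ => mem_attach _ _) ?_ ?_ ?_
  · intro a _ b _ h
    exact e.injective (congrArg Subtype.val h)
  · rintro ⟨s, hs⟩ _
    have : s ∈ Set.range e := by rw [T.range_orderEmbOfFin hT]; exact hs
    obtain ⟨i, hi⟩ := this
    exact ⟨i, mem_univ _, Subtype.ext hi⟩
  · intro i _
    have hsign : ({t ∈ T | t < e i} : Finset (Fin q)) = (Finset.Iio i).map e.toEmbedding := by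
      ext t
      simp only [mem_filter, mem_map, mem_Iio]
      constructor
      · rintro ⟨h, h'⟩
        have : t ∈ Set.range e := by rw [T.range_orderEmbOfFin hT]; exact h
        obtain ⟨l, rfl⟩ := this
        exact ⟨l, e.lt_iff_lt.1 h', rfl⟩
      · rintro ⟨l, hl, rfl⟩
        exact ⟨T.orderEmbOfFin_mem hT l, e.lt_iff_lt.2 hl⟩
    have hc : #(T.erase (e i)) = m := by
      rw [card_erase_of_mem (T.orderEmbOfFin_mem hT i), hT]; rfl
    have hminor : (fun a => e (i.succAbove a)) = (T.erase (e i)).orderEmbOfFin hc := by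
      refine orderEmbOfFin_unique hc (fun a => ?_) ?_
      · refine mem_erase.2 ⟨fun h => ?_, T.orderEmbOfFin_mem hT _⟩
        exact Fin.succAbove_ne i a (e.injective h)
      · exact e.strictMono.comp (Fin.strictMono_succAbove i)
    have hdet : ((B.submatrix id e).submatrix Fin.succ i.succAbove) =
        (B.submatrix Fin.succ id).submatrix id ((T.erase (e i)).orderEmbOfFin hc) := by
      ext a b
      rw [← hminor]
      rfl
    simp only [posSign, maximalMinor, hsign, card_map, Fin.card_Iio]
    change _ * _ * (Matrix.det ((B.submatrix id e).submatrix Fin.succ i.succAbove)) = _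
    rw [hdet]
    rfl

/-- The maximal minor on the columns in `T`, or zero if `T` has the wrong size. -/
def minorOrZero {m : ℕ} (B : Matrix (Fin m) (Fin q) A) (T : Finset (Fin q)) : A :=
  if h : #T = m then maximalMinor B T h else 0

theorem minorOrZero_succ {m : ℕ} (B : Matrix (Fin (m + 1)) (Fin q) A) (T : Finset (Fin q)) :
    minorOrZero B T = ∑ s ∈ T, posSign A T s * B 0 s *
      minorOrZero (B.submatrix Fin.succ id) (T.erase s) := by
  rw [← sum_attach]
  by_cases h : #T = m + 1
  · rw [minorOrZero, dif_pos h, maximalMinor_succ]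
    refine sum_congr rfl fun s _ => ?_
    rw [minorOrZero, dif_pos]
  · rw [minorOrZero, dif_neg h]
    refine (sum_eq_zero fun s _ => ?_).symm
    rw [minorOrZero, dif_neg, mul_zero]
    rw [card_erase_of_mem s.2]
    have := card_pos.2 ⟨s.1, s.2⟩
    omega

/-- Laplace expansion of minors along the first row is adjoint to contraction against that row. -/
theorem sum_mul_minorOrZero_succ {m : ℕ} (B : Matrix (Fin (m + 1)) (Fin q) A)
    (x : Finset (Fin q) → A) :
    ∑ T, x T * minorOrZero B T =
      ∑ T, contract (B 0) x T * minorOrZero (B.submatrix Fin.succ id) T := by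
  have h1 : ∀ T, x T * minorOrZero B T = ∑ s, ∑ T' : Finset (Fin q), if s ∈ T ∧ T' = T.erase s then
      posSign A (insert s T') s * B 0 s * x (insert s T') *
        minorOrZero (B.submatrix Fin.succ id) T' else 0 := by
    intro T
    rw [minorOrZero_succ, mul_sum, ← sum_filter_add_sum_filter_not univ (· ∈ T),
      Finset.filter_mem_eq_inter, univ_inter]
    rw [sum_eq_zero (s := univ.filter (· ∉ T)) (fun s hs => by
      simp [(mem_filter.1 hs).2]), add_zero]
    refine sum_congr rfl fun s hs => ?_
    simp only [hs, true_and, sum_ite_eq', mem_univ, if_true, insert_erase]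
    ring
  have h2 : ∀ T', contract (B 0) x T' * minorOrZero (B.submatrix Fin.succ id) T' =
      ∑ s, ∑ T : Finset (Fin q), if s ∈ T ∧ T' = T.erase s then
      posSign A (insert s T') s * B 0 s * x (insert s T') *
        minorOrZero (B.submatrix Fin.succ id) T' else 0 := by
    intro T'
    rw [contract_apply, sum_mul, ← sum_filter_add_sum_filter_not univ (· ∉ T')]
    rw [sum_eq_zero (s := univ.filter (¬ · ∉ T')) (fun s hs => ?_), add_zero]
    · have : (univ.filter (· ∉ T')) = T'ᶜ := by ext; simp
      rw [this]
      refine sum_congr rfl fun s hs => ?_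
      have h3 : ∀ T, (s ∈ T ∧ T' = T.erase s) ↔ T = insert s T' := fun T => by
        constructor
        · rintro ⟨h, rfl⟩; rw [insert_erase h]
        · rintro rfl; simp [erase_insert (mem_compl.1 hs)]
      simp only [h3, sum_ite_eq', mem_univ, if_true]
    · refine sum_eq_zero fun T _ => if_neg ?_
      rintro ⟨_, rfl⟩
      simp at hs
  simp only [h1, h2]
  rw [sum_comm]
  conv_rhs => rw [sum_comm]
  exact sum_congr rfl fun s _ => sum_comm

/-- The row of maximal minors, which is the last map of the Eagon–Northcott complex, is the
composite of the contractions against all rows. This lets it be handled by the same homotopies as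
the higher differentials. -/
theorem contractList_rows_empty : ∀ {m : ℕ} (B : Matrix (Fin m) (Fin q) A)
    (x : Finset (Fin q) → A),
    contractList (List.ofFn B.row) x ∅ = ∑ T, x T * minorOrZero B T
  | 0, B, x => by
    rw [List.ofFn_zero, contractList, sum_eq_single ∅]
    · simp [minorOrZero, maximalMinor]
    · intro T _ hT
      rw [minorOrZero, dif_neg (by simpa using hT), mul_zero]
    · simp
  | m + 1, B, x => by
    rw [List.ofFn_succ, contractList, sum_mul_minorOrZero_succ, ← contractList_rows_empty]
    rfl

theorem contractList_eq_zero_of_card (l : List (Fin q → A)) (x : Finset (Fin q) → A)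
    (hx : ∀ T, #T ≠ l.length → x T = 0) (T : Finset (Fin q)) (hT : T ≠ ∅) :
    contractList l x T = 0 := by
  induction l generalizing x with
  | nil => exact hx T (by simpa using hT)
  | cons f l ih =>
    refine ih _ fun T hT => ?_
    rw [contract_apply]
    refine sum_eq_zero fun s hs => ?_
    rw [hx, mul_zero]
    rw [card_insert_of_notMem (mem_compl.1 hs), List.length_cons]
    omega

end Contraction

/-! ### The minors annihilate the homology of the Eagon–Northcott complex -/

section Strand

variable {A : Type v} [CommRing A] {p q : ℕ} (Z : Matrix (Fin p) (Fin q) A)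

/-- The differential of the Koszul complex of the columns of `Z`, acting as linear forms on the
inverse polynomials in `p` variables. The Eagon–Northcott complex is a strand of it. -/
def inverseKoszul : ((Fin p → ℕ) → Finset (Fin q) → A) →ₗ[A] ((Fin p → ℕ) → Finset (Fin q) → A) where
  toFun x a := ∑ j, contract (Z j) (x (a + Pi.single j 1))
  map_add' x y := by
    ext a : 1; simp only [Pi.add_apply, map_add, sum_add_distrib]
  map_smul' r x := by
    ext a : 1; simp only [Pi.smul_apply, map_smul, RingHom.id_apply, smul_sum]

theorem inverseKoszul_apply (x : (Fin p → ℕ) → Finset (Fin q) → A) (a : Fin p → ℕ) :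
    inverseKoszul Z x a = ∑ j, contract (Z j) (x (a + Pi.single j 1)) := rfl

theorem inverseKoszul_inverseKoszul (x : (Fin p → ℕ) → Finset (Fin q) → A) :
    inverseKoszul Z (inverseKoszul Z x) = 0 := by
  ext a T
  simp only [inverseKoszul_apply, map_sum, Finset.sum_apply]
  have : ∀ i ∈ (univ : Finset (Fin p)),
      ∑ j, contract (Z i) (contract (Z j) (x (a + Pi.single i 1 + Pi.single j 1))) T =
      ∑ j ∈ univ.erase i,
        contract (Z i) (contract (Z j) (x (a + Pi.single i 1 + Pi.single j 1))) T := by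
    intro i hi
    rw [← add_sum_erase _ _ hi, contract_contract_self]
    simp
  rw [sum_congr rfl this]
  refine sum_sum_erase_eq_zero _ _ fun i _ j _ _ => ?_
  rw [contract_contract, add_right_comm]
  rfl

/-- On cycles, exterior multiplication by `b` is a homotopy from zero to `δ` times multiplication by
the `i`-th variable on inverse polynomials, because `b` pairs to `δ` with row `i` and to zero with
the other rows. -/
theorem inverseKoszul_wedge {b : Fin q → A} {δ : A} {i : Fin p}
    (hb : ∀ j, ∑ s, Z j s * b s = if j = i then δ else 0)
    (v : (Fin p → ℕ) → Finset (Fin q) → A) (hv : inverseKoszul Z v = 0) :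
    inverseKoszul Z (fun a => wedge b (v a)) = fun a => δ • v (a + Pi.single i 1) := by
  ext a : 1
  have h : wedge b (inverseKoszul Z v a) = 0 := by rw [hv]; simp
  rw [inverseKoszul_apply, map_sum] at h
  rw [inverseKoszul_apply]
  simp only [contract_wedge, hb, sum_sub_distrib, h, sub_zero, ite_smul, zero_smul, sum_ite_eq',
    mem_univ, if_true]

/-- Induction on the list of variables that may occur in `x`, each of which costs one factor `δ`.
Dividing `x` by the variable `i` gives `x'`, whose boundary no longer involves `i`; the induction
hypothesis bounds `δ ^ l.length` times that boundary by some `w'`, so subtracting `w'` turns a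
multiple of `x'` into a cycle, and the homotopy for `i` recovers a multiple of `x`. -/
theorem exists_inverseKoszul_eq {b : Fin p → Fin q → A} {δ : A}
    (hb : ∀ i j, ∑ s, Z j s * b i s = if j = i then δ else 0) (l : List (Fin p)) :
    ∀ (_ : l.Nodup) (x : (Fin p → ℕ) → Finset (Fin q) → A)
      (_ : ∀ a i, i ∉ l → a i ≠ 0 → x a = 0) (_ : inverseKoszul Z x = 0)
      (_ : contractList (l.map Z.row) (x 0) = 0),
    ∃ w : (Fin p → ℕ) → Finset (Fin q) → A, (∀ a i, i ∉ l → a i ≠ 0 → w a = 0) ∧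
      inverseKoszul Z w = δ ^ l.length • x := by
  induction l with
  | nil =>
    intro _ x hx _ h0
    have : x = 0 := by
      ext a : 1
      by_cases ha : a = 0
      · rw [ha]; exact h0
      · obtain ⟨i, hi⟩ := Function.ne_iff.1 ha
        exact hx a i (by simp) hi
    exact ⟨0, fun _ _ _ _ => rfl, by rw [this]; simp⟩
  | cons i l ih =>
    intro hl x hx hdx h0
    obtain ⟨hil, hl⟩ := List.nodup_cons.1 hl
    let x' : (Fin p → ℕ) → Finset (Fin q) → A := fun a => if a i = 0 then 0 else x (a - Pi.single i 1)
    have hx' : ∀ a, x' (a + Pi.single i 1) = x a := by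
      intro a
      simp [x']
    have hx's : ∀ a j, j ∉ i :: l → a j ≠ 0 → x' a = 0 := by
      intro a j hj haj
      simp only [x']
      split_ifs with h
      · rfl
      · refine hx _ j hj ?_
        have : j ≠ i := fun h => hj (h ▸ List.mem_cons_self)
        simpa [this] using haj
    -- At exponents involving `i` the boundary of `x'` is a shift of the boundary of `x`, hence
    -- zero.
    have hy : ∀ a j, j ∉ l → a j ≠ 0 → inverseKoszul Z x' a = 0 := by
      intro a j hj haj
      by_cases hji : j = i
      · subst hji
        have : a = (a - Pi.single j 1) + Pi.single j 1 := by
          ext t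
          by_cases htj : t = j
          · subst htj; simp; omega
          · simp [htj]
        rw [inverseKoszul_apply, this]
        simp only [add_right_comm _ (Pi.single j 1 : Fin p → ℕ), hx']
        exact congrFun hdx _
      · rw [inverseKoszul_apply]
        refine sum_eq_zero fun t _ => ?_
        rw [hx's _ j (by simp [hji, hj]) (by simp [haj]), map_zero]
    have hy0 : inverseKoszul Z x' 0 = contract (Z i) (x 0) := by
      rw [inverseKoszul_apply, sum_eq_single i, hx']
      · intro j _ hj
        have : x' (0 + Pi.single j 1) = 0 := by simp [x', hj.symm]
        rw [this, map_zero]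
      · simp
    obtain ⟨w', hw's, hw'⟩ := ih hl (inverseKoszul Z x') hy (inverseKoszul_inverseKoszul Z x')
      (by rw [hy0]; exact h0)
    let v := δ ^ l.length • x' - w'
    have hv : inverseKoszul Z v = 0 := by
      simp only [v, map_sub, map_smul, hw', sub_self]
    refine ⟨fun a => wedge (b i) (v a), ?_, ?_⟩
    · intro a j hj haj
      have h1 := hx's a j hj haj
      have h2 := hw's a j (fun h => hj (List.mem_cons_of_mem _ h)) haj
      simp [v, h1, h2]
    · rw [inverseKoszul_wedge Z (hb i) v hv]
      ext a : 1
      have h2 := hw's (a + Pi.single i 1) i hil (by simp)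
      simp only [v, Pi.sub_apply, Pi.smul_apply, hx', h2, sub_zero, smul_smul, List.length_cons,
        pow_succ']

theorem sum_enEntry_mul (k : ℕ) {y : (Fin p → ℕ) × Finset (Fin q)} (hy : y ∈ enBasis p q k)
    (x : (Fin p → ℕ) → Finset (Fin q) → A) :
    ∑ z ∈ enBasis p q (k + 1), enEntry Z y z * x z.1 z.2 = inverseKoszul Z x y.1 y.2 := by
  have h1 : ∀ z ∈ enBasis p q (k + 1), enEntry Z y z * x z.1 z.2 =
      ∑ j, ∑ s ∈ y.2ᶜ, if z = (y.1 + Pi.single j 1, insert s y.2) then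
        posSign A (insert s y.2) s * Z j s * x (y.1 + Pi.single j 1) (insert s y.2) else 0 := by
    intro z _
    rw [enEntry, sum_comm, sum_mul]
    refine sum_congr rfl fun j _ => ?_
    rw [sum_mul]
    have e1 : ∀ s ∈ z.2, (if y.2 = z.2.erase s ∧ z.1 = y.1 + Pi.single j 1 then
        posSign A z.2 s * Z j s else 0) * x z.1 z.2 =
        if s ∉ y.2 ∧ z = (y.1 + Pi.single j 1, insert s y.2) then
        posSign A (insert s y.2) s * Z j s * x (y.1 + Pi.single j 1) (insert s y.2) else 0 := by
      intro s hs
      have : (y.2 = z.2.erase s ∧ z.1 = y.1 + Pi.single j 1) ↔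
          (s ∉ y.2 ∧ z = (y.1 + Pi.single j 1, insert s y.2)) := by
        constructor
        · rintro ⟨h1, h2⟩
          refine ⟨by rw [h1]; simp, Prod.ext h2 ?_⟩
          rw [h1]; simp [insert_erase hs]
        · rintro ⟨h1, h2⟩
          rw [h2]; simp [erase_insert h1]
      by_cases h : s ∉ y.2 ∧ z = (y.1 + Pi.single j 1, insert s y.2)
      · rw [if_pos (this.2 h), if_pos h]
        obtain ⟨_, rfl⟩ := h
        rfl
      · rw [if_neg (mt this.1 h), if_neg h, zero_mul]
    rw [sum_congr rfl e1]
    have e2 : ∑ s ∈ z.2, (if s ∉ y.2 ∧ z = (y.1 + Pi.single j 1, insert s y.2) then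
        posSign A (insert s y.2) s * Z j s * x (y.1 + Pi.single j 1) (insert s y.2) else 0) =
        ∑ s, (if s ∉ y.2 ∧ z = (y.1 + Pi.single j 1, insert s y.2) then
        posSign A (insert s y.2) s * Z j s * x (y.1 + Pi.single j 1) (insert s y.2) else 0) := by
      refine sum_subset (subset_univ _) fun s _ hs => if_neg ?_
      rintro ⟨_, rfl⟩
      exact hs (mem_insert_self _ _)
    rw [e2]
    simp only [ite_and]
    rw [← sum_filter]
    refine sum_congr ?_ fun _ _ => rfl
    ext; simp
  rw [sum_congr rfl h1, sum_comm, inverseKoszul_apply, Finset.sum_apply]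
  refine sum_congr rfl fun j _ => ?_
  rw [sum_comm, contract_apply]
  refine sum_congr rfl fun s hs => ?_
  rw [sum_ite_eq', if_pos]
  refine mem_enBasis ?_ ?_
  · simp [Finset.sum_add_distrib, enBasis_sum hy]
  · simp only
    rw [card_insert_of_notMem (mem_compl.1 hs), enBasis_card hy]; rfl

/-- Extension by zero of the coordinates of an element of a term of the complex. -/
def extendByZero {k : ℕ} (z : ↥(enBasis p q k) → A) : (Fin p → ℕ) → Finset (Fin q) → A :=
  fun a T => if h : (a, T) ∈ enBasis p q k then z ⟨(a, T), h⟩ else 0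

theorem extendByZero_coe {k : ℕ} (z : ↥(enBasis p q k) → A) (y : ↥(enBasis p q k)) :
    extendByZero z y.1.1 y.1.2 = z y := by
  simp [extendByZero]

theorem enDifferential_succ_mulVec (k : ℕ) (x : (Fin p → ℕ) → Finset (Fin q) → A)
    (y : ↥(enBasis p q k)) :
    (∑ z : ↥(enBasis p q (k + 1)), enDifferential Z (k + 1) y z * x z.1.1 z.1.2) =
      inverseKoszul Z x y.1.1 y.1.2 :=
  (Finset.sum_coe_sort (enBasis p q (k + 1))
    (fun z => enEntry Z y.1 z * x z.1 z.2)).trans (sum_enEntry_mul Z k y.2 x)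

theorem inverseKoszul_extendByZero_of_notMem {k : ℕ} (z : ↥(enBasis p q (k + 1)) → A)
    (a : Fin p → ℕ) (T : Finset (Fin q)) (h : (a, T) ∉ enBasis p q k) :
    inverseKoszul Z (extendByZero z) a T = 0 := by
  rw [inverseKoszul_apply, Finset.sum_apply]
  refine sum_eq_zero fun j _ => ?_
  rw [contract_apply]
  refine sum_eq_zero fun s hs => ?_
  rw [extendByZero, dif_neg, mul_zero]
  intro h'
  apply h
  have h1 := enBasis_sum h'
  have h2 := enBasis_card h'
  simp only at h1 h2
  rw [card_insert_of_notMem (mem_compl.1 hs)] at h2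
  simp only [Pi.add_apply, sum_add_distrib, Fintype.sum_pi_single'] at h1
  exact mem_enBasis (by simp only; omega) (by simp only; omega)

/-- The vectors are the columns of the adjugate of the square block on `T`, extended by zero to the
other indices. -/
theorem exists_columns_of_minor (T : Finset (Fin q)) (hT : #T = p) :
    ∃ b : Fin p → Fin q → A, ∀ i j, ∑ s, Z j s * b i s =
      if j = i then maximalMinor Z T hT else 0 := by
  let e := T.orderEmbOfFin hT
  let Y := Z.submatrix id e
  refine ⟨fun i s => ∑ t, if s = e t then Y.adjugate t i else 0, fun i j => ?_⟩
  have h := congrFun (congrFun (Matrix.mul_adjugate Y) j) i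
  rw [Matrix.smul_apply, Matrix.one_apply, smul_eq_mul, mul_ite, mul_one, mul_zero] at h
  change _ = if j = i then Y.det else 0
  rw [← h, Matrix.mul_apply]
  simp only [mul_sum]
  rw [sum_comm]
  refine sum_congr rfl fun t _ => ?_
  simp only [mul_ite, mul_zero, sum_ite_eq', mem_univ, if_true]
  rfl

/-- The exponent `p` is the number of rows: the homotopies remove them one at a time, each at the
cost of one factor of the minor. -/
theorem exists_enDifferential_eq_minor_pow_smul (T : Finset (Fin q)) (hT : #T = p) :
    ∀ (i : ℕ) (z : (eagonNorthcott Z).ι (i + 1) → A),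
      ((eagonNorthcott Z).d i).mulVec z = 0 →
      ∃ w, ((eagonNorthcott Z).d (i + 1)).mulVec w = maximalMinor Z T hT ^ p • z := by
  intro i z hz
  change ↥(enBasis p q i) → A at z
  obtain ⟨b, hb⟩ := exists_columns_of_minor Z T hT
  have hcyc : inverseKoszul Z (extendByZero z) = 0 := by
    ext a T
    cases i with
    | zero =>
      rw [inverseKoszul_apply, Finset.sum_apply]
      refine sum_eq_zero fun j _ => ?_
      rw [contract_apply]
      refine sum_eq_zero fun s hs => ?_
      rw [extendByZero, dif_neg, mul_zero]
      intro h'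
      have h1 := enBasis_sum h'
      simp [sum_add_distrib] at h1
    | succ i =>
      by_cases h : (a, T) ∈ enBasis p q i
      · have := congrFun hz ⟨(a, T), h⟩
        rw [← enDifferential_succ_mulVec Z i _ ⟨(a, T), h⟩]
        simp only [extendByZero_coe]
        exact this
      · exact inverseKoszul_extendByZero_of_notMem Z z a T h
  have h0 : contractList ((List.finRange p).map Z.row) (extendByZero z 0) = 0 := by
    cases i with
    | zero =>
      -- In degree one only the exponent 0 occurs, and the cycle condition says that the row of
      -- minors kills `z`, that is, that the full contraction of `z` against the rows vanishes.
      rw [← List.ofFn_eq_map]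
      ext T
      by_cases hT : T = ∅
      · subst hT
        rw [contractList_rows_empty]
        have := congrFun hz ()
        refine Eq.trans ?_ this
        change _ = ∑ y : ↥(enBasis p q 0), maximalMinor Z y.1.2 (enBasis_card y.2) * z y
        symm
        refine Finset.sum_of_injOn (fun y => y.1.2) ?_ (fun _ _ => mem_coe.2 (mem_univ _)) ?_ ?_
        · rintro ⟨⟨a, T⟩, ha⟩ _ ⟨⟨a', T'⟩, ha'⟩ _ h
          have e : ∀ a : Fin p → ℕ, ∑ j, a j = 0 → a = 0 := fun a h => by
            funext j; exact (Finset.sum_eq_zero_iff.1 h) j (mem_univ j)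
          have h1 := e a (enBasis_sum ha)
          have h2 := e a' (enBasis_sum ha')
          simp only at h
          subst h1 h2 h
          rfl
        · intro T _ hT
          have : #T ≠ p := by
            intro h
            refine hT ⟨⟨(0, T), mem_enBasis (by simp) (by simpa using h)⟩, mem_coe.2 (mem_univ _), rfl⟩
          rw [minorOrZero, dif_neg this, mul_zero]
        · rintro ⟨⟨a, T⟩, ha⟩ _
          have h1 : a = 0 := by
            funext j; exact (Finset.sum_eq_zero_iff.1 (enBasis_sum ha)) j (mem_univ j)
          subst h1
          have h2 : #T = p := enBasis_card ha
          rw [minorOrZero, dif_pos h2, extendByZero, dif_pos ha, mul_comm]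
      · refine contractList_eq_zero_of_card _ _ (fun T hT => ?_) T hT
        rw [extendByZero, dif_neg]
        intro h
        exact hT (by rw [List.length_ofFn]; exact enBasis_card h)
    | succ i =>
      have : extendByZero z 0 = 0 := by
        ext T
        rw [extendByZero, dif_neg]
        · rfl
        · intro h
          have := enBasis_sum h
          simp at this
      rw [this, contractList_zero]
  obtain ⟨w, -, hw⟩ := exists_inverseKoszul_eq Z hb (List.finRange p) (List.nodup_finRange p)
    (extendByZero z) (fun a i hi => absurd (List.mem_finRange i) hi) hcyc h0
  rw [List.length_finRange] at hw
  refine ⟨fun y : ↥(enBasis p q (i + 1)) => w y.1.1 y.1.2, ?_⟩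
  funext y
  change ↥(enBasis p q i) at y
  refine (enDifferential_succ_mulVec Z i w y).trans ?_
  rw [hw]
  change _ * extendByZero z y.1.1 y.1.2 = _ * z y
  rw [extendByZero_coe]

theorem exists_enDifferential_zero_eq {a : A} (ha : a ∈ maximalMinorIdeal Z)
    (z : (eagonNorthcott Z).ι 0 → A) :
    ∃ w, ((eagonNorthcott Z).d 0).mulVec w = a • z := by
  change Unit → A at z
  suffices a ∈ boundaryColon ((eagonNorthcott Z).d 0).mulVecLin z from
    (mem_boundaryColon _ _ _).1 this
  refine (Ideal.span_le.2 ?_ : maximalMinorIdeal Z ≤ _) ha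
  rintro _ ⟨T, hT, rfl⟩
  refine (mem_boundaryColon _ _ _).2 ⟨fun y : ↥(enBasis p q 0) => if y.1.2 = T then z () else 0, ?_⟩
  funext u
  change ∑ y : ↥(enBasis p q 0), maximalMinor Z y.1.2 (enBasis_card y.2) *
    (if y.1.2 = T then z () else 0) = maximalMinor Z T hT * z ()
  have h0 : ((0 : Fin p → ℕ), T) ∈ enBasis p q 0 := mem_enBasis (by simp) (by simpa using hT)
  rw [sum_eq_single ⟨(0, T), h0⟩]
  · simp
  · rintro ⟨⟨a, T'⟩, ha⟩ _ hne
    rw [if_neg, mul_zero]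
    rintro rfl
    apply hne
    have h1 : a = 0 := by
      funext j; exact (Finset.sum_eq_zero_iff.1 (enBasis_sum ha)) j (mem_univ j)
    subst h1
    rfl
  · simp

end Strand

/-! ### Systems of parameters -/

section Parameters

variable {A : Type v} [CommRing A] [IsLocalRing A] [IsNoetherianRing A]

open IsLocalRing

/-- An element outside all nonmaximal minimal primes of `I` lowers the bound on coheights by one.
The supply `f` is left open so that parameters can be drawn from the whole ideal of the origin or
from the linear forms alone. -/
theorem exists_parameters {W : Type*} (f : W → A)
    (hf : ∀ s : Set (Ideal A), s.Finite → (∀ P ∈ s, P.IsPrime ∧ P ≠ maximalIdeal A) →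
      ∃ w, ∀ P ∈ s, f w ∉ P) (d : ℕ) :
    ∀ (I : Ideal A) (_ : ∀ P : PrimeSpectrum A, I ≤ P.asIdeal → Order.coheight P ≤ d),
    ∃ ws : List W, ws.length = d ∧
      maximalIdeal A ≤ (I ⊔ Ideal.ofList (ws.map f)).radical := by
  induction d with
  | zero =>
    intro I hI
    refine ⟨[], rfl, ?_⟩
    rw [List.map_nil, Ideal.ofList_nil, sup_bot_eq, Ideal.radical_eq_sInf]
    refine le_sInf fun P hP => ?_
    have hP' := hP.2
    have h := hI ⟨P, hP'⟩ hP.1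
    have h0 : Order.coheight (⟨P, hP'⟩ : PrimeSpectrum A) = 0 := by simpa using h
    rw [Order.coheight_eq_zero] at h0
    exact h0 (b := closedPoint A) (le_maximalIdeal hP'.ne_top)
  | succ d ih =>
    intro I hI
    obtain ⟨w, hw⟩ := hf {P | P ∈ I.minimalPrimes ∧ P ≠ maximalIdeal A}
      ((I.finite_minimalPrimes_of_isNoetherianRing).subset fun P hP => hP.1)
      (fun P hP => ⟨hP.1.1.1, hP.2⟩)
    obtain ⟨ws, hlen, hws⟩ := ih (I ⊔ Ideal.span {f w}) (fun P hP => by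
      have hP' := P.2
      obtain ⟨Q, hQ, hQP⟩ := Ideal.exists_minimalPrimes_le (le_sup_left.trans hP)
      have hQ' : Q.IsPrime := hQ.1.1
      have hwP : f w ∈ P.asIdeal := hP (Ideal.mem_sup_right (Ideal.mem_span_singleton_self _))
      by_cases hQm : Q = maximalIdeal A
      · have : Order.coheight P = 0 := by
          rw [Order.coheight_eq_zero]
          intro P' _
          exact (le_maximalIdeal P'.2.ne_top).trans (hQm ▸ hQP)
        rw [this]; simp
      · have hlt : (⟨Q, hQ'⟩ : PrimeSpectrum A) < P := by
          refine lt_of_le_of_ne hQP fun h => hw Q ⟨hQ, hQm⟩ ?_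
          rw [← h] at hwP
          exact hwP
        have h1 := (Order.coheight_add_one_le hlt).trans (hI ⟨Q, hQ'⟩ hQ.1.2)
        rw [Nat.cast_add, Nat.cast_one] at h1
        exact (ENat.add_le_add_iff_right (by simp)).1 h1)
    refine ⟨w :: ws, by simp [hlen], ?_⟩
    rwa [List.map_cons, Ideal.ofList_cons, ← sup_assoc]

/-- In `A ⧸ P` the maximal ideal is minimal over the images of `gs`. Krull's theorem bounds its
height, which is the coheight of `P`. -/
theorem coheight_le_length_of_radical (I : Ideal A) (gs : List A)
    (hgs : ∀ g ∈ gs, g ∈ maximalIdeal A)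
    (h : maximalIdeal A ≤ (I ⊔ Ideal.ofList gs).radical) (P : PrimeSpectrum A)
    (hP : I ≤ P.asIdeal) : Order.coheight P ≤ gs.length := by
  classical
  have hP' := P.2
  have : IsLocalRing (A ⧸ P.asIdeal) :=
    IsLocalRing.of_surjective' (Ideal.Quotient.mk P.asIdeal) Ideal.Quotient.mk_surjective
  have hmax : ∀ x, x ∈ maximalIdeal A → Ideal.Quotient.mk P.asIdeal x ∈
      maximalIdeal (A ⧸ P.asIdeal) := fun x hx => by
    have := Ideal.mem_map_of_mem (Ideal.Quotient.mk P.asIdeal) hx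
    refine le_maximalIdeal (fun htop => ?_) this
    have h1 := congrArg (Ideal.comap (Ideal.Quotient.mk P.asIdeal)) htop
    rw [Ideal.comap_map_of_surjective _ Ideal.Quotient.mk_surjective, Ideal.comap_top,
      ← RingHom.ker_eq_comap_bot, Ideal.mk_ker, sup_eq_left.2 (le_maximalIdeal hP'.ne_top)] at h1
    exact (maximalIdeal.isMaximal A).ne_top h1
  have hmin : maximalIdeal (A ⧸ P.asIdeal) ∈ (Ideal.span
      (((gs.map (Ideal.Quotient.mk P.asIdeal)).toFinset : Finset _) : Set _)).minimalPrimes := by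
    refine ⟨⟨inferInstance, Ideal.span_le.2 fun y hy => ?_⟩, fun Q hQ _ => ?_⟩
    · rw [List.coe_toFinset] at hy
      obtain ⟨x, hx, rfl⟩ := List.mem_map.1 hy
      exact hmax x (hgs x hx)
    · have hQ' := hQ.1
      have h1 : maximalIdeal A ≤ Q.comap (Ideal.Quotient.mk P.asIdeal) := by
        refine h.trans ((Ideal.IsPrime.isRadical inferInstance).radical_le_iff.2 (sup_le ?_ ?_))
        · intro x hx
          rw [Ideal.mem_comap, Ideal.Quotient.eq_zero_iff_mem.2 (hP hx)]
          exact Q.zero_mem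
        · refine Ideal.span_le.2 fun x hx => hQ.2 (Ideal.subset_span ?_)
          rw [List.coe_toFinset]
          exact List.mem_map_of_mem hx
      intro y hy
      obtain ⟨x, rfl⟩ := Ideal.Quotient.mk_surjective y
      refine h1 ?_
      rw [mem_maximalIdeal, mem_nonunits_iff] at hy ⊢
      exact fun hx => hy (hx.map _)
  have h2 := Ideal.height_le_card_of_mem_minimalPrimes_span_finset hmin
  have h3 : (Order.coheight P : WithBot ℕ∞) = (maximalIdeal (A ⧸ P.asIdeal)).height := by
    rw [IsLocalRing.maximalIdeal_height_eq_ringKrullDim, ringKrullDim_quotient,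
      Order.coheight_eq_krullDim_Ici]
    rfl
  rw [WithBot.coe_inj] at h3
  rw [h3]
  refine h2.trans ?_
  have h4 := List.toFinset_card_le (gs.map (Ideal.Quotient.mk P.asIdeal))
  rw [List.length_map] at h4
  exact_mod_cast h4

end Parameters

/-! ### Parameters at the origin of affine space -/

section Polynomial

open MvPolynomial

variable (σ : Type*) (k : Type*) [Field k]

/-- The ideal of the polynomials that vanish at the origin. -/
noncomputable def originIdeal : Ideal (MvPolynomial σ k) := RingHom.ker constantCoeff

instance : (originIdeal σ k).IsPrime := RingHom.ker_isPrime _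

variable {σ k}

theorem mem_originIdeal {f : MvPolynomial σ k} : f ∈ originIdeal σ k ↔ constantCoeff f = 0 :=
  RingHom.mem_ker

theorem originIdeal_eq_idealOfVars : originIdeal σ k = idealOfVars σ k := by
  ext f
  rw [mem_originIdeal, ← pow_one (idealOfVars σ k), mem_pow_idealOfVars_iff']
  constructor
  · intro h x hx
    rw [Nat.lt_one_iff, Finsupp.degree_eq_zero_iff] at hx
    rw [hx]; exact h
  · intro h
    exact h 0 (by simp)

/-- Elements `g₁, …, g_s` of the ideal `𝔪` of the origin that generate an `𝔪`-primary ideal in the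
local ring at the origin of the quotient by `I`. -/
def HasParameters (I : Ideal (MvPolynomial σ k)) (gs : List (MvPolynomial σ k)) : Prop :=
  (∀ g ∈ gs, constantCoeff g = 0) ∧ ∀ v, constantCoeff v = 0 →
    ∃ u, ∃ N : ℕ, constantCoeff u ≠ 0 ∧ u * v ^ N ∈ I ⊔ Ideal.ofList gs

/-- The local ring of affine space at the origin. -/
abbrev OriginLocal (σ : Type*) (k : Type*) [Field k] := Localization.AtPrime (originIdeal σ k)

/-- Clearing denominators: the factor `u` is a unit in the local ring. -/
theorem maximalIdeal_le_radical_map_iff (J : Ideal (MvPolynomial σ k)) :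
    IsLocalRing.maximalIdeal (OriginLocal σ k) ≤
      (J.map (algebraMap _ (OriginLocal σ k))).radical ↔
    ∀ v, constantCoeff v = 0 → ∃ u, ∃ N : ℕ, constantCoeff u ≠ 0 ∧ u * v ^ N ∈ J := by
  rw [← Localization.AtPrime.map_eq_maximalIdeal]
  constructor
  · intro h v hv
    obtain ⟨N, hN⟩ := h (Ideal.mem_map_of_mem _ (mem_originIdeal.2 hv))
    rw [← map_pow, IsLocalization.mem_map_algebraMap_iff (originIdeal σ k).primeCompl] at hN
    obtain ⟨⟨j, s⟩, hjs⟩ := hN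
    rw [← map_mul, IsLocalization.eq_iff_exists (originIdeal σ k).primeCompl] at hjs
    obtain ⟨c, hc⟩ := hjs
    refine ⟨c * s, N, ?_, ?_⟩
    · have := (c * s).2
      exact fun h => this (mem_originIdeal.2 h)
    · have : (c : MvPolynomial σ k) * s * v ^ N = c * j := by rw [← hc]; ring
      rw [this]
      exact J.mul_mem_left _ j.2
  · intro h
    refine Ideal.map_le_iff_le_comap.2 fun v hv => ?_
    obtain ⟨u, N, hu, huv⟩ := h v (mem_originIdeal.1 hv)
    refine ⟨N, ?_⟩
    have h1 := Ideal.mem_map_of_mem (algebraMap _ (OriginLocal σ k)) huv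
    rw [map_mul, map_pow] at h1
    have h2 : IsUnit (algebraMap _ (OriginLocal σ k) u) :=
      IsLocalization.map_units (M := (originIdeal σ k).primeCompl) _
        ⟨u, fun h => hu (mem_originIdeal.1 h)⟩
    exact (Ideal.unit_mul_mem_iff_mem _ h2).1 h1

theorem map_sup_ofList (I : Ideal (MvPolynomial σ k)) (gs : List (MvPolynomial σ k)) :
    (I ⊔ Ideal.ofList gs).map (algebraMap _ (OriginLocal σ k)) =
      I.map (algebraMap _ (OriginLocal σ k)) ⊔
        Ideal.ofList (gs.map (algebraMap _ (OriginLocal σ k))) := by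
  rw [Ideal.map_sup, Ideal.map_ofList]

theorem HasParameters.maximalIdeal_le {I : Ideal (MvPolynomial σ k)}
    {gs : List (MvPolynomial σ k)} (h : HasParameters I gs) :
    IsLocalRing.maximalIdeal (OriginLocal σ k) ≤ (I.map (algebraMap _ (OriginLocal σ k)) ⊔
      Ideal.ofList (gs.map (algebraMap _ (OriginLocal σ k)))).radical := by
  rw [← map_sup_ofList]
  exact (maximalIdeal_le_radical_map_iff _).2 h.2

theorem algebraMap_mem_maximalIdeal {v : MvPolynomial σ k} (hv : constantCoeff v = 0) :
    algebraMap _ (OriginLocal σ k) v ∈ IsLocalRing.maximalIdeal (OriginLocal σ k) := by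
  rw [← Localization.AtPrime.map_eq_maximalIdeal]
  exact Ideal.mem_map_of_mem _ (mem_originIdeal.2 hv)

theorem hasParameters_map_iff {I : Ideal (MvPolynomial σ k)} {W : Type*}
    (f : W → MvPolynomial σ k) (hf : ∀ w, constantCoeff (f w) = 0) (ws : List W)
    (h : IsLocalRing.maximalIdeal (OriginLocal σ k) ≤ (I.map (algebraMap _ (OriginLocal σ k)) ⊔
      Ideal.ofList (ws.map fun w => algebraMap _ (OriginLocal σ k) (f w))).radical) :
    HasParameters I (ws.map f) := by
  refine ⟨fun g hg => ?_, ?_⟩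
  · obtain ⟨w, _, rfl⟩ := List.mem_map.1 hg
    exact hf w
  · rw [← maximalIdeal_le_radical_map_iff, map_sup_ofList, List.map_map]
    exact h

theorem height_originIdeal_le [Fintype σ] : (originIdeal σ k).height ≤ Fintype.card σ := by
  have h : originIdeal σ k ∈ (Ideal.span (Set.range (X : σ → MvPolynomial σ k))).minimalPrimes := by
    change _ ∈ (idealOfVars σ k).minimalPrimes
    rw [← originIdeal_eq_idealOfVars, Ideal.minimalPrimes_eq_subsingleton_self]
    rfl
  refine (Ideal.height_le_card_of_mem_minimalPrimes_span (Set.finite_range _) h).trans ?_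
  rw [← Set.image_univ]
  have := Set.ncard_image_le (f := (X : σ → MvPolynomial σ k)) (Set.finite_univ (α := σ))
  rw [Set.ncard_univ, Nat.card_eq_fintype_card] at this
  exact_mod_cast this

/-- In the local ring at the origin, height plus coheight of a prime is at most the number of
variables, so primes over `I` have coheight at most `card σ - c`. The elements themselves come from
prime avoidance inside the ideal of the origin. -/
theorem exists_hasParameters_of_height [Fintype σ] {I : Ideal (MvPolynomial σ k)} {c : ℕ}
    (hc : (c : ℕ∞) ≤ I.height) :
    ∃ gs : List (MvPolynomial σ k), gs.length = Fintype.card σ - c ∧ HasParameters I gs := by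
  have key := exists_parameters
    (fun w : originIdeal σ k => algebraMap _ (OriginLocal σ k) w.1) ?_
    (Fintype.card σ - c) (I.map (algebraMap _ (OriginLocal σ k))) ?_
  · obtain ⟨ws, hlen, hws⟩ := key
    exact ⟨ws.map Subtype.val, by simp [hlen], hasParameters_map_iff Subtype.val
      (fun w => mem_originIdeal.1 w.2) ws hws⟩
  · intro s hs hP
    by_contra hcon
    push Not at hcon
    have hsub : ((originIdeal σ k : Ideal _) : Set (MvPolynomial σ k)) ⊆
        ⋃ P ∈ (hs.toFinset : Set (Ideal (OriginLocal σ k))),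
          ((P.comap (algebraMap (MvPolynomial σ k) (OriginLocal σ k)) : Ideal (MvPolynomial σ k)) :
            Set (MvPolynomial σ k)) := by
      intro w hw
      obtain ⟨P, hPs, hwP⟩ := hcon ⟨w, hw⟩
      rw [Set.mem_iUnion₂]
      exact ⟨P, by simpa using hPs, hwP⟩
    rw [Ideal.subset_union_prime ⊥ ⊥ (fun P hPs _ _ => by
      have := (hP P (by simpa using hPs)).1
      infer_instance)] at hsub
    obtain ⟨P, hPs, hle⟩ := hsub
    have hPs' := hP P (by simpa using hPs)
    apply hPs'.2
    refine ((IsLocalRing.maximalIdeal.isMaximal _).eq_of_le hPs'.1.ne_top ?_).symm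
    rw [← Localization.AtPrime.map_eq_maximalIdeal]
    exact Ideal.map_le_iff_le_comap.2 hle
  · intro P hP
    have h1 : Order.height P + Order.coheight P ≤ Fintype.card σ := by
      have h2 : ((Order.height P + Order.coheight P : ℕ∞) : WithBot ℕ∞) ≤
          Order.krullDim (PrimeSpectrum (OriginLocal σ k)) := by
        rw [Order.krullDim_eq_iSup_height_add_coheight_of_nonempty, WithBot.coe_le_coe]
        exact le_iSup (fun P => Order.height P + Order.coheight P) P
      have h3 := IsLocalization.AtPrime.ringKrullDim_eq_height (originIdeal σ k) (OriginLocal σ k)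
      rw [ringKrullDim] at h3
      rw [h3, WithBot.coe_le_coe] at h2
      exact h2.trans height_originIdeal_le
    have h4 : (c : ℕ∞) ≤ Order.height P := by
      rw [← PrimeSpectrum.height_eq_orderHeight,
        ← IsLocalization.height_under (originIdeal σ k).primeCompl]
      exact hc.trans (Ideal.height_mono (Ideal.map_le_iff_le_comap.1 hP))
    have h5 : (c : ℕ∞) + Order.coheight P ≤ Fintype.card σ := (add_le_add_left h4 _).trans h1
    generalize Order.coheight P = t at h5
    cases t with
    | top => simp at h5
    | coe t =>
      norm_cast at h5 ⊢
      omega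

/-- The linear form with given coefficients. -/
noncomputable def linearForm [Fintype σ] : (σ → k) →ₗ[k] MvPolynomial σ k :=
  Fintype.linearCombination k X

theorem linearForm_apply [Fintype σ] (w : σ → k) :
    linearForm w = ∑ i, C (w i) * (X i : MvPolynomial σ k) := by
  simp [linearForm, Fintype.linearCombination_apply, smul_eq_C_mul]

theorem constantCoeff_linearForm [Fintype σ] (w : σ → k) : constantCoeff (linearForm w) = 0 := by
  simp [linearForm_apply]

/-- A nonmaximal prime of the local ring does not contain all linear forms, and a vector space over
an infinite field is not a finite union of proper subspaces. The given `gs` serve only to bound the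
coheights. -/
theorem HasParameters.exists_linearForms [Fintype σ] [Infinite k] {I : Ideal (MvPolynomial σ k)}
    {gs : List (MvPolynomial σ k)} (h : HasParameters I gs) :
    ∃ ws : List (σ → k), ws.length = gs.length ∧ HasParameters I (ws.map linearForm) := by
  classical
  have key := exists_parameters
    (fun w : σ → k => algebraMap _ (OriginLocal σ k) (linearForm w)) ?_
    gs.length (I.map (algebraMap _ (OriginLocal σ k))) ?_
  · obtain ⟨ws, hlen, hws⟩ := key
    exact ⟨ws, hlen, hasParameters_map_iff _ constantCoeff_linearForm ws hws⟩
  · intro s hs hP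
    let t : Finset (Subspace k (σ → k)) := hs.toFinset.image fun P =>
      ((P.comap (algebraMap _ (OriginLocal σ k))).restrictScalars k).comap linearForm
    have ht : ⊤ ∉ t := by
      intro htop
      obtain ⟨P, hPs, hPtop⟩ := Finset.mem_image.1 htop
      have hPs' := hP P (by simpa using hPs)
      apply hPs'.2
      refine ((IsLocalRing.maximalIdeal.isMaximal _).eq_of_le hPs'.1.ne_top ?_).symm
      rw [← Localization.AtPrime.map_eq_maximalIdeal]
      refine Ideal.map_le_iff_le_comap.2 (originIdeal_eq_idealOfVars.le.trans (Ideal.span_le.2 ?_))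
      rintro _ ⟨i, rfl⟩
      have h1 : (Pi.single i 1 : σ → k) ∈ (⊤ : Subspace k (σ → k)) := trivial
      rw [← hPtop] at h1
      have h2 : linearForm (Pi.single i 1 : σ → k) = X i := by
        rw [linearForm_apply, Finset.sum_eq_single i] <;> simp +contextual
      have h3 : linearForm (Pi.single i 1 : σ → k) ∈ P.comap (algebraMap _ (OriginLocal σ k)) := h1
      rwa [h2] at h3
    obtain ⟨w, hw⟩ := (Set.ne_univ_iff_exists_notMem _).1
      (Subspace.biUnion_ne_univ_of_top_notMem ht)
    refine ⟨w, fun P hPs hwP => hw ?_⟩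
    rw [Set.mem_iUnion₂]
    exact ⟨_, Finset.mem_image_of_mem _ (by simpa using hPs), hwP⟩
  · intro P hP
    have := coheight_le_length_of_radical _ _ (fun g hg => ?_) h.maximalIdeal_le P hP
    · simpa using this
    · obtain ⟨g, hg', rfl⟩ := List.mem_map.1 hg
      exact algebraMap_mem_maximalIdeal (h.1 g hg')

/-- The substitution of linear forms in new variables for the variables. -/
noncomputable def linearSubst {τ : Type*} [Fintype τ] (a : σ → τ → k) :
    MvPolynomial σ k →ₐ[k] MvPolynomial τ k :=
  aeval fun i => linearForm (a i)

theorem linearSubst_linearForm {τ : Type*} [Fintype σ] [Fintype τ] (a : (σ → k) →ₗ[k] (τ → k))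
    [DecidableEq σ] (w : σ → k) :
    linearSubst (fun i => a (Pi.single i 1)) (linearForm w) = linearForm (a w) := by
  rw [linearForm_apply, map_sum]
  have : a w = ∑ i, w i • a (Pi.single i 1) := by
    conv_lhs => rw [pi_eq_sum_univ' w, map_sum]
    exact Finset.sum_congr rfl fun i _ => by rw [map_smul]
  rw [this, map_sum]
  refine Finset.sum_congr rfl fun i _ => ?_
  rw [map_mul, map_smul, smul_eq_C_mul]
  simp [linearSubst]

theorem constantCoeff_linearSubst {τ : Type*} [Fintype τ] (a : σ → τ → k) (f : MvPolynomial σ k) :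
    constantCoeff (linearSubst a f) = constantCoeff f := by
  induction f using MvPolynomial.induction_on with
  | C r => simp [linearSubst]
  | add f g hf hg => simp [hf, hg]
  | mul_X f i hf => simp [linearSubst, constantCoeff_linearForm]

/-- Once the parameters are linear forms, setting them to zero is a substitution of linear forms in
fewer variables. -/
theorem HasParameters.exists_linearSubst [Fintype σ] [Infinite k] {I : Ideal (MvPolynomial σ k)}
    {gs : List (MvPolynomial σ k)} (h : HasParameters I gs) {c : ℕ}
    (hc : gs.length + c ≤ Fintype.card σ) :
    ∃ a : σ → Fin c → k, HasParameters (I.map (linearSubst a)) [] := by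
  classical
  obtain ⟨ws, hlen, hws⟩ := h.exists_linearForms
  let L : Submodule k (σ → k) := Submodule.span k {w | w ∈ ws}
  have hL : Module.finrank k L ≤ gs.length := by
    have h1 : {w | w ∈ ws} = ((ws.toFinset : Finset _) : Set (σ → k)) := by simp
    have h2 := finrank_span_finset_le_card (R := k) ws.toFinset
    have h3 := List.toFinset_card_le ws
    rw [← h1] at h2
    exact (h2.trans h3).trans hlen.le
  have hq : c ≤ Module.finrank k ((σ → k) ⧸ L) := by
    have := L.finrank_quotient_add_finrank
    rw [Module.finrank_fintype_fun_eq_card] at this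
    omega
  -- The quotient by the span of the parameters may have dimension more than `c`; keeping `c`
  -- coordinates sets further linear forms to zero, which does no harm.
  let π : (σ → k) →ₗ[k] (Fin c → k) := LinearMap.funLeft k k (Fin.castLE hq) ∘ₗ
    (Module.finBasis k ((σ → k) ⧸ L)).equivFun.toLinearMap ∘ₗ L.mkQ
  have hπ : Function.Surjective π :=
    (LinearMap.funLeft_surjective_of_injective k k _ (Fin.castLE_injective hq)).comp
      ((Module.finBasis k ((σ → k) ⧸ L)).equivFun.surjective.comp L.mkQ_surjective)
  have hπL : ∀ w ∈ ws, π w = 0 := fun w hw => by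
    have : L.mkQ w = 0 := by
      rw [Submodule.mkQ_apply, Submodule.Quotient.mk_eq_zero]
      exact Submodule.subset_span hw
    simp only [π, LinearMap.comp_apply, this, map_zero]
  refine ⟨fun i => π (Pi.single i 1), by simp, fun v hv => ?_⟩
  choose s hs using hπ
  let v' : MvPolynomial σ k := aeval (fun l => linearForm (s (Pi.single l 1))) v
  have hv' : linearSubst (fun i => π (Pi.single i 1)) v' = v := by
    have : (linearSubst (fun i => π (Pi.single i 1))).comp
        (aeval (fun l => linearForm (s (Pi.single l 1)))) = AlgHom.id k _ := by
      refine MvPolynomial.algHom_ext fun l => ?_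
      rw [AlgHom.comp_apply, aeval_X, linearSubst_linearForm, hs, linearForm_apply,
        Finset.sum_eq_single l] <;> simp +contextual
    exact DFunLike.congr_fun this v
  obtain ⟨u, N, hu, huv⟩ := hws.2 v' (by
    rw [← constantCoeff_linearSubst (fun i => π (Pi.single i 1)), hv', hv])
  refine ⟨linearSubst (fun i => π (Pi.single i 1)) u, N, by rwa [constantCoeff_linearSubst], ?_⟩
  have h1 := Ideal.mem_map_of_mem (linearSubst (fun i => π (Pi.single i 1))) huv
  rw [map_mul, map_pow, hv', Ideal.map_sup] at h1
  have h2 : (Ideal.ofList (ws.map linearForm)).map (linearSubst fun i => π (Pi.single i 1)) ≤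
      Ideal.ofList [] := ?_
  · exact sup_le_sup_left h2 _ h1
  rw [Ideal.map_le_iff_le_comap]
  refine Ideal.span_le.2 fun g hg => ?_
  obtain ⟨w, hw, rfl⟩ := List.mem_map.1 hg
  change linearSubst (fun i => π (Pi.single i 1)) (linearForm w) ∈ Ideal.ofList []
  rw [linearSubst_linearForm, hπL w hw, map_zero]
  exact (Ideal.ofList _).zero_mem

end Polynomial

/-! ### Exactness of the Eagon–Northcott complex -/

section Exactness

open MvPolynomial

theorem maximalMinor_map {R S : Type*} [CommRing R] [CommRing S] (f : R →+* S) {p q : ℕ}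
    (Z : Matrix (Fin p) (Fin q) R) (T : Finset (Fin q)) (hT : #T = p) :
    maximalMinor (Z.map f) T hT = f (maximalMinor Z T hT) := by
  rw [maximalMinor, maximalMinor, RingHom.map_det]
  rfl

theorem posSign_map {R S : Type*} [CommRing R] [CommRing S] (f : R →+* S) {m : ℕ}
    (T : Finset (Fin m)) (s : Fin m) : f (posSign R T s) = posSign S T s := by
  simp [posSign]

theorem enEntry_map {R S : Type*} [CommRing R] [CommRing S] (f : R →+* S) {p q : ℕ}
    (Z : Matrix (Fin p) (Fin q) R) (y x : (Fin p → ℕ) × Finset (Fin q)) :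
    enEntry (Z.map f) y x = f (enEntry Z y x) := by
  simp only [enEntry, map_sum, apply_ite f, map_mul, map_zero, posSign_map, Matrix.map_apply]

theorem enDifferential_map {R S : Type*} [CommRing R] [CommRing S] (f : R →+* S) {p q : ℕ}
    (Z : Matrix (Fin p) (Fin q) R) : ∀ i, enDifferential (Z.map f) i = (enDifferential Z i).map f
  | 0 => by ext _ x; exact maximalMinor_map f Z _ _
  | i + 1 => by ext y x; exact enEntry_map f Z _ _

/-- Base change of a complex of free modules. -/
def FreeComplex.map {R S : Type*} [CommRing R] [CommRing S] (G : FreeComplex R) (f : R →+* S) :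
    FreeComplex S where
  ι := G.ι
  fin := G.fin
  d i := (G.d i).map f
  d_comp_d i := by rw [← Matrix.map_mul, G.d_comp_d, Matrix.map_zero _ (map_zero f)]

theorem eagonNorthcott_map {R S : Type*} [CommRing R] [CommRing S] (f : R →+* S) {p q : ℕ}
    (Z : Matrix (Fin p) (Fin q) R) : eagonNorthcott (Z.map f) = (eagonNorthcott Z).map f := by
  have h : enDifferential (Z.map f) = fun i => (enDifferential Z i).map f :=
    funext fun i => enDifferential_map f Z i
  simp only [eagonNorthcott, FreeComplex.map, h]

theorem maximalMinorIdeal_map {R S : Type*} [CommRing R] [CommRing S] (f : R →+* S) {p q : ℕ}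
    (Z : Matrix (Fin p) (Fin q) R) :
    maximalMinorIdeal (Z.map f) = (maximalMinorIdeal Z).map f := by
  rw [maximalMinorIdeal, maximalMinorIdeal, Ideal.map_span]
  congr 1
  ext m
  constructor
  · rintro ⟨T, hT, rfl⟩
    exact ⟨_, ⟨T, hT, rfl⟩, (maximalMinor_map f Z T hT).symm⟩
  · rintro ⟨_, ⟨T, hT, rfl⟩, rfl⟩
    exact ⟨T, hT, (maximalMinor_map f Z T hT).symm⟩

variable {k : Type*} [Field k] {n : ℕ}

theorem X_mul_mem_span_X_image {σ : Type*} {s : Set σ} {i : σ} (hi : i ∉ s)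
    {f : MvPolynomial σ k} (h : X i * f ∈ Ideal.span (X '' s)) : f ∈ Ideal.span (X '' s) := by
  rw [mem_ideal_span_X_image] at h ⊢
  intro m hm
  have hm' : Finsupp.single i 1 + m ∈ (X i * f).support := by
    rw [mem_support_iff, coeff_X_mul]
    exact mem_support_iff.1 hm
  obtain ⟨j, hj, hmj⟩ := h _ hm'
  refine ⟨j, hj, ?_⟩
  have : i ≠ j := fun h => hi (h ▸ hj)
  simpa [this] using hmj

theorem isWeaklyRegular_variables :
    RingTheory.Sequence.IsWeaklyRegular (MvPolynomial (Fin n) k)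
      (List.ofFn (X (R := k) (σ := Fin n))) := by
  rw [RingTheory.Sequence.isWeaklyRegular_iff_Fin]
  intro i
  have hi : i.1 < n := by simpa using i.2
  have h1 : Ideal.ofList (List.take i (List.ofFn (X (R := k) (σ := Fin n)))) =
      Ideal.span (X '' {j : Fin n | j.1 < i.1}) := by
    rw [Ideal.ofList]
    congr 1
    ext f
    simp only [Set.mem_ofPred_eq, Set.mem_image, List.mem_take_iff_getElem]
    constructor
    · rintro ⟨j, hj, rfl⟩
      refine ⟨⟨j, by simp at hj; omega⟩, by simp at hj ⊢; omega, by simp⟩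
    · rintro ⟨j, hj, rfl⟩
      exact ⟨j, by simp; omega, by simp⟩
  rw [h1, isSMulRegular_quotient_iff_mem_of_smul_mem]
  intro f hf
  simp only [smul_eq_mul, Ideal.mul_top, Fin.getElem_fin, List.getElem_ofFn] at hf ⊢
  exact X_mul_mem_span_X_image (by simp) hf

/-- The complex has length `q - p + 1`, powers of the minors kill its positive homology, and the
minors with `gs` generate locally an ideal whose radical contains the variables, a regular sequence
of length `n`. Thus `acyclic_of_mem_radical` applies to the localization, and clearing denominators
produces `u`. -/
theorem eagonNorthcott_exact_at_origin {p q : ℕ} (hpq : p ≤ q)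
    (Z : Matrix (Fin p) (Fin q) (MvPolynomial (Fin n) k)) {gs : List (MvPolynomial (Fin n) k)}
    (hgs : HasParameters (maximalMinorIdeal Z) gs) (hlen : gs.length + (q - p + 1) ≤ n)
    (i : ℕ) (z : (eagonNorthcott Z).ι (i + 1) → MvPolynomial (Fin n) k)
    (hz : ((eagonNorthcott Z).d i).mulVec z = 0) :
    ∃ (u : MvPolynomial (Fin n) k) (w : _), constantCoeff u ≠ 0 ∧
      ((eagonNorthcott Z).d (i + 1)).mulVec w = u • z := by
  let A := OriginLocal (Fin n) k
  let f : MvPolynomial (Fin n) k →+* A := algebraMap _ _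
  have hf : Function.Injective f :=
    IsLocalization.injective A (M := (originIdeal (Fin n) k).primeCompl)
      (Ideal.primeCompl_le_nonZeroDivisors _)
  let G := (eagonNorthcott Z).map f
  have hZ : eagonNorthcott (Z.map f) = G := eagonNorthcott_map f Z
  have hex := acyclic_of_mem_radical (A := A) (xs := (List.ofFn (X (R := k) (σ := Fin n))).map f)
    (isWeaklyRegular_variables.of_isLocalization (T := (originIdeal (Fin n) k).primeCompl) A)
    (gs.map f) (maximalMinorIdeal (Z.map f)) ?_ ?_ (fun i => G.ι i → A) (fun i => (G.d i).mulVecLin)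
    ?_ ?_ ?_ ?_ i (fun y => f (z y)) ?_
  · obtain ⟨w, hw⟩ := hex
    obtain ⟨b, hb⟩ := IsLocalization.exist_integer_multiples_of_finite
      (originIdeal (Fin n) k).primeCompl w
    choose w' hw' using hb
    refine ⟨b, w', fun h => b.2 (mem_originIdeal.2 h), ?_⟩
    funext y
    apply hf
    have h2 : (f ∘ w') = f b • w := by
      funext y
      refine (hw' y).trans ?_
      rw [Pi.smul_apply, smul_eq_mul, Algebra.smul_def]
    have h3 : (G.d (i + 1)).mulVec w = fun y => f (z y) := hw.symm
    refine (RingHom.map_mulVec f _ w' y).trans ?_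
    rw [h2]
    change (G.d (i + 1)).mulVec (f b • w) y = _
    rw [Matrix.mulVec_smul, h3]
    exact (map_mul f _ _).symm
  · intro x hx
    obtain ⟨x', hx', rfl⟩ := List.mem_map.1 hx
    obtain ⟨j, rfl⟩ := (List.mem_ofFn' _ _).1 hx'
    rw [maximalMinorIdeal_map]
    exact hgs.maximalIdeal_le (algebraMap_mem_maximalIdeal (by simp))
  · intro g hg
    obtain ⟨g', hg', rfl⟩ := List.mem_map.1 hg
    exact algebraMap_mem_maximalIdeal (hgs.1 g' hg')
  · intro i z
    rw [Matrix.mulVecLin_apply, Matrix.mulVecLin_apply]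
    refine (Matrix.mulVec_mulVec _ _ _).trans ?_
    rw [G.d_comp_d, Matrix.zero_mulVec]
  · intro i hi
    simp only [List.length_map, List.length_ofFn] at hi
    have : IsEmpty (G.ι i) := by
      cases i with
      | zero => omega
      | succ i =>
        refine ⟨fun x : ↥(enBasis p q i) => ?_⟩
        have := enBasis_card x.2
        have h2 := card_le_univ x.1.2
        rw [Fintype.card_fin] at h2
        omega
    infer_instance
  · intro z a ha
    have h0 := fun z => exists_enDifferential_zero_eq (Z.map f) ha z
    rw [hZ] at h0
    obtain ⟨w, hw⟩ := h0 z
    exact ⟨1, (mem_boundaryColon _ _ _).2 ⟨w, by rw [pow_one]; exact hw⟩⟩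
  · intro i z hz
    refine Ideal.span_le.2 ?_
    rintro _ ⟨T, hT, rfl⟩
    have h0 := exists_enDifferential_eq_minor_pow_smul (Z.map f) T hT
    rw [hZ] at h0
    obtain ⟨w, hw⟩ := h0 i z hz
    exact ⟨p, (mem_boundaryColon _ _ _).2 ⟨w, hw⟩⟩
  · funext y
    rw [Matrix.mulVecLin_apply]
    refine (RingHom.map_mulVec f ((eagonNorthcott Z).d i) z y).symm.trans ?_
    rw [hz]
    exact map_zero f

/-- Exactness of a complex of free modules in positive degrees. -/
def FreeComplex.IsAcyclic {R : Type*} [CommRing R] (G : FreeComplex R) : Prop :=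
  ∀ i z, (G.d i).mulVec z = 0 → ∃ w, (G.d (i + 1)).mulVec w = z

/-- The entries of the `i`-th differential are homogeneous of degree `e i`. -/
def FreeComplex.IsHomogeneous {σ R : Type*} [CommRing R] (G : FreeComplex (MvPolynomial σ R))
    (e : ℕ → ℕ) : Prop :=
  ∀ i a b, (G.d i a b).IsHomogeneous (e i)

variable {σ : Type*}

theorem homogeneousComponent_mul_of_isHomogeneous {f : MvPolynomial σ k} {e : ℕ}
    (hf : f.IsHomogeneous e) (g : MvPolynomial σ k) (m : ℕ) :
    homogeneousComponent (m + e) (f * g) = f * homogeneousComponent m g := by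
  classical
  ext d
  rw [coeff_homogeneousComponent, coeff_mul, coeff_mul, ← mul_boole, Finset.sum_mul]
  refine Finset.sum_congr rfl fun x hx => ?_
  rw [HasAntidiagonal.mem_antidiagonal] at hx
  rw [coeff_homogeneousComponent, ← hx, map_add]
  by_cases h : Finsupp.degree x.1 = e
  · have h' : e + Finsupp.degree x.2 = m + e ↔ Finsupp.degree x.2 = m := by omega
    simp only [h, h', mul_ite, mul_zero, mul_one]
  · rw [hf.coeff_eq_zero h]; simp

theorem homogeneousComponent_mul_eq_zero {f : MvPolynomial σ k} {e : ℕ}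
    (hf : f.IsHomogeneous e) (g : MvPolynomial σ k) {m : ℕ} (hm : m < e) :
    homogeneousComponent m (f * g) = 0 := by
  classical
  ext d
  rw [coeff_homogeneousComponent, coeff_mul, coeff_zero]
  split_ifs with hd
  · refine Finset.sum_eq_zero fun x hx => ?_
    rw [HasAntidiagonal.mem_antidiagonal] at hx
    rw [hf.coeff_eq_zero, zero_mul]
    rw [← hx, map_add] at hd
    omega
  · rfl

theorem homogeneousComponent_mulVec {ι κ : Type*} [Fintype κ]
    {D : Matrix ι κ (MvPolynomial σ k)} {e : ℕ} (hD : ∀ a b, (D a b).IsHomogeneous e)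
    (z : κ → MvPolynomial σ k) (m : ℕ) (a : ι) :
    homogeneousComponent (m + e) (D.mulVec z a) =
      D.mulVec (fun b => homogeneousComponent m (z b)) a := by
  simp only [Matrix.mulVec, dotProduct, map_sum,
    homogeneousComponent_mul_of_isHomogeneous (hD a _)]

/-- It suffices to treat a cycle `z` that is homogeneous of degree `m`. The component of degree `m`
of `u • z` is `u(0)` times `z`, and the matching component of `w` bounds it. -/
theorem FreeComplex.isAcyclic_of_exact_at_origin {G : FreeComplex (MvPolynomial σ k)}
    {e : ℕ → ℕ} (hG : G.IsHomogeneous e)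
    (h : ∀ i z, (G.d i).mulVec z = 0 → ∃ (u : MvPolynomial σ k) (w : _), constantCoeff u ≠ 0 ∧
      (G.d (i + 1)).mulVec w = u • z) : G.IsAcyclic := by
  have key : ∀ i z, (G.d i).mulVec z = 0 → ∀ m, ∃ w, (G.d (i + 1)).mulVec w =
      fun b => homogeneousComponent m (z b) := by
    intro i z hz m
    have hzm : (G.d i).mulVec (fun b => homogeneousComponent m (z b)) = 0 := by
      funext a
      rw [← homogeneousComponent_mulVec (hG i), hz]
      simp
    obtain ⟨u, w, hu, huw⟩ := h i _ hzm
    have h1 : ∀ b, homogeneousComponent m (u * homogeneousComponent m (z b)) =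
        C (constantCoeff u) * homogeneousComponent m (z b) := by
      intro b
      have := homogeneousComponent_mul_of_isHomogeneous
        (homogeneousComponent_isHomogeneous m (z b)) u 0
      rw [zero_add, homogeneousComponent_zero] at this
      rw [mul_comm, this, mul_comm]
      rfl
    have h2 : ∀ b, (G.d (i + 1)).mulVec w b = u * homogeneousComponent m (z b) :=
      fun b => congrFun huw b
    have hC : C (constantCoeff u)⁻¹ * C (constantCoeff u) = (1 : MvPolynomial σ k) := by
      rw [← C_mul, inv_mul_cancel₀ hu, C_1]
    by_cases hm : e (i + 1) ≤ m
    · obtain ⟨t, rfl⟩ := Nat.exists_eq_add_of_le' hm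
      refine ⟨(C (constantCoeff u)⁻¹ : MvPolynomial σ k) • fun b => homogeneousComponent t (w b), ?_⟩
      rw [Matrix.mulVec_smul]
      funext b
      rw [Pi.smul_apply, ← homogeneousComponent_mulVec (hG (i + 1)), h2, h1, smul_eq_mul,
        ← mul_assoc, hC, one_mul]
    -- In degrees below that of the differential there are no boundaries, so the component of `z`
    -- must vanish.
    · refine ⟨0, ?_⟩
      funext b
      rw [Matrix.mulVec_zero, Pi.zero_apply]
      have h3 : homogeneousComponent m ((G.d (i + 1)).mulVec w b) = 0 := by
        simp only [Matrix.mulVec, dotProduct, map_sum]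
        exact Finset.sum_eq_zero fun x _ =>
          homogeneousComponent_mul_eq_zero (hG (i + 1) b x) _ (not_le.1 hm)
      rw [h2, h1] at h3
      calc (0 : MvPolynomial σ k) = C (constantCoeff u)⁻¹ * 0 := (mul_zero _).symm
        _ = _ := by rw [← h3, ← mul_assoc, hC, one_mul]
  intro i z hz
  choose w hw using key i z hz
  let M := Finset.univ.sup fun b => (z b).totalDegree
  refine ⟨∑ m ∈ Finset.range (M + 1), w m, ?_⟩
  rw [Matrix.mulVec_sum]
  simp only [hw]
  funext b
  rw [Finset.sum_apply]
  conv_rhs => rw [← sum_homogeneousComponent (z b)]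
  symm
  refine Finset.sum_subset (Finset.range_mono ?_) fun m _ hm => ?_
  · exact Nat.succ_le_succ (Finset.le_sup (f := fun b => (z b).totalDegree) (mem_univ b))
  · refine homogeneousComponent_eq_zero _ _ ?_
    simpa using hm

/-- The degrees of the entries of the Eagon–Northcott differentials, for a matrix of forms of
degree `e`. -/
def enDegree (p e : ℕ) : ℕ → ℕ
  | 0 => p * e
  | _ + 1 => e

theorem eagonNorthcott_isHomogeneous {p q e : ℕ} {Z : Matrix (Fin p) (Fin q) (MvPolynomial σ k)}
    (hZ : ∀ i j, (Z i j).IsHomogeneous e) : (eagonNorthcott Z).IsHomogeneous (enDegree p e) := by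
  have hsign : ∀ s : ℕ, ((-1 : MvPolynomial σ k) ^ s).IsHomogeneous 0 := fun s => by
    have := (isHomogeneous_C σ (-1 : k)).pow s
    simpa using this
  intro i
  cases i with
  | zero =>
    rintro a b
    change (maximalMinor Z _ _).IsHomogeneous (p * e)
    rw [maximalMinor, Matrix.det_apply']
    refine IsHomogeneous.sum _ _ _ fun s _ => ?_
    have h1 : (∏ i, (Z.submatrix id (b.1.2.orderEmbOfFin (enBasis_card b.2))) (s i) i).IsHomogeneous
        (∑ _i : Fin p, e) := IsHomogeneous.prod _ _ _ fun i _ => hZ _ _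
    rw [Finset.sum_const, Finset.card_univ, Fintype.card_fin, smul_eq_mul] at h1
    have h2 : (((Equiv.Perm.sign s : ℤ) : MvPolynomial σ k)).IsHomogeneous 0 := by
      have := isHomogeneous_C σ ((Equiv.Perm.sign s : ℤ) : k)
      rwa [map_intCast] at this
    simpa using h2.mul h1
  | succ i =>
    rintro a b
    change (enEntry Z _ _).IsHomogeneous e
    refine IsHomogeneous.sum _ _ _ fun s _ => IsHomogeneous.sum _ _ _ fun j _ => ?_
    split_ifs
    · have := (hsign (#{t ∈ b.1.2 | t < s})).mul (hZ j s)
      rwa [zero_add] at this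
    · exact isHomogeneous_zero _ _ _

theorem eagonNorthcott_isAcyclic {p q e : ℕ} (hpq : p ≤ q)
    {Z : Matrix (Fin p) (Fin q) (MvPolynomial (Fin n) k)}
    (hZ : ∀ i j, (Z i j).IsHomogeneous e) {gs : List (MvPolynomial (Fin n) k)}
    (hgs : HasParameters (maximalMinorIdeal Z) gs) (hlen : gs.length + (q - p + 1) ≤ n) :
    (eagonNorthcott Z).IsAcyclic :=
  FreeComplex.isAcyclic_of_exact_at_origin (eagonNorthcott_isHomogeneous hZ)
    (eagonNorthcott_exact_at_origin hpq Z hgs hlen)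

end Exactness

/-! ### Comparison of minimal complexes -/

section Comparison

open MvPolynomial

theorem Matrix.exists_mul_eq {R m l n : Type*} [CommRing R] [Fintype l] (D : Matrix m l R)
    (B : Matrix m n R) (h : ∀ b, ∃ w, D.mulVec w = fun a => B a b) :
    ∃ X : Matrix l n R, D * X = B := by
  choose w hw using h
  refine ⟨Matrix.of fun a b => w b a, ?_⟩
  ext a b
  exact congrFun (hw b) a

theorem FreeComplex.IsAcyclic.exists_mul_eq {R : Type*} [CommRing R] {G : FreeComplex R}
    (hG : G.IsAcyclic) {n : Type*} (i : ℕ) (B : Matrix (G.ι (i + 1)) n R) (hB : G.d i * B = 0) :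
    ∃ X : Matrix (G.ι (i + 2)) n R, G.d (i + 1) * X = B := by
  refine Matrix.exists_mul_eq _ _ fun b => hG i _ ?_
  funext a
  exact congrFun (congrFun hB a) b

/-- A morphism in degree zero that maps boundaries to boundaries lifts to a morphism of complexes
into an acyclic complex. -/
theorem FreeComplex.IsAcyclic.exists_lift {R : Type*} [CommRing R] {G : FreeComplex R}
    (hG : G.IsAcyclic) (F : FreeComplex R) (β₀ : Matrix (G.ι 0) (F.ι 0) R)
    (h₀ : ∃ X : Matrix (G.ι 1) (F.ι 1) R, G.d 0 * X = β₀ * F.d 0) :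
    ∃ β : ∀ i, Matrix (G.ι i) (F.ι i) R, β 0 = β₀ ∧
      ∀ i, G.d i * β (i + 1) = β i * F.d i := by
  have step : ∀ i (β : Matrix (G.ι i) (F.ι i) R), (∃ X : Matrix (G.ι (i + 1)) (F.ι (i + 1)) R, G.d i * X = β * F.d i) →
      ∃ β' : Matrix (G.ι (i + 1)) (F.ι (i + 1)) R, G.d i * β' = β * F.d i ∧
        ∃ X : Matrix (G.ι (i + 2)) (F.ι (i + 2)) R, G.d (i + 1) * X = β' * F.d (i + 1) := by
    rintro i β ⟨X, hX⟩
    refine ⟨X, hX, hG.exists_mul_eq i _ ?_⟩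
    rw [← Matrix.mul_assoc, hX, Matrix.mul_assoc, F.d_comp_d, Matrix.mul_zero]
  choose s hs hs' using step
  let B : ∀ i, {β : Matrix (G.ι i) (F.ι i) R //
      ∃ X : Matrix (G.ι (i + 1)) (F.ι (i + 1)) R, G.d i * X = β * F.d i} := fun i =>
    Nat.rec (motive := fun i => {β : Matrix (G.ι i) (F.ι i) R //
      ∃ X : Matrix (G.ι (i + 1)) (F.ι (i + 1)) R, G.d i * X = β * F.d i})
      ⟨β₀, h₀⟩ (fun i β => ⟨s i β.1 β.2, hs' i β.1 β.2⟩) i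
  exact ⟨fun i => (B i).1, rfl, fun i => hs i (B i).1 (B i).2⟩

/-- The entries of the differentials vanish at the origin. -/
def FreeComplex.IsMinimal {σ k : Type*} [Field k] (G : FreeComplex (MvPolynomial σ k)) : Prop :=
  ∀ i a b, constantCoeff (G.d i a b) = 0

variable {σ k : Type*} [Field k]

theorem FreeComplex.IsMinimal.map_d {G : FreeComplex (MvPolynomial σ k)} (hG : G.IsMinimal)
    (i : ℕ) : (G.d i).map (constantCoeff (R := k) (σ := σ)) = 0 := by
  ext a b
  exact hG i a b

/-- The endomorphism is homotopic to the identity, the homotopy being built degree by degree from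
exactness. Each homotopy term contains a differential, which vanishes at the origin. -/
theorem FreeComplex.IsAcyclic.map_constantCoeff_eq_one {F : FreeComplex (MvPolynomial σ k)}
    [∀ i, DecidableEq (F.ι i)] (hF : F.IsAcyclic) (hmin : F.IsMinimal)
    (γ : ∀ i, Matrix (F.ι i) (F.ι i) (MvPolynomial σ k))
    (hγ : ∀ i, F.d i * γ (i + 1) = γ i * F.d i) 
    (h₀ : ∃ h : Matrix (F.ι 1) (F.ι 0) (MvPolynomial σ k), γ 0 - 1 = F.d 0 * h) (i : ℕ) :
    (γ i).map (constantCoeff (R := k) (σ := σ)) = 1 := by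
  have key : ∀ i, (γ i).map (constantCoeff (R := k) (σ := σ)) = 1 ∧
      ∃ h : Matrix (F.ι (i + 1)) (F.ι i) (MvPolynomial σ k), (γ i - 1 - F.d i * h) * F.d i = 0 := by
    intro i
    induction i with
    | zero =>
      obtain ⟨h, hh⟩ := h₀
      refine ⟨?_, h, by rw [hh, sub_self, Matrix.zero_mul]⟩
      have h1 : γ 0 = 1 + F.d 0 * h := by rw [← hh]; abel
      rw [h1, Matrix.map_add _ (map_add _), Matrix.map_mul, hmin.map_d, Matrix.zero_mul, add_zero,
        Matrix.map_one _ (map_zero _) (map_one _)]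
    | succ i ih =>
      obtain ⟨-, h, hh⟩ := ih
      obtain ⟨h', hh'⟩ := hF.exists_mul_eq i (γ (i + 1) - 1 - h * F.d i) (by
        rw [Matrix.mul_sub, Matrix.mul_sub, hγ, Matrix.mul_one, ← Matrix.mul_assoc]
        rw [Matrix.sub_mul, Matrix.sub_mul, Matrix.one_mul] at hh
        exact hh)
      have h1 : γ (i + 1) = 1 + h * F.d i + F.d (i + 1) * h' := by rw [hh']; abel
      refine ⟨?_, h', ?_⟩
      · rw [h1, Matrix.map_add _ (map_add _), Matrix.map_add _ (map_add _), Matrix.map_mul,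
          Matrix.map_mul, hmin.map_d, hmin.map_d, Matrix.zero_mul, Matrix.mul_zero, add_zero,
          add_zero, Matrix.map_one _ (map_zero _) (map_one _)]
      · have h2 : γ (i + 1) - 1 - F.d (i + 1) * h' = h * F.d i := by rw [h1]; abel
        rw [h2, Matrix.mul_assoc, F.d_comp_d, Matrix.mul_zero]
  exact (key i).1

theorem exists_matrix_lift {R : Type*} [CommRing R] {ι κ : Type*} [Fintype ι] [Fintype κ]
    [DecidableEq ι]
    (M : Submodule R (ι → R)) (N : Submodule R (κ → R)) (e : ((ι → R) ⧸ M) →ₗ[R] ((κ → R) ⧸ N)) :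
    ∃ β : Matrix κ ι R, ∀ v, N.mkQ (β.mulVec v) = e (M.mkQ v) := by
  choose s hs using N.mkQ_surjective
  refine ⟨Matrix.of fun b a => s (e (M.mkQ (Pi.single a 1))) b, fun v => ?_⟩
  have : (Matrix.of fun b a => s (e (M.mkQ (Pi.single a 1))) b).mulVec v =
      ∑ a, v a • s (e (M.mkQ (Pi.single a 1))) := by
    ext b
    simp [Matrix.mulVec, dotProduct, mul_comm]
  rw [this, map_sum]
  conv_rhs => rw [pi_eq_sum_univ' v, map_sum, map_sum]
  exact Finset.sum_congr rfl fun a _ => by simp only [map_smul, hs]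

/-- An isomorphism of the zeroth homology of minimal acyclic complexes lifts to a morphism that is
split injective at the origin. -/
theorem exists_comparison {F G : FreeComplex (MvPolynomial σ k)} (hF : F.IsAcyclic)
    (hG : G.IsAcyclic) (hFm : F.IsMinimal)
    (e : ((F.ι 0 → MvPolynomial σ k) ⧸ LinearMap.range (F.d 0).mulVecLin) ≃ₗ[MvPolynomial σ k]
      ((G.ι 0 → MvPolynomial σ k) ⧸ LinearMap.range (G.d 0).mulVecLin)) :
    ∃ (β : ∀ i, Matrix (G.ι i) (F.ι i) (MvPolynomial σ k))
      (ρ : ∀ i, Matrix (F.ι i) (G.ι i) k),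
      (∀ i, G.d i * β (i + 1) = β i * F.d i) ∧
      ∀ i (_ : DecidableEq (F.ι i)), ρ i * (β i).map (constantCoeff (R := k) (σ := σ)) = 1 := by
  classical
  obtain ⟨β₀, hβ₀⟩ := exists_matrix_lift _ _ e.toLinearMap
  obtain ⟨α₀, hα₀⟩ := exists_matrix_lift _ _ e.symm.toLinearMap
  have hrange : ∀ {H H' : FreeComplex (MvPolynomial σ k)} 
      (γ : Matrix (H'.ι 0) (H.ι 0) (MvPolynomial σ k))
      (g : _ →ₗ[MvPolynomial σ k] _), (∀ v, (LinearMap.range (H'.d 0).mulVecLin).mkQ (γ.mulVec v) =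
        g ((LinearMap.range (H.d 0).mulVecLin).mkQ v)) →
      ∃ X : Matrix (H'.ι 1) (H.ι 1) (MvPolynomial σ k), H'.d 0 * X = γ * H.d 0 := by
    intro H H' γ g h
    refine Matrix.exists_mul_eq _ _ fun b => ?_
    have h1 := h fun a => H.d 0 a b
    have h2 : (LinearMap.range (H.d 0).mulVecLin).mkQ (fun a => H.d 0 a b) = 0 := by
      rw [Submodule.mkQ_apply, Submodule.Quotient.mk_eq_zero]
      refine ⟨Pi.single b 1, ?_⟩
      rw [Matrix.mulVecLin_apply, Matrix.mulVec_single_one]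
      rfl
    rw [h2, map_zero, Submodule.mkQ_apply, Submodule.Quotient.mk_eq_zero] at h1
    obtain ⟨w, hw⟩ := h1
    exact ⟨w, hw⟩
  obtain ⟨β, hβ0, hβ⟩ := hG.exists_lift F β₀ (hrange β₀ _ hβ₀)
  obtain ⟨α, hα0, hα⟩ := hF.exists_lift G α₀ (hrange α₀ _ hα₀)
  have hid := hF.map_constantCoeff_eq_one hFm (fun i => α i * β i) (fun i => by
    rw [← Matrix.mul_assoc, hα, Matrix.mul_assoc, hβ, Matrix.mul_assoc]) (by
    have : ∃ X : Matrix (F.ι 1) (F.ι 0) (MvPolynomial σ k), F.d 0 * X = α₀ * β₀ - 1 := by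
      refine Matrix.exists_mul_eq _ _ fun b => ?_
      have h1 : (LinearMap.range (F.d 0).mulVecLin).mkQ ((α₀ * β₀ - 1).mulVec (Pi.single b 1)) =
          0 := by
        rw [Matrix.sub_mulVec, map_sub, ← Matrix.mulVec_mulVec, hα₀, hβ₀, Matrix.one_mulVec]
        simp
      rw [Submodule.mkQ_apply, Submodule.Quotient.mk_eq_zero] at h1
      obtain ⟨w, hw⟩ := h1
      refine ⟨w, hw.trans ?_⟩
      rw [Matrix.mulVec_single_one]
      rfl
    obtain ⟨X, hX⟩ := this
    exact ⟨X, by rw [hX, hα0, hβ0]⟩)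
  refine ⟨β, fun i => (α i).map constantCoeff, hβ, fun i inst => ?_⟩
  rw [← Matrix.map_mul]
  convert hid i

theorem homogeneousComponent_eq_zero_of_mem_pow {f : MvPolynomial σ k} {e : ℕ}
    (hf : f ∈ idealOfVars σ k ^ (e + 1)) : homogeneousComponent e f = 0 := by
  ext d
  rw [coeff_homogeneousComponent, coeff_zero]
  split_ifs with h
  · exact (mem_pow_idealOfVars_iff' _ _).1 hf d (by omega)
  · rfl

theorem mem_pow_idealOfVars_of_isHomogeneous {f : MvPolynomial σ k} {e : ℕ}
    (hf : f.IsHomogeneous e) : f ∈ idealOfVars σ k ^ e :=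
  (mem_pow_idealOfVars_iff' _ _).2 fun _ hd => hf.coeff_eq_zero hd.ne

theorem sub_C_constantCoeff_mem (f : MvPolynomial σ k) :
    f - C (constantCoeff f) ∈ idealOfVars σ k := by
  rw [← originIdeal_eq_idealOfVars, mem_originIdeal]
  simp

/-- The constant terms and the parts of lowest degree of a morphism of complexes into a complex
with homogeneous differentials form a morphism of complexes again. -/
theorem mem_rankSequences_of_constantCoeff {G : FreeComplex (MvPolynomial σ k)} {e : ℕ → ℕ}
    (hG : G.IsHomogeneous e) {r : ℕ → ℕ}
    (f : ∀ i, Matrix (Fin (r i)) (Fin (r (i + 1))) (MvPolynomial σ k))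
    (φ : ∀ i, Matrix (G.ι i) (Fin (r i)) (MvPolynomial σ k))
    (ρ : ∀ i, Matrix (Fin (r i)) (G.ι i) k)
    (hρ : ∀ i, ρ i * (φ i).map (constantCoeff (R := k) (σ := σ)) = 1)
    (h : ∀ i, φ i * f i = G.d i * φ (i + 1)) : r ∈ rankSequences k G := by
  let φ₀ : ∀ i, Matrix (G.ι i) (Fin (r i)) k := fun i => (φ i).map constantCoeff
  let Φ : ∀ i, Matrix (G.ι i) (Fin (r i)) (MvPolynomial σ k) := fun i => (φ₀ i).map C
  let P : ∀ i, Matrix (Fin (r i)) (G.ι i) (MvPolynomial σ k) := fun i => (ρ i).map C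
  have hP : ∀ i, P i * Φ i = 1 := fun i => by
    simp only [P, Φ, φ₀]
    rw [← Matrix.map_mul, hρ, Matrix.map_one _ (map_zero _) (map_one _)]
  have hΦ : ∀ i a b, (φ i - Φ i) a b ∈ idealOfVars σ k := fun i a b =>
    sub_C_constantCoeff_mem _
  -- A bootstrap: `f = P (d φ - (φ - Φ) f)`, where `φ - Φ` has entries in the ideal of the
  -- variables. Each pass gains one power of that ideal, up to the degree `e i` of `d`.
  have hfe : ∀ i m, m ≤ e i → ∀ a b, f i a b ∈ idealOfVars σ k ^ m := by
    intro i m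
    induction m with
    | zero => intro _ a b; simp
    | succ m ih =>
      intro hm a b
      have h1 : f i = P i * (G.d i * φ (i + 1) - (φ i - Φ i) * f i) := by
        rw [Matrix.sub_mul, h, sub_sub_cancel, ← Matrix.mul_assoc, hP, Matrix.one_mul]
      rw [h1, Matrix.mul_apply]
      refine Ideal.sum_mem _ fun c _ => Ideal.mul_mem_left _ _ ?_
      rw [Matrix.sub_apply]
      refine Ideal.sub_mem _ ?_ ?_
      · rw [Matrix.mul_apply]
        exact Ideal.sum_mem _ fun c _ => Ideal.mul_mem_right _ _
          (Ideal.pow_le_pow_right hm (mem_pow_idealOfVars_of_isHomogeneous (hG i _ _)))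
      · rw [Matrix.mul_apply]
        refine Ideal.sum_mem _ fun c _ => ?_
        rw [pow_succ']
        exact Ideal.mul_mem_mul (hΦ i _ _) (ih (by omega) _ _)
  -- `Φ f` and `d Φ` agree modulo the power `e i + 1`, so their components of degree `e i` are
  -- equal.
  have hlow : ∀ i, Φ i * (f i).map (homogeneousComponent (e i)) = G.d i * Φ (i + 1) := by
    intro i
    refine Matrix.ext fun a b => ?_
    have h1 : (Φ i * f i - G.d i * Φ (i + 1)) a b ∈ idealOfVars σ k ^ (e i + 1) := by
      have h2 : Φ i * f i - G.d i * Φ (i + 1) =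
          G.d i * (φ (i + 1) - Φ (i + 1)) - (φ i - Φ i) * f i := by
        rw [Matrix.sub_mul, Matrix.mul_sub, h]; abel
      rw [h2, Matrix.sub_apply]
      refine Ideal.sub_mem _ ?_ ?_
      · rw [Matrix.mul_apply]
        refine Ideal.sum_mem _ fun c _ => ?_
        rw [pow_succ]
        exact Ideal.mul_mem_mul (mem_pow_idealOfVars_of_isHomogeneous (hG i _ _)) (hΦ _ _ _)
      · rw [Matrix.mul_apply]
        refine Ideal.sum_mem _ fun c _ => ?_
        rw [pow_succ']
        exact Ideal.mul_mem_mul (hΦ i _ _) (hfe i _ le_rfl _ _)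
    have h3 := homogeneousComponent_eq_zero_of_mem_pow h1
    rw [Matrix.sub_apply, map_sub, sub_eq_zero, Matrix.mul_apply, Matrix.mul_apply, map_sum,
      map_sum] at h3
    rw [Matrix.mul_apply, Matrix.mul_apply]
    refine Eq.trans (Finset.sum_congr rfl fun c _ => ?_) (h3.trans (Finset.sum_congr rfl fun c _ => ?_))
    · simp only [Φ, Matrix.map_apply, homogeneousComponent_C_mul]
    · simp only [Φ, Matrix.map_apply]
      rw [mul_comm (G.d i a c), homogeneousComponent_C_mul,
        homogeneousComponent_eq_self (hG i _ _)]
  refine ⟨fun i => (f i).map (homogeneousComponent (e i)), φ₀, ρ, fun i => ?_, hρ, hlow⟩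
  have h1 : ∀ M : Matrix (Fin (r i)) (Fin (r (i + 2))) (MvPolynomial σ k), Φ i * M = 0 → M = 0 := by
    intro M hM
    rw [← Matrix.one_mul M, ← hP, Matrix.mul_assoc, hM, Matrix.mul_zero]
  apply h1
  rw [← Matrix.mul_assoc, hlow, Matrix.mul_assoc, hlow, ← Matrix.mul_assoc, G.d_comp_d,
    Matrix.zero_mul]

/-- Composed with `β`, a subcomplex of `F` is known to remain split injective only at the origin;
passing to constant terms makes it a genuine subcomplex of `G`. -/
theorem rankSequences_subset_of_comparison {F G : FreeComplex (MvPolynomial σ k)} {e : ℕ → ℕ}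
    (hG : G.IsHomogeneous e) (β : ∀ i, Matrix (G.ι i) (F.ι i) (MvPolynomial σ k))
    (ρ : ∀ i, Matrix (F.ι i) (G.ι i) k) (hβ : ∀ i, G.d i * β (i + 1) = β i * F.d i)
    (hρ : ∀ i (_ : DecidableEq (F.ι i)), ρ i * (β i).map (constantCoeff (R := k) (σ := σ)) = 1) :
    rankSequences (MvPolynomial σ k) F ⊆ rankSequences k G := by
  classical
  rintro r ⟨f, φ, ρ', -, hρ', hφ⟩
  refine mem_rankSequences_of_constantCoeff hG f (fun i => β i * φ i)
    (fun i => (ρ' i).map constantCoeff * ρ i) (fun i => ?_) (fun i => ?_)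
  · rw [Matrix.map_mul, Matrix.mul_assoc, ← Matrix.mul_assoc (ρ i), hρ, Matrix.one_mul,
      ← Matrix.map_mul, hρ', Matrix.map_one _ (map_zero _) (map_one _)]
  · rw [← Matrix.mul_assoc, hβ, Matrix.mul_assoc, Matrix.mul_assoc]
    congr 1
    have := hφ i
    simpa using this

theorem FreeComplex.IsHomogeneous.rankSequences_subset {G : FreeComplex (MvPolynomial σ k)}
    {e : ℕ → ℕ} (hG : G.IsHomogeneous e) :
    rankSequences (MvPolynomial σ k) G ⊆ rankSequences k G := by
  rintro r ⟨f, φ, ρ, -, hρ, hφ⟩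
  refine mem_rankSequences_of_constantCoeff hG f φ (fun i => (ρ i).map constantCoeff)
    (fun i => ?_) (fun i => by simpa using hφ i)
  rw [← Matrix.map_mul, hρ, Matrix.map_one _ (map_zero _) (map_one _)]

theorem rankSequences_subset_rankSequences {R A : Type*} [CommRing R] [CommRing A] [Algebra A R]
    (G : FreeComplex R) : rankSequences A G ⊆ rankSequences R G := by
  rintro r ⟨f, φ, ρ, hf, hρ, hφ⟩
  refine ⟨f, fun i => (φ i).map (algebraMap A R), fun i => (ρ i).map (algebraMap A R), hf,
    fun i => ?_, fun i => ?_⟩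
  · rw [← Matrix.map_mul, hρ, Matrix.map_one _ (map_zero _) (map_one _)]
  · simpa using hφ i

end Comparison

/-! ### Rank sequences and specialization -/

section Specialization

open MvPolynomial

/-- The intersection of a subspace of `K ^ ι` with the lattice `O ^ ι` is a direct summand of the
lattice, for `O` a principal ideal domain with fraction field `K`. -/
theorem exists_saturated_basis {O K : Type*} [CommRing O] [IsDomain O] [IsPrincipalIdealRing O]
    [Field K] [Algebra O K] [IsFractionRing O K] {ι : Type*} [Fintype ι] {r : ℕ}
    (φ : Matrix ι (Fin r) K) (ρ : Matrix (Fin r) ι K) (hρ : ρ * φ = 1) :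
    ∃ (φ' : Matrix ι (Fin r) O) (ρ' : Matrix (Fin r) ι O) (g g' : Matrix (Fin r) (Fin r) K),
      ρ' * φ' = 1 ∧ φ'.map (algebraMap O K) = φ * g ∧ φ = φ'.map (algebraMap O K) * g' := by
  classical
  have hinj := IsFractionRing.injective O K
  obtain ⟨s, hs⟩ := IsLocalization.exist_integer_multiples_of_finite (nonZeroDivisors O)
    (fun x : ι × Fin r => φ x.1 x.2)
  choose ψ' hψ' using hs
  let ψ : Matrix ι (Fin r) O := Matrix.of fun a b => ψ' (a, b)
  have hs0 : algebraMap O K s ≠ 0 := by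
    rw [Ne, map_eq_zero_iff _ hinj]; exact nonZeroDivisors.coe_ne_zero s
  have hψ : ψ.map (algebraMap O K) = algebraMap O K s • φ := by
    ext a b
    refine (hψ' (a, b)).trans ?_
    change (s : O) • φ a b = _
    rw [Matrix.smul_apply, smul_eq_mul, Algebra.smul_def]
  have hψinj : Function.Injective ψ.mulVecLin := by
    rw [← LinearMap.ker_eq_bot, LinearMap.ker_eq_bot']
    intro v hv
    have h1 : (ψ.map (algebraMap O K)).mulVec (algebraMap O K ∘ v) = 0 := by
      funext a
      refine (RingHom.map_mulVec (algebraMap O K) ψ v a).symm.trans ?_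
      rw [← Matrix.mulVecLin_apply, hv]
      exact map_zero _
    rw [hψ, Matrix.smul_mulVec, smul_eq_zero_iff_right hs0] at h1
    have h2 : algebraMap O K ∘ v = 0 := by
      rw [← Matrix.one_mulVec (algebraMap O K ∘ v), ← hρ, ← Matrix.mulVec_mulVec, h1,
        Matrix.mulVec_zero]
    funext b
    exact hinj ((congrFun h2 b).trans (map_zero _).symm)
  let N := LinearMap.range ψ.mulVecLin
  obtain ⟨m, snf⟩ := N.smithNormalForm (Pi.basisFun O ι)
  have hm : m = r := by
    have h1 := Module.finrank_eq_card_basis snf.bN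
    rw [LinearMap.finrank_range_of_inj hψinj] at h1
    simpa using h1.symm
  subst hm
  have ha : ∀ i, algebraMap O K (snf.a i) ≠ 0 := by
    intro i h
    rw [map_eq_zero_iff _ hinj] at h
    have := snf.snf i
    rw [h, zero_smul] at this
    exact snf.bN.ne_zero i (Subtype.ext this)
  -- Omitting the elementary divisors `snf.a` saturates `N`: the columns are part of a basis of the
  -- whole lattice.
  let φ' : Matrix ι (Fin m) O := Matrix.of fun a i => snf.bM (snf.f i) a
  have hE : ∀ b, ψ.mulVec (Pi.single b 1) ∈ N := fun b => ⟨Pi.single b 1, rfl⟩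
  let E : Matrix (Fin m) (Fin m) O := Matrix.of fun i b => snf.bN.repr ⟨_, hE b⟩ i * snf.a i
  have h1 : ψ = φ' * E := by
    ext a b
    have h2 := congrArg (fun v : N => (v : ι → O) a) (snf.bN.sum_repr ⟨_, hE b⟩)
    simp only [Submodule.coe_sum, Submodule.coe_smul, snf.snf, Finset.sum_apply, Pi.smul_apply,
      smul_eq_mul, Matrix.mulVec_single_one] at h2
    refine h2.symm.trans ?_
    rw [Matrix.mul_apply]
    exact Finset.sum_congr rfl fun i _ => by
      simp only [φ', E, Matrix.of_apply, Matrix.mulVec_single_one]; ring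
  choose W' hW' using fun i => (snf.bN i).2
  let W : Matrix (Fin m) (Fin m) O := Matrix.of fun b i => W' i b
  have h2 : φ' * Matrix.diagonal snf.a = ψ * W := by
    ext a i
    have h3 := congrFun (hW' i) a
    rw [snf.snf, Pi.smul_apply, smul_eq_mul] at h3
    rw [Matrix.mul_diagonal, mul_comm]
    exact h3.symm
  refine ⟨φ', Matrix.of fun i a => snf.bM.coord (snf.f i) (Pi.single a 1),
    algebraMap O K s • W.map (algebraMap O K) *
      Matrix.diagonal fun i => (algebraMap O K (snf.a i))⁻¹,
    (algebraMap O K s)⁻¹ • E.map (algebraMap O K), ?_, ?_, ?_⟩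
  · ext i j
    have h3 : ∑ a, snf.bM (snf.f j) a • Pi.single a (1 : O) = snf.bM (snf.f j) :=
      (pi_eq_sum_univ' _).symm
    have h4 := congrArg (snf.bM.coord (snf.f i)) h3
    rw [map_sum, Module.Basis.coord_apply snf.bM, Module.Basis.repr_self] at h4
    rw [Matrix.mul_apply]
    refine Eq.trans (Finset.sum_congr rfl fun a _ => ?_) (h4.trans ?_)
    · rw [map_smul, smul_eq_mul, mul_comm]; rfl
    · rw [Finsupp.single_apply, Matrix.one_apply]
      simp only [snf.f.injective.eq_iff, eq_comm]
  · rw [← Matrix.mul_assoc, Matrix.mul_smul, ← Matrix.smul_mul, ← hψ, ← Matrix.map_mul, ← h2,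
      Matrix.map_mul, Matrix.diagonal_map (map_zero _), Matrix.mul_assoc, Matrix.diagonal_mul_diagonal]
    have : (fun i => algebraMap O K (snf.a i) * (algebraMap O K (snf.a i))⁻¹) = fun _ => 1 :=
      funext fun i => mul_inv_cancel₀ (ha i)
    simp only [this, Matrix.diagonal_one, Matrix.mul_one]
  · rw [Matrix.mul_smul, ← Matrix.map_mul, ← h1, hψ, smul_smul, inv_mul_cancel₀ hs0, one_smul]

theorem map_C_map_map {σ A B : Type*} [CommRing A] [CommRing B] (f : A →+* B) {ι κ : Type*}
    (φ : Matrix ι κ A) :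
    (φ.map (C (σ := σ))).map (MvPolynomial.map f) = (φ.map f).map (C (σ := σ)) := by
  ext a b : 2
  simp

theorem mem_rankSequences_map {A R S : Type*} [CommRing A] [CommRing R] [CommRing S] [Algebra A S]
    (G : FreeComplex R) (g : R →+* S) (r : ℕ → ℕ) :
    r ∈ rankSequences A (G.map g) ↔ ∃ (f : ∀ i, Matrix (Fin (r i)) (Fin (r (i + 1))) S)
      (φ : ∀ i, Matrix (G.ι i) (Fin (r i)) A) (ρ : ∀ i, Matrix (Fin (r i)) (G.ι i) A),
      (∀ i, f i * f (i + 1) = 0) ∧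
      (∀ i, ρ i * φ i = 1) ∧
      ∀ i, (φ i).map (algebraMap A S) * f i = (G.d i).map g * (φ (i + 1)).map (algebraMap A S) :=
  Iff.rfl

theorem rankSequences_map_subset {σ A B : Type*} [CommRing A] [CommRing B] (f : A →+* B)
    (G : FreeComplex (MvPolynomial σ A)) :
    rankSequences A G ⊆ rankSequences B (G.map (MvPolynomial.map f)) := by
  rintro r ⟨h, φ, ρ, hh, hρ, hφ⟩
  rw [mem_rankSequences_map]
  refine ⟨fun i => (h i).map (MvPolynomial.map f), fun i => (φ i).map f, fun i => (ρ i).map f,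
    fun i => ?_, fun i => ?_, fun i => ?_⟩
  · rw [← Matrix.map_mul, hh, Matrix.map_zero _ (map_zero _)]
  · rw [← Matrix.map_mul, hρ, Matrix.map_one _ (map_zero _) (map_one _)]
  · have := congrArg (fun M => M.map (MvPolynomial.map (σ := σ) f)) (hφ i)
    simpa only [Matrix.map_mul, algebraMap_eq, map_C_map_map] using this

/-- Each column space over `K` is replaced by its saturated lattice over `O`. As this is a direct
summand, with projection `τ`, the only candidate for the restricted differential is `τ d ψ`; that it
works can be checked over `K`. -/
theorem rankSequences_fractionRing_subset {σ O K : Type*} [CommRing O] [IsDomain O]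
    [IsPrincipalIdealRing O] [Field K] [Algebra O K] [IsFractionRing O K]
    (G : FreeComplex (MvPolynomial σ O)) :
    rankSequences K (G.map (MvPolynomial.map (algebraMap O K))) ⊆ rankSequences O G := by
  intro r hr
  rw [mem_rankSequences_map] at hr
  obtain ⟨h, φ, ρ, hh, hρ, hφ⟩ := hr
  choose φ' ρ' g g' hρ' hg hg' using fun i => exists_saturated_basis (O := O) (φ i) (ρ i) (hρ i)
  have hinj : Function.Injective (MvPolynomial.map (σ := σ) (algebraMap O K)) :=
    map_injective _ (IsFractionRing.injective O K)
  let ψ : ∀ i, Matrix (G.ι i) (Fin (r i)) (MvPolynomial σ O) := fun i => (φ' i).map C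
  let τ : ∀ i, Matrix (Fin (r i)) (G.ι i) (MvPolynomial σ O) := fun i => (ρ' i).map C
  have hτ : ∀ i, τ i * ψ i = 1 := fun i => by
    simp only [τ, ψ]
    rw [← Matrix.map_mul, hρ', Matrix.map_one _ (map_zero _) (map_one _)]
  have hψ : ∀ i, ∃ x : Matrix (Fin (r i)) (Fin (r (i + 1))) (MvPolynomial σ O), ψ i * x = G.d i * ψ (i + 1) := by
    intro i
    refine ⟨τ i * (G.d i * ψ (i + 1)), ?_⟩
    apply Matrix.map_injective hinj
    dsimp only
    have h1 : ∀ i, (ψ i).map (MvPolynomial.map (algebraMap O K)) =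
        (φ i).map (C (σ := σ)) * (g i).map (C (σ := σ)) := fun i => by
      rw [map_C_map_map, hg, Matrix.map_mul]
    have h2 : ∀ i, (φ i).map (C (σ := σ)) =
        (ψ i).map (MvPolynomial.map (algebraMap O K)) * (g' i).map (C (σ := σ)) := fun i => by
      rw [map_C_map_map, ← Matrix.map_mul, ← hg']
    have h3 : (G.d i * ψ (i + 1)).map (MvPolynomial.map (algebraMap O K)) =
        (ψ i).map (MvPolynomial.map (algebraMap O K)) *
          ((g' i).map (C (σ := σ)) * (h i * (g (i + 1)).map (C (σ := σ)))) := by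
      rw [Matrix.map_mul, h1, ← Matrix.mul_assoc]
      have := hφ i
      simp only [algebraMap_eq] at this
      rw [← this, h2 i]
      simp only [Matrix.mul_assoc]
    rw [Matrix.map_mul, Matrix.map_mul, h3, ← Matrix.mul_assoc, ← Matrix.mul_assoc,
      Matrix.mul_assoc (Matrix.map (ψ i) _), ← Matrix.map_mul, hτ,
      Matrix.map_one _ (map_zero _) (map_one _), Matrix.mul_one]
  choose x hx using hψ
  refine ⟨x, φ', ρ', fun i => ?_, hρ', hx⟩
  rw [← Matrix.one_mul (x i * x (i + 1)), ← hτ, Matrix.mul_assoc, ← Matrix.mul_assoc (ψ i), hx,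
    Matrix.mul_assoc (G.d i), hx, ← Matrix.mul_assoc (G.d i), G.d_comp_d, Matrix.zero_mul,
    Matrix.mul_zero]

theorem FreeComplex.map_map {R S T : Type*} [CommRing R] [CommRing S] [CommRing T]
    (G : FreeComplex R) (f : R →+* S) (g : S →+* T) : (G.map f).map g = G.map (g.comp f) := rfl

/-- Subcomplexes over a purely transcendental extension specialize to subcomplexes over `k`. -/
theorem rankSequences_transcendental_subset {σ k : Type*} [Field k]
    (G : FreeComplex (MvPolynomial σ k)) :
    rankSequences (FractionRing (Polynomial k))
      (G.map (MvPolynomial.map (algebraMap k (FractionRing (Polynomial k))))) ⊆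
      rankSequences k G := by
  have h1 : MvPolynomial.map (σ := σ) (algebraMap k (FractionRing (Polynomial k))) =
      (MvPolynomial.map (algebraMap (Polynomial k) (FractionRing (Polynomial k)))).comp
        (MvPolynomial.map Polynomial.C) := by
    ext <;> simp [IsScalarTower.algebraMap_apply k (Polynomial k) (FractionRing (Polynomial k))]
  rw [h1, ← FreeComplex.map_map]
  refine (rankSequences_fractionRing_subset _).trans ?_
  -- Any value of the parameter would do: the left inverses specialize as well, so no rank drops.
  refine (rankSequences_map_subset (Polynomial.evalRingHom (0 : k)) _).trans ?_
  rw [FreeComplex.map_map]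
  have h2 : (MvPolynomial.map (σ := σ) (Polynomial.evalRingHom (0 : k))).comp
      (MvPolynomial.map Polynomial.C) = RingHom.id _ := by
    ext <;> simp
  rw [h2]
  exact subset_rfl

end Specialization

/-! ### Reduction to matrices of linear forms -/

section Linearization

open MvPolynomial

theorem hasParameters_of_X {σ k : Type*} [Field k] {I : Ideal (MvPolynomial σ k)}
    {gs : List (MvPolynomial σ k)} (hgs : ∀ g ∈ gs, constantCoeff g = 0)
    (hX : ∀ i, ∃ u, ∃ N : ℕ, constantCoeff u ≠ 0 ∧ u * X i ^ N ∈ I ⊔ Ideal.ofList gs) :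
    HasParameters I gs := by
  refine ⟨hgs, (maximalIdeal_le_radical_map_iff _).1 ?_⟩
  rw [← Localization.AtPrime.map_eq_maximalIdeal, Ideal.map_le_iff_le_comap]
  refine originIdeal_eq_idealOfVars.le.trans (Ideal.span_le.2 ?_)
  rintro _ ⟨i, rfl⟩
  obtain ⟨u, N, hu, huX⟩ := hX i
  refine ⟨N, ?_⟩
  have h1 := Ideal.mem_map_of_mem (algebraMap _ (OriginLocal σ k)) huX
  rw [map_mul, map_pow] at h1
  have h2 : IsUnit (algebraMap _ (OriginLocal σ k) u) :=
    IsLocalization.map_units (M := (originIdeal σ k).primeCompl) _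
      ⟨u, fun h => hu (mem_originIdeal.1 h)⟩
  exact (Ideal.unit_mul_mem_iff_mem _ h2).1 h1

theorem maximalMinor_sub_mem {R : Type*} [CommRing R] {p q : ℕ} {J : Ideal R}
    {Z Z' : Matrix (Fin p) (Fin q) R} (h : ∀ i j, Z i j - Z' i j ∈ J) (T : Finset (Fin q))
    (hT : #T = p) : maximalMinor Z T hT - maximalMinor Z' T hT ∈ J := by
  have h1 : Z.map (Ideal.Quotient.mk J) = Z'.map (Ideal.Quotient.mk J) := by
    ext i j
    exact Ideal.Quotient.eq.2 (h i j)
  rw [← Ideal.Quotient.eq, ← maximalMinor_map, ← maximalMinor_map, h1]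

theorem maximalMinorIdeal_le_of_sub_mem {R : Type*} [CommRing R] {p q : ℕ} {J : Ideal R}
    {Z Z' : Matrix (Fin p) (Fin q) R} (h : ∀ i j, Z i j - Z' i j ∈ J) :
    maximalMinorIdeal Z ≤ maximalMinorIdeal Z' ⊔ J := by
  refine Ideal.span_le.2 ?_
  rintro _ ⟨T, hT, rfl⟩
  have h1 := Ideal.add_mem (maximalMinorIdeal Z' ⊔ J)
    (Ideal.mem_sup_left (Ideal.subset_span ⟨T, hT, rfl⟩))
    (Ideal.mem_sup_right (maximalMinor_sub_mem h T hT))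
  rwa [add_sub_cancel] at h1

theorem isHomogeneous_linearForm {σ k : Type*} [Field k] [Fintype σ] (w : σ → k) :
    (linearForm w).IsHomogeneous 1 := by
  rw [linearForm_apply]
  exact IsHomogeneous.sum _ _ _ fun i _ => isHomogeneous_C_mul_X _ _

/-- A matrix with a system of parameters modulo its maximal minors can be replaced by a matrix of
linear forms, additively in the entries, such that the maximal minors define the origin. -/
theorem exists_linearization {k K : Type*} [Field k] [Field K] [Infinite K] (f : k →+* K)
    {n p q c : ℕ} (Z : Matrix (Fin p) (Fin q) (MvPolynomial (Fin n) k))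
    (hmin : ∀ i j, constantCoeff (Z i j) = 0) {gs : List (MvPolynomial (Fin n) k)}
    (hgs : HasParameters (maximalMinorIdeal Z) gs) (hlen : gs.length + c ≤ n) :
    ∃ L : MvPolynomial (Fin n) k →+ MvPolynomial (Fin c) K,
      (∀ a v, L (C a * v) = C (f a) * L v) ∧ (∀ v, (L v).IsHomogeneous 1) ∧
      HasParameters (maximalMinorIdeal (Z.map L)) [] := by
  classical
  let A : Finset (Fin n →₀ ℕ) := univ.biUnion fun i => univ.biUnion fun j => (Z i j).support
  have hA : ∀ i j, (Z i j).support ⊆ A := fun i j d hd =>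
    mem_biUnion.2 ⟨i, mem_univ _, mem_biUnion.2 ⟨j, mem_univ _, hd⟩⟩
  have hA0 : ∀ d ∈ A, d ≠ 0 := by
    rintro d hd rfl
    obtain ⟨i, -, hd⟩ := mem_biUnion.1 hd
    obtain ⟨j, -, hd⟩ := mem_biUnion.1 hd
    exact (mem_support_iff.1 hd) (by simpa [constantCoeff_eq] using hmin i j)
  -- One new variable is added for each monomial occurring in `Z`, and `L'` replaces such monomials
  -- by their variables.
  let σ := Fin n ⊕ A
  let ψ : MvPolynomial (Fin n) k →+* MvPolynomial σ K :=
    eval₂Hom (C.comp f) fun i => X (Sum.inl i)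
  let mono : (Fin n →₀ ℕ) → MvPolynomial σ K := fun d => ∏ i, X (Sum.inl i) ^ d i
  let L' : MvPolynomial (Fin n) k →+ MvPolynomial σ K :=
    { toFun := fun v => ∑ d : A, C (f (coeff d.1 v)) * X (Sum.inr d)
      map_zero' := by simp
      map_add' := fun v w => by
        rw [← Finset.sum_add_distrib]
        exact Finset.sum_congr rfl fun d _ => by rw [coeff_add, map_add, map_add, add_mul] }
  have hψcc : ∀ v, constantCoeff (ψ v) = f (constantCoeff v) := by
    intro v
    induction v using MvPolynomial.induction_on with
    | C r => simp [ψ]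
    | add f g hf hg => simp [hf, hg]
    | mul_X f i hf => simp [ψ]
  have hmono : ∀ d : A, ∃ i, X (Sum.inl i) ∣ mono d.1 := by
    intro d
    obtain ⟨i, hi⟩ := Finsupp.ne_iff.1 (hA0 d.1 d.2)
    exact ⟨i, (dvd_pow_self _ hi).trans (Finset.dvd_prod_of_mem _ (mem_univ i))⟩
  -- Modulo the added elements each new variable equals its monomial, so the linear matrix becomes
  -- `Z` again. There are as many added elements as added variables, so the count of parameters
  -- stays right.
  let gs' : List (MvPolynomial σ K) := gs.map ψ ++
    (univ : Finset A).toList.map fun d => X (Sum.inr d) - mono d.1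
  have hy : ∀ d : A, X (Sum.inr d) - mono d.1 ∈ Ideal.ofList gs' := fun d =>
    Ideal.subset_span (List.mem_append_right _ (List.mem_map.2 ⟨d, by simp, rfl⟩))
  have hsub : ∀ i j, (Z.map ψ) i j - (Z.map L') i j ∈ Ideal.ofList gs' := by
    intro i j
    have h1 : ψ (Z i j) = ∑ d : A, C (f (coeff d.1 (Z i j))) * mono d.1 := by
      refine (eval₂_eq' _ _ _).trans ?_
      rw [Finset.sum_coe_sort A (fun d => C (f (coeff d (Z i j))) * mono d)]
      refine Finset.sum_subset (hA i j) fun d _ hd => ?_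
      rw [notMem_support_iff.1 hd]
      simp
    have h2 : (Z.map ψ) i j - (Z.map L') i j =
        - ∑ d : A, C (f (coeff d.1 (Z i j))) * (X (Sum.inr d) - mono d.1) := by
      rw [Matrix.map_apply, h1, ← Finset.sum_neg_distrib]
      change _ - ∑ d : A, C (f (coeff d.1 (Z i j))) * X (Sum.inr d) = _
      rw [← Finset.sum_sub_distrib]
      exact Finset.sum_congr rfl fun d _ => by ring
    rw [h2]
    exact neg_mem (Ideal.sum_mem _ fun d _ => Ideal.mul_mem_left _ _ (hy d))
  have hle : (maximalMinorIdeal Z ⊔ Ideal.ofList gs).map ψ ≤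
      maximalMinorIdeal (Z.map L') ⊔ Ideal.ofList gs' := by
    rw [Ideal.map_sup, ← maximalMinorIdeal_map, Ideal.map_ofList]
    refine sup_le (maximalMinorIdeal_le_of_sub_mem hsub) (le_sup_of_le_right ?_)
    exact Ideal.span_mono fun g hg => List.mem_append_left _ hg
  have hinl : ∀ i, ∃ u, ∃ N : ℕ, constantCoeff u ≠ 0 ∧ u * X (Sum.inl i) ^ N ∈
      maximalMinorIdeal (Z.map L') ⊔ Ideal.ofList gs' := by
    intro i
    obtain ⟨u, N, hu, huv⟩ := hgs.2 (X i) (by simp)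
    refine ⟨ψ u, N, ?_, ?_⟩
    · rw [hψcc, Ne, map_eq_zero]; exact hu
    · have := hle (Ideal.mem_map_of_mem ψ huv)
      simpa [ψ] using this
  have hpar : HasParameters (maximalMinorIdeal (Z.map L')) gs' := by
    refine hasParameters_of_X (fun g hg => ?_) ?_
    · rcases List.mem_append.1 hg with hg | hg
      · obtain ⟨g', hg', rfl⟩ := List.mem_map.1 hg
        rw [hψcc, hgs.1 g' hg', map_zero]
      · obtain ⟨d, -, rfl⟩ := List.mem_map.1 hg
        obtain ⟨i, t, ht⟩ := hmono d
        rw [ht]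
        simp
    · rintro (i | d)
      · exact hinl i
      · obtain ⟨i, t, ht⟩ := hmono d
        obtain ⟨u, N, hu, huv⟩ := hinl i
        refine ⟨u, N, hu, ?_⟩
        have h1 : u * X (Sum.inr d) ^ N = u * (X (Sum.inr d) ^ N - mono d.1 ^ N) +
            t ^ N * (u * X (Sum.inl i) ^ N) := by
          rw [ht]; ring
        rw [h1]
        refine Ideal.add_mem _ (Ideal.mul_mem_left _ _ (Ideal.mem_sup_right ?_))
          (Ideal.mul_mem_left _ _ huv)
        exact Ideal.mem_of_dvd _ (sub_dvd_pow_sub_pow _ _ _) (hy d)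
  obtain ⟨a, ha⟩ := hpar.exists_linearSubst (c := c) (by
    simp only [gs', List.length_append, List.length_map, Finset.length_toList, card_univ, σ,
      Fintype.card_sum, Fintype.card_fin]
    omega)
  refine ⟨(linearSubst a : MvPolynomial σ K →ₐ[K] MvPolynomial (Fin c) K).toRingHom.toAddMonoidHom.comp L', fun b v => ?_,
    fun v => ?_, ?_⟩
  · have h1 : L' (C b * v) = C (f b) * L' v := by
      change ∑ d : A, _ = C (f b) * ∑ d : A, _
      rw [Finset.mul_sum]
      exact Finset.sum_congr rfl fun d _ => by rw [coeff_C_mul, map_mul, map_mul, mul_assoc]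
    change linearSubst a (L' (C b * v)) = C (f b) * linearSubst a (L' v)
    rw [h1, map_mul]
    congr 1
    exact (linearSubst a).commutes (f b)
  · change (linearSubst a (∑ d : A, C (f (coeff d.1 v)) * X (Sum.inr d))).IsHomogeneous 1
    rw [map_sum]
    refine IsHomogeneous.sum _ _ _ fun d _ => ?_
    rw [← smul_eq_C_mul, map_smul, smul_eq_C_mul, linearSubst, aeval_X]
    have := (isHomogeneous_C (Fin c) (f (coeff d.1 v))).mul (isHomogeneous_linearForm (a (Sum.inr d)))
    rwa [zero_add] at this
  · have h1 := maximalMinorIdeal_map (linearSubst a : MvPolynomial σ K →ₐ[K] MvPolynomial (Fin c) K).toRingHom (Z.map L')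
    have h2 : Z.map ((linearSubst a : MvPolynomial σ K →ₐ[K] MvPolynomial (Fin c) K).toRingHom.toAddMonoidHom.comp L') =
        (Z.map L').map (linearSubst a : MvPolynomial σ K →ₐ[K] MvPolynomial (Fin c) K).toRingHom := rfl
    rw [h2, h1]
    exact ha

theorem posSign_mem (k : Type*) {R : Type*} [Field k] [CommRing R] [Algebra k R] {m : ℕ}
    (T : Finset (Fin m)) (s : Fin m) : posSign R T s = algebraMap k R (posSign k T s) := by
  simp [posSign]

/-- The entries of the differentials in positive degrees are signed sums of entries of `Z`, so no
multiplicativity of `L` is needed. The minors in degree zero are not preserved in this way. -/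
theorem enEntry_map_addHom {k K σ τ : Type*} [Field k] [Field K] (f : k →+* K)
    (L : MvPolynomial σ k →+ MvPolynomial τ K) (hL : ∀ a v, L (C a * v) = C (f a) * L v)
    {p q : ℕ} (Z : Matrix (Fin p) (Fin q) (MvPolynomial σ k))
    (y x : (Fin p → ℕ) × Finset (Fin q)) : enEntry (Z.map L) y x = L (enEntry Z y x) := by
  simp only [enEntry, map_sum, apply_ite L, map_zero, Matrix.map_apply,
    posSign_mem k (R := MvPolynomial σ k), posSign_mem K (R := MvPolynomial τ K), algebraMap_eq, hL,
    posSign_map f]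

theorem enDifferential_isMinimal {σ k : Type*} [Field k] {p q : ℕ} (hp : 1 ≤ p)
    {Z : Matrix (Fin p) (Fin q) (MvPolynomial σ k)} (hZ : ∀ i j, constantCoeff (Z i j) = 0) :
    (eagonNorthcott Z).IsMinimal := by
  have h0 : Z.map (constantCoeff (R := k) (σ := σ)) = 0 := by
    ext i j; exact hZ i j
  intro i a b
  have h := congrFun (congrFun (enDifferential_map (constantCoeff (R := k) (σ := σ)) Z i) a) b
  refine h.symm.trans ?_
  rw [h0]
  cases i with
  | zero =>
    have : Nonempty (Fin p) := ⟨⟨0, hp⟩⟩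
    exact Matrix.det_zero
  | succ i =>
    change enEntry 0 _ _ = 0
    simp [enEntry]

/-- At the origin a boundary of a minimal complex vanishes, whereas `u • C z` takes the value `u(0)
z`. -/
theorem eq_zero_of_mulVec_C_eq_zero {σ k : Type*} [Field k] {G : FreeComplex (MvPolynomial σ k)}
    (hG : G.IsMinimal) {i : ℕ} {z : G.ι (i + 1) → k}
    (h : ∃ (u : MvPolynomial σ k) (w : _), constantCoeff u ≠ 0 ∧
      (G.d (i + 1)).mulVec w = u • fun b => C (z b)) : z = 0 := by
  obtain ⟨u, w, hu, h⟩ := h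
  funext b
  have h1 := congrArg constantCoeff (congrFun h b)
  simp only [Matrix.mulVec, dotProduct, map_sum, map_mul, hG _ _ _, zero_mul, Finset.sum_const_zero,
    Pi.smul_apply, smul_eq_mul, constantCoeff_C] at h1
  simpa [hu] using h1.symm

end Linearization

/-! ### The power matrix and transfer of subcomplexes to its complex -/

section PowerMatrix

open MvPolynomial

theorem powerMatrix_apply (k : Type*) [Field k] {n d : ℕ} (i : Fin d) (j : Fin (n + d - 1)) :
    powerMatrix k n d i j = if h : i.val ≤ j.val ∧ j.val - i.val < n then
      (X ⟨j.val - i.val, h.2⟩ : MvPolynomial (Fin n) k) else 0 := rfl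

theorem powerMatrix_isHomogeneous (k : Type*) [Field k] {n d : ℕ} (i : Fin d)
    (j : Fin (n + d - 1)) : (powerMatrix k n d i j).IsHomogeneous 1 := by
  rw [powerMatrix_apply]
  split_ifs
  · exact isHomogeneous_X _ _
  · exact isHomogeneous_zero _ _ _

theorem constantCoeff_eq_zero_of_isHomogeneous {σ k : Type*} [Field k] {f : MvPolynomial σ k}
    {e : ℕ} (he : e ≠ 0) (hf : f.IsHomogeneous e) : constantCoeff f = 0 := by
  rw [constantCoeff_eq]
  exact hf.coeff_eq_zero (by simpa using he.symm)

theorem powerMatrix_map {k K : Type*} [Field k] [Field K] (f : k →+* K) (n d : ℕ) :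
    (powerMatrix k n d).map (MvPolynomial.map f) = powerMatrix K n d := by
  ext i j : 2
  rw [Matrix.map_apply, powerMatrix_apply, powerMatrix_apply]
  split_ifs <;> simp

/-- A prime ideal containing the maximal minors of the power matrix contains the variables. -/
theorem X_mem_of_maximalMinorIdeal_powerMatrix_le {k : Type*} [Field k] {n d : ℕ}
    {P : Ideal (MvPolynomial (Fin n) k)} (hP : P.IsPrime)
    (hle : maximalMinorIdeal (powerMatrix k n d) ≤ P) (l : Fin n) : X l ∈ P := by
  obtain ⟨l, hl⟩ := l
  induction l using Nat.strong_induction_on with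
  | _ l ih =>
  -- The columns from `l` to `l + d - 1`: modulo `P` the variables before `X l` vanish by induction,
  -- so this block is upper triangular with `X l` on the diagonal.
  let e : Fin d ↪o Fin (n + d - 1) :=
    OrderEmbedding.ofStrictMono (fun j => ⟨l + j.1, by omega⟩) fun a b hab => by
      simpa using hab
  have hT : #(univ.map e.toEmbedding) = d := by simp
  have h1 : maximalMinor (powerMatrix k n d) (univ.map e.toEmbedding) hT ∈ P :=
    hle (Ideal.subset_span ⟨_, hT, rfl⟩)
  have h2 : (univ.map e.toEmbedding).orderEmbOfFin hT = e := by
    ext1 j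
    exact (congrFun (orderEmbOfFin_unique hT (fun x => mem_map_of_mem _ (mem_univ x))
      e.strictMono) j).symm
  have he : ∀ j, (e j : ℕ) = l + j := fun j => rfl
  rw [maximalMinor, h2, ← Ideal.Quotient.eq_zero_iff_mem, RingHom.map_det,
    Matrix.det_of_isUpperTriangular] at h1
  · obtain ⟨i, -, hi⟩ := (Finset.prod_eq_zero_iff).1 h1
    rw [RingHom.mapMatrix_apply, Matrix.map_apply, Matrix.submatrix_apply,
      Ideal.Quotient.eq_zero_iff_mem, powerMatrix_apply] at hi
    have h3 : ((id i : Fin d) : ℕ) ≤ (e i : ℕ) ∧ (e i : ℕ) - (id i : Fin d) < n := by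
      rw [he]; simp only [id]; omega
    rw [dif_pos h3] at hi
    convert hi using 3
    rw [he]; simp
  · intro i j hij
    have hij' : j.1 < i.1 := hij
    rw [RingHom.mapMatrix_apply, Matrix.map_apply, Matrix.submatrix_apply,
      Ideal.Quotient.eq_zero_iff_mem, powerMatrix_apply]
    split_ifs with h
    · refine ih _ ?_ _
      have h3 := h.1
      rw [he] at h3 ⊢
      simp only [id] at h3 ⊢
      omega
    · exact P.zero_mem

theorem powerMatrix_hasParameters (k : Type*) [Field k] (n d : ℕ) :
    HasParameters (maximalMinorIdeal (powerMatrix k n d)) [] := by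
  refine hasParameters_of_X (by simp) fun l => ?_
  have h1 : X l ∈ (maximalMinorIdeal (powerMatrix k n d)).radical := by
    rw [Ideal.radical_eq_sInf, Submodule.mem_sInf]
    rintro P ⟨hle, hP⟩
    exact X_mem_of_maximalMinorIdeal_powerMatrix_le hP hle l
  obtain ⟨N, hN⟩ := h1
  exact ⟨1, N, by simp, by rw [one_mul]; exact Ideal.mem_sup_left hN⟩

theorem finrank_homogeneousSubmodule (K : Type*) [Field K] (c p : ℕ) :
    Module.finrank K (homogeneousSubmodule (Fin c) K p) = (c + p - 1).choose p := by
  rw [homogeneousSubmodule_eq_finsupp_supported]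
  refine (Module.finrank_eq_nat_card_basis
    (basisRestrictSupport K {d : Fin c →₀ ℕ | d.degree = p})).trans ?_
  have h1 : {d : Fin c →₀ ℕ | d.degree = p} = ↑((univ : Finset (Fin c)).finsuppAntidiag p) := by
    ext d
    simp [Finsupp.degree_eq_sum]
  rw [h1, Nat.card_coe_set_eq, Set.ncard_coe_finset, card_finsuppAntidiag_nat_eq_choose]
  simp

theorem card_enBasis_zero (p q : ℕ) : #(enBasis p q 0) = q.choose p := by
  simp [enBasis]

theorem eagonNorthcott_isAcyclic_of_linear {K : Type*} [Field K] {p c : ℕ}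
    {Z : Matrix (Fin p) (Fin (c + p - 1)) (MvPolynomial (Fin c) K)} (hc : 1 ≤ c)
    (hZ : ∀ i j, (Z i j).IsHomogeneous 1) (h : HasParameters (maximalMinorIdeal Z) []) :
    (eagonNorthcott Z).IsAcyclic :=
  eagonNorthcott_isAcyclic (by omega) hZ h (by simp; omega)

/-- A linear relation over `K` is a constant cycle in degree one, hence a boundary, and nonzero
constant vectors are not boundaries in a minimal complex. -/
theorem linearIndependent_maximalMinors {K σ : Type*} [Field K] {p q : ℕ} (hp : 1 ≤ p)
    {Z : Matrix (Fin p) (Fin q) (MvPolynomial σ K)} (hZ : ∀ i j, constantCoeff (Z i j) = 0)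
    (h : (eagonNorthcott Z).IsAcyclic) :
    LinearIndependent K fun x : ↥(enBasis p q 0) =>
      maximalMinor Z x.1.2 (enBasis_card x.2) := by
  rw [Fintype.linearIndependent_iff]
  intro g hg
  have h1 : ((eagonNorthcott Z).d 0).mulVec (fun x => C (g x)) = 0 := by
    funext a
    refine Eq.trans (Finset.sum_congr rfl fun x _ => ?_) hg
    rw [smul_eq_C_mul, mul_comm]
    rfl
  obtain ⟨w, hw⟩ := h 0 _ h1
  have h2 := eq_zero_of_mulVec_C_eq_zero (enDifferential_isMinimal hp hZ) (z := g)
    ⟨1, w, by simp, by rw [hw, one_smul]⟩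
  exact fun x => congrFun h2 x

theorem maximalMinor_isHomogeneous {σ K : Type*} [Field K] {p q e : ℕ}
    {Z : Matrix (Fin p) (Fin q) (MvPolynomial σ K)} (hZ : ∀ i j, (Z i j).IsHomogeneous e)
    (x : ↥(enBasis p q 0)) : (maximalMinor Z x.1.2 (enBasis_card x.2)).IsHomogeneous (p * e) :=
  eagonNorthcott_isHomogeneous hZ 0 () x

/-- If the maximal minors of a matrix of linear forms in the right number of variables define the
origin, they span all forms of their degree. -/
theorem span_maximalMinors_eq {K : Type*} [Field K] {p c : ℕ} (hp : 1 ≤ p)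
    {Z : Matrix (Fin p) (Fin (c + p - 1)) (MvPolynomial (Fin c) K)} (hc : 1 ≤ c)
    (hZ : ∀ i j, (Z i j).IsHomogeneous 1) (h : HasParameters (maximalMinorIdeal Z) []) :
    Submodule.span K (Set.range fun x : ↥(enBasis p (c + p - 1) 0) =>
      maximalMinor Z x.1.2 (enBasis_card x.2)) = homogeneousSubmodule (Fin c) K p := by
  have hfin : Module.Finite K (homogeneousSubmodule (Fin c) K p) :=
    Module.Finite.iff_fg.2 (homogeneousSubmodule_fg _ _ p)
  refine Submodule.eq_of_le_of_finrank_eq (Submodule.span_le.2 ?_) ?_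
  · rintro _ ⟨x, rfl⟩
    have := maximalMinor_isHomogeneous hZ x
    rwa [mul_one] at this
  -- The minors are independent and as numerous as the monomials of degree `p` in `c` variables.
  · rw [finrank_span_eq_card (linearIndependent_maximalMinors hp
      (fun i j => constantCoeff_eq_zero_of_isHomogeneous one_ne_zero (hZ i j))
      (eagonNorthcott_isAcyclic_of_linear hc hZ h)), finrank_homogeneousSubmodule,
      Fintype.card_coe, card_enBasis_zero]

theorem maximalMinorIdeal_eq_span {R : Type*} [CommRing R] {p q : ℕ}
    (Z : Matrix (Fin p) (Fin q) R) : maximalMinorIdeal Z =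
      Ideal.span (Set.range fun x : ↥(enBasis p q 0) => maximalMinor Z x.1.2 (enBasis_card x.2)) := by
  rw [maximalMinorIdeal]
  congr 1
  ext m
  constructor
  · rintro ⟨T, hT, rfl⟩
    exact ⟨⟨(0, T), mem_enBasis (by simp) hT⟩, rfl⟩
  · rintro ⟨x, rfl⟩
    exact ⟨_, _, rfl⟩

theorem maximalMinorIdeal_eq_span_homogeneous {K : Type*} [Field K] {p c : ℕ} (hp : 1 ≤ p)
    {Z : Matrix (Fin p) (Fin (c + p - 1)) (MvPolynomial (Fin c) K)} (hc : 1 ≤ c)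
    (hZ : ∀ i j, (Z i j).IsHomogeneous 1) (h : HasParameters (maximalMinorIdeal Z) []) :
    maximalMinorIdeal Z = Ideal.span (homogeneousSubmodule (Fin c) K p : Set _) := by
  rw [← span_maximalMinors_eq hp hc hZ h, maximalMinorIdeal_eq_span]
  exact (Submodule.span_span_of_tower K (MvPolynomial (Fin c) K) _).symm

theorem range_enDifferential_zero {R : Type*} [CommRing R] {p q : ℕ}
    (Z : Matrix (Fin p) (Fin q) R) :
    LinearMap.range ((eagonNorthcott Z).d 0).mulVecLin =
      Submodule.comap (LinearMap.proj (R := R) (φ := fun _ : Unit => R) ()) (maximalMinorIdeal Z) := by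
  ext v
  change _ ↔ v () ∈ maximalMinorIdeal Z
  rw [maximalMinorIdeal_eq_span]
  refine Iff.trans ?_ (Submodule.mem_span_range_iff_exists_fun R).symm
  constructor
  · rintro ⟨w, rfl⟩
    refine ⟨w, Finset.sum_congr rfl fun x _ => ?_⟩
    rw [smul_eq_mul, mul_comm]
    rfl
  · rintro ⟨w, hw⟩
    refine ⟨w, funext fun a => ?_⟩
    refine Eq.trans (Finset.sum_congr rfl fun x _ => ?_) hw
    rw [smul_eq_mul, mul_comm]
    rfl

/-- Both ideals of minors are generated by all forms of degree `p`, so the two complexes are minimal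
resolutions of the same module and can be compared. -/
theorem rankSequences_linear_subset {K : Type*} [Field K] {p c : ℕ} (hp : 1 ≤ p) (hc : 1 ≤ c)
    {Z : Matrix (Fin p) (Fin (c + p - 1)) (MvPolynomial (Fin c) K)}
    (hZ : ∀ i j, (Z i j).IsHomogeneous 1) (h : HasParameters (maximalMinorIdeal Z) []) :
    rankSequences (MvPolynomial (Fin c) K) (eagonNorthcott Z) ⊆
      rankSequences K (eagonNorthcott (powerMatrix K c p)) := by
  have hZ0 : ∀ i j, constantCoeff (Z i j) = 0 := fun i j =>
    constantCoeff_eq_zero_of_isHomogeneous one_ne_zero (hZ i j)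
  obtain ⟨β, ρ, hβ, hρ⟩ := exists_comparison (F := eagonNorthcott Z)
    (G := eagonNorthcott (powerMatrix K c p))
    (eagonNorthcott_isAcyclic_of_linear hc hZ h)
    (eagonNorthcott_isAcyclic_of_linear hc (powerMatrix_isHomogeneous K)
      (powerMatrix_hasParameters K c p))
    (enDifferential_isMinimal hp hZ0)
    (Submodule.quotEquivOfEq _ _ (by
      refine (range_enDifferential_zero Z).trans ?_
      refine Eq.trans ?_ (range_enDifferential_zero (powerMatrix K c p)).symm
      rw [maximalMinorIdeal_eq_span_homogeneous hp hc hZ h,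
        maximalMinorIdeal_eq_span_homogeneous hp hc (powerMatrix_isHomogeneous K)
          (powerMatrix_hasParameters K c p)]))
  exact rankSequences_subset_of_comparison
    (eagonNorthcott_isHomogeneous (powerMatrix_isHomogeneous K)) β ρ hβ hρ

theorem zero_mem_rankSequences {A R : Type*} [CommRing A] [CommRing R] [Algebra A R]
    (G : FreeComplex R) {r : ℕ → ℕ} (hr : ∀ i, r i = 0) : r ∈ rankSequences A G := by
  obtain rfl : r = fun _ => 0 := funext hr
  refine ⟨fun _ => 0, fun _ => 0, fun _ => 0, fun _ => ?_, fun _ => ?_, fun _ => ?_⟩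
  · simp
  · exact Subsingleton.elim _ _
  · exact Matrix.ext fun _ b => b.elim0

theorem rankSequences_zero_le_one {k S : Type*} [Field k] [CommRing S] [Algebra k S]
    {G : FreeComplex S} {r : ℕ → ℕ} (hr : r ∈ rankSequences k G)
    (hG : Fintype.card (G.ι 0) = 1) : r 0 = 0 ∨ r 0 = 1 := by
  obtain ⟨f, φ, ρ, -, hρ, -⟩ := hr
  have h1 : r 0 ≤ 1 := by
    have h2 := Matrix.rank_mul_le_right (ρ 0) (φ 0)
    rw [hρ, Matrix.rank_one, Fintype.card_fin] at h2
    exact h2.trans ((Matrix.rank_le_card_height _).trans hG.le)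
  omega

theorem card_eagonNorthcott_zero {R : Type*} [CommRing R] {p q : ℕ}
    (Z : Matrix (Fin p) (Fin q) R) : Fintype.card ((eagonNorthcott Z).ι 0) = 1 := rfl

/-- A subcomplex over the field that vanishes in degree zero vanishes, in a minimal complex that is
exact in positive degrees at the origin. -/
theorem rankSequences_eq_zero {σ k : Type*} [Field k] {G : FreeComplex (MvPolynomial σ k)}
    (hmin : G.IsMinimal)
    (hex : ∀ i z, (G.d i).mulVec z = 0 → ∃ (u : MvPolynomial σ k) (w : _), constantCoeff u ≠ 0 ∧
      (G.d (i + 1)).mulVec w = u • z)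
    {r : ℕ → ℕ} (hr : r ∈ rankSequences k G) (h0 : r 0 = 0) (i : ℕ) : r i = 0 := by
  obtain ⟨f, φ, ρ, -, hρ, hφ⟩ := hr
  induction i with
  | zero => exact h0
  | succ i ih =>
    have hempty : IsEmpty (Fin (r i)) := by rw [ih]; infer_instance
    have h1 : φ (i + 1) = 0 := by
      ext a b
      have h2 : (G.d i).mulVec (fun a => C (φ (i + 1) a b)) = 0 := by
        funext c
        have h3 := congrFun (congrFun (hφ i) c) b
        rw [Matrix.mul_apply, Finset.univ_eq_empty, Finset.sum_empty] at h3
        exact h3.symm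
      exact congrFun (eq_zero_of_mulVec_C_eq_zero hmin (z := fun a => φ (i + 1) a b)
        (hex i _ h2)) a
    have h2 := hρ (i + 1)
    rw [h1, Matrix.mul_zero] at h2
    by_contra hne
    have := congrFun (congrFun h2 ⟨0, Nat.pos_of_ne_zero hne⟩) ⟨0, Nat.pos_of_ne_zero hne⟩
    simp at this

theorem map_map_addHom {k K σ τ : Type*} [Field k] [Field K] (f : k →+* K)
    (L : MvPolynomial σ k →+ MvPolynomial τ K) (hL : ∀ a v, L (C a * v) = C (f a) * L v)
    {ι κ μ : Type*} [Fintype κ] (M : Matrix ι κ (MvPolynomial σ k)) (φ : Matrix κ μ k) :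
    (M * φ.map (C (σ := σ))).map L = M.map L * (φ.map f).map (C (σ := τ)) := by
  refine Matrix.ext fun a b => ?_
  rw [Matrix.map_apply, Matrix.mul_apply, Matrix.mul_apply, map_sum]
  refine Finset.sum_congr rfl fun c _ => ?_
  simp only [Matrix.map_apply]
  rw [mul_comm, hL, mul_comm]

theorem map_addHom_map {k K σ τ : Type*} [Field k] [Field K] (f : k →+* K)
    (L : MvPolynomial σ k →+ MvPolynomial τ K) (hL : ∀ a v, L (C a * v) = C (f a) * L v)
    {ι κ μ : Type*} [Fintype κ] (φ : Matrix ι κ k) (M : Matrix κ μ (MvPolynomial σ k)) :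
    (φ.map (C (σ := σ)) * M).map L = (φ.map f).map (C (σ := τ)) * M.map L := by
  refine Matrix.ext fun a b => ?_
  rw [Matrix.map_apply, Matrix.mul_apply, Matrix.mul_apply, map_sum]
  refine Finset.sum_congr rfl fun c _ => ?_
  simp only [Matrix.map_apply]
  rw [hL]

/-- An additive map applied to the entries of the differentials in positive degrees preserves the
subcomplexes over the field that are everything in degree zero. -/
theorem mem_rankSequences_of_addHom {k K σ τ : Type*} [Field k] [Field K] (a : k →+* K)
    (L : MvPolynomial σ k →+ MvPolynomial τ K) (hL : ∀ b v, L (C b * v) = C (a b) * L v)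
    {G : FreeComplex (MvPolynomial σ k)}
    (D : ∀ i, Matrix (G.ι i) (G.ι (i + 1)) (MvPolynomial τ K)) (hD : ∀ i, D i * D (i + 1) = 0)
    (hDL : ∀ i, D (i + 1) = (G.d (i + 1)).map L) {r : ℕ → ℕ} (hr : r ∈ rankSequences k G)
    (h0 : r 0 = Fintype.card (G.ι 0)) :
    r ∈ rankSequences K (⟨G.ι, G.fin, D, hD⟩ : FreeComplex (MvPolynomial τ K)) := by
  classical
  obtain ⟨f, φ, ρ, -, hρ, hφ⟩ := hr
  let Φ : ∀ i, Matrix (G.ι i) (Fin (r i)) (MvPolynomial τ K) := fun i => ((φ i).map a).map C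
  let P : ∀ i, Matrix (Fin (r i)) (G.ι i) (MvPolynomial τ K) := fun i => ((ρ i).map a).map C
  have hP : ∀ i, P i * Φ i = 1 := fun i => by
    simp only [P, Φ]
    rw [← Matrix.map_mul, ← Matrix.map_mul, hρ, Matrix.map_one _ (map_zero _) (map_one _),
      Matrix.map_one _ (map_zero _) (map_one _)]
  -- In degree zero `Φ 0` is a square invertible matrix, so every map into the target factors
  -- through it. This is why `D 0` need not be related to `G.d 0`.
  have hx : ∀ i, ∃ x : Matrix (Fin (r i)) (Fin (r (i + 1))) (MvPolynomial τ K),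
      Φ i * x = D i * Φ (i + 1)
    | 0 => by
      have h1 : Φ 0 * P 0 = 1 :=
        (Matrix.mul_eq_one_comm_of_card_eq _ _ _ (by rw [← h0, Fintype.card_fin])).1 (hP 0)
      exact ⟨P 0 * (D 0 * Φ 1), by rw [← Matrix.mul_assoc, h1, Matrix.one_mul]⟩
    | i + 1 => by
      refine ⟨(f (i + 1)).map L, ?_⟩
      rw [hDL]
      have h2 := congrArg (fun M => M.map L) (hφ (i + 1))
      simp only [algebraMap_eq] at h2
      rw [map_addHom_map a L hL, map_map_addHom a L hL] at h2
      exact h2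
  choose x hx using hx
  refine ⟨x, fun i => (φ i).map a, fun i => (ρ i).map a, fun i => ?_, fun i => ?_, hx⟩
  · rw [← Matrix.one_mul (x i * x (i + 1)), ← hP, Matrix.mul_assoc, ← Matrix.mul_assoc (Φ i), hx,
      Matrix.mul_assoc (D i), hx, ← Matrix.mul_assoc (D i), hD, Matrix.zero_mul, Matrix.mul_zero]
  · dsimp only
    exact (Matrix.map_mul (f := a)).symm.trans
      (by rw [hρ, Matrix.map_one _ (map_zero _) (map_one _)])

/-- Subcomplexes over the field of the Eagon–Northcott complex of a matrix of the expected
codimension occur in the Eagon–Northcott complex of the power matrix. -/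
theorem rankSequences_subset_powerMatrix {k : Type*} [Field k] {n p q c : ℕ} (hp : 1 ≤ p)
    (hc : 1 ≤ c) (hq : q = c + p - 1) (Z : Matrix (Fin p) (Fin q) (MvPolynomial (Fin n) k))
    (hmin : ∀ i j, constantCoeff (Z i j) = 0) {gs : List (MvPolynomial (Fin n) k)}
    (hgs : HasParameters (maximalMinorIdeal Z) gs) (hlen : gs.length + c ≤ n) :
    rankSequences k (eagonNorthcott Z) ⊆ rankSequences k (eagonNorthcott (powerMatrix k c p)) := by
  subst hq
  intro r hr
  have hzero := rankSequences_eq_zero (enDifferential_isMinimal hp hmin)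
    (eagonNorthcott_exact_at_origin (by omega) Z hgs (by omega)) hr
  rcases rankSequences_zero_le_one hr (card_eagonNorthcott_zero Z) with h0 | h0
  · exact zero_mem_rankSequences _ (hzero h0)
  -- `k` may be finite, while the choice of linear parameters requires an infinite field.
  let K := FractionRing (Polynomial k)
  have : Infinite K := Infinite.of_injective _ (IsFractionRing.injective (Polynomial k) K)
  obtain ⟨L, hL, hL1, hLp⟩ := exists_linearization (algebraMap k K) Z hmin hgs hlen
  have hlin : ∀ i j, ((Z.map L) i j).IsHomogeneous 1 := fun i j => hL1 _
  have hDL : ∀ i, enDifferential (Z.map L) (i + 1) = (enDifferential Z (i + 1)).map L := fun i =>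
    Matrix.ext fun (y : ↥(enBasis p (c + p - 1) i)) (x : ↥(enBasis p (c + p - 1) (i + 1))) =>
      enEntry_map_addHom (algebraMap k K) L hL Z y.1 x.1
  have key : r ∈ rankSequences K (eagonNorthcott (Z.map L)) :=
    mem_rankSequences_of_addHom (G := eagonNorthcott Z) (algebraMap k K) L hL
      (enDifferential (Z.map L)) (eagonNorthcott (Z.map L)).d_comp_d hDL hr
      (by rw [h0, card_eagonNorthcott_zero])
  have h2 := rankSequences_linear_subset hp hc hlin hLp (rankSequences_subset_rankSequences _ key)
  rw [← powerMatrix_map (algebraMap k K), eagonNorthcott_map] at h2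
  exact rankSequences_transcendental_subset _ h2

end PowerMatrix

/-! ### Subcomplexes of linear complexes -/

section AnticommutingOperators

variable {k X : Type*} [Field k] [AddCommGroup X] [Module k X] {c : ℕ}

/-- The product of the operators `D l` over `l ∈ J`, the smallest index being applied first. -/
noncomputable def operatorProduct (D : Fin c → Module.End k X) (J : Finset (Fin c)) :
    Module.End k X :=
  ((J.sort (· ≥ ·)).map D).prod

theorem operatorProduct_empty (D : Fin c → Module.End k X) : operatorProduct D ∅ = 1 := by
  simp [operatorProduct]

theorem operatorProduct_insert (D : Fin c → Module.End k X) {J : Finset (Fin c)} {m : Fin c}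
    (hm : ∀ l ∈ J, l < m) : operatorProduct D (insert m J) = D m * operatorProduct D J := by
  rw [operatorProduct, Finset.sort_insert (r := (· ≥ ·)) (fun l hl => (hm l hl).le)
    (fun h => (hm m h).false), List.map_cons, List.prod_cons]
  rfl

theorem posSign_insert_max (k : Type*) [CommRing k] {J : Finset (Fin c)} {l m : Fin c} (h : l < m) :
    posSign k (insert m J) l = posSign k J l := by
  rw [posSign, posSign, Finset.filter_insert, if_neg h.not_gt]

theorem posSign_insert_self_max (k : Type*) [CommRing k] {J : Finset (Fin c)} {l : Fin c}
    (h : ∀ t ∈ J, t < l) : posSign k (insert l J) l = (-1) ^ #J := by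
  rw [posSign, Finset.filter_insert, if_neg (lt_irrefl l), Finset.filter_true_of_mem h]

/-- The operators define an action of the exterior algebra; this is its multiplication rule for a
basis monomial times a generator. -/
theorem operatorProduct_mul {D : Fin c → Module.End k X} (h0 : ∀ l, D l * D l = 0)
    (h1 : ∀ l m, D l * D m = - (D m * D l)) (J : Finset (Fin c)) (l : Fin c) :
    operatorProduct D J * D l =
      if l ∈ J then 0 else posSign k (insert l J) l • operatorProduct D (insert l J) := by
  induction J using Finset.induction_on_max with
  | empty =>
    rw [if_neg (notMem_empty l), operatorProduct_insert D (by simp), posSign_insert_self_max k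
      (by simp), operatorProduct_empty]
    simp
  | insert m J hm ih =>
    have hmJ : m ∉ J := fun h => (hm m h).false
    rw [operatorProduct_insert D hm, mul_assoc, ih]
    rcases lt_trichotomy l m with hlm | rfl | hlm
    · by_cases hl : l ∈ J
      · rw [if_pos hl, if_pos (mem_insert_of_mem hl), mul_zero]
      · have h2 : l ∉ insert m J := by
          rw [mem_insert, not_or]; exact ⟨hlm.ne, hl⟩
        rw [if_neg hl, if_neg h2, Finset.insert_comm, posSign_insert_max k hlm,
          operatorProduct_insert D (J := insert l J) (by
            intro t ht
            rcases mem_insert.1 ht with rfl | ht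
            · exact hlm
            · exact hm t ht), mul_smul_comm]
    · rw [if_neg hmJ, if_pos (mem_insert_self _ _), operatorProduct_insert D hm, mul_smul_comm,
        ← mul_assoc, h0, zero_mul, smul_zero]
    · have hl : ∀ t ∈ J, t < l := fun t ht => (hm t ht).trans hlm
      have hl' : ∀ t ∈ insert m J, t < l := by
        intro t ht
        rcases mem_insert.1 ht with rfl | ht
        · exact hlm
        · exact hl t ht
      rw [if_neg fun h => (hl l h).false, if_neg fun h => (hl' l h).false,
        posSign_insert_self_max k hl, posSign_insert_self_max k hl', operatorProduct_insert D hl,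
        operatorProduct_insert D hl', operatorProduct_insert D hm, card_insert_of_notMem hmJ,
        mul_smul_comm, ← mul_assoc, ← mul_assoc, h1 m l, pow_succ]
      simp

/-- A subspace has the same dimension as the graded space of a filtration by joint kernels. -/
theorem sum_finrank_graded {V Y ι : Type*} [AddCommGroup V] [Module k V] [FiniteDimensional k V]
    [AddCommGroup Y] [Module k Y] [LinearOrder ι] (f : ι → V →ₗ[k] Y) (T : Submodule k V)
    (S : Finset ι) :
    ∑ u ∈ S, Module.finrank k ((T ⊓ ⨅ v ∈ {v ∈ S | v < u}, LinearMap.ker (f v)).map (f u)) +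
      Module.finrank k (T ⊓ ⨅ v ∈ S, LinearMap.ker (f v) : Submodule k V) =
        Module.finrank k T := by
  induction S using Finset.induction_on_max with
  | empty =>
    have h : T ⊓ ⨅ v ∈ (∅ : Finset ι), LinearMap.ker (f v) = T := by simp
    rw [Finset.sum_empty, zero_add, h]
  | insert a S ha ih =>
    have haS : a ∉ S := fun h => (ha a h).false
    have h1 : {v ∈ insert a S | v < a} = S := by
      rw [Finset.filter_insert, if_neg (lt_irrefl a), Finset.filter_true_of_mem ha]
    have h2 : ∀ u ∈ S, {v ∈ insert a S | v < u} = {v ∈ S | v < u} := fun u hu => by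
      rw [Finset.filter_insert, if_neg (ha u hu).not_gt]
    rw [Finset.sum_insert haS, h1, Finset.sum_congr rfl fun u hu => by rw [h2 u hu], ← ih]
    set W := T ⊓ ⨅ v ∈ S, LinearMap.ker (f v) with hW
    have h3 : T ⊓ ⨅ v ∈ insert a S, LinearMap.ker (f v) = LinearMap.ker (f a) ⊓ W := by
      rw [Finset.iInf_insert, hW, inf_left_comm]
    rw [h3]
    have h4 := LinearMap.finrank_range_add_finrank_ker ((f a).domRestrict W)
    rw [LinearMap.range_domRestrict] at h4
    have h5 : Module.finrank k (LinearMap.ker ((f a).domRestrict W)) =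
        Module.finrank k (LinearMap.ker (f a) ⊓ W : Submodule k V) := by
      rw [LinearMap.ker_domRestrict, ← Submodule.finrank_map_subtype_eq,
        Submodule.map_comap_subtype, inf_comm]
    omega

end AnticommutingOperators

/-! ### Constant vectors in linear complexes -/

section LinearComplex

open MvPolynomial

variable {k σ : Type*} [Field k]

theorem MvPolynomial.IsHomogeneous.eq_sum_eval [Fintype σ] [DecidableEq σ] {f : MvPolynomial σ k}
    (hf : f.IsHomogeneous 1) : f = ∑ l, C (eval (Pi.single l 1) f) * X l := by
  have h : f ∈ Submodule.span k (Set.range (X : σ → MvPolynomial σ k)) := by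
    rw [← homogeneousSubmodule_one_eq_span_X]; exact hf
  clear hf
  induction h using Submodule.span_induction with
  | mem f hf =>
    obtain ⟨i, rfl⟩ := hf
    rw [Finset.sum_eq_single i]
    · simp
    · intro l _ hl; simp [hl.symm]
    · simp
  | zero => simp
  | add f g _ _ hf hg =>
    conv_lhs => rw [hf, hg, ← Finset.sum_add_distrib]
    exact Finset.sum_congr rfl fun l _ => by rw [map_add, map_add, add_mul]
  | smul a f _ hf =>
    conv_lhs => rw [hf, Finset.smul_sum]
    exact Finset.sum_congr rfl fun l _ => by
      rw [smul_eval, map_mul, smul_eq_C_mul, mul_assoc]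

/-- The value of a differential at a point. -/
noncomputable def FreeComplex.evalAt (G : FreeComplex (MvPolynomial σ k)) (w : σ → k) (i : ℕ) :
    Matrix (G.ι i) (G.ι (i + 1)) k :=
  (G.d i).map (eval w)

theorem FreeComplex.evalAt_mul_evalAt (G : FreeComplex (MvPolynomial σ k)) (w : σ → k) (i : ℕ) :
    G.evalAt w i * G.evalAt w (i + 1) = 0 := by
  rw [evalAt, evalAt, ← Matrix.map_mul, G.d_comp_d, Matrix.map_zero _ (map_zero _)]

/-- Evaluation of `φ f = d φ` at a point leaves the constant matrices `φ` unchanged, so their column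
spaces are stable under all evaluated differentials. -/
theorem exists_submodules_of_mem_rankSequences {G : FreeComplex (MvPolynomial σ k)} {r : ℕ → ℕ}
    (hr : r ∈ rankSequences k G) :
    ∃ U : ∀ i, Submodule k (G.ι i → k), (∀ i, Module.finrank k (U i) = r i) ∧
      ∀ i w, ∀ v ∈ U (i + 1), (G.evalAt w i).mulVec v ∈ U i := by
  obtain ⟨f, φ, ρ, -, hρ, hφ⟩ := hr
  refine ⟨fun i => LinearMap.range (φ i).mulVecLin, fun i => ?_, ?_⟩
  · rw [LinearMap.finrank_range_of_inj, Module.finrank_fin_fun]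
    intro v v' h
    have h1 := congrArg (ρ i).mulVec h
    simpa only [Matrix.mulVecLin_apply, Matrix.mulVec_mulVec, hρ, Matrix.one_mulVec] using h1
  · rintro i w _ ⟨v, rfl⟩
    refine ⟨((f i).map (eval w)).mulVec v, ?_⟩
    have h1 := congrArg (fun M => M.map (eval w)) (hφ i)
    have h2 : ∀ j, ((φ j).map (algebraMap k (MvPolynomial σ k))).map (eval w) = φ j := fun j => by
      ext a b; simp
    simp only [Matrix.map_mul, h2] at h1
    rw [Matrix.mulVecLin_apply, Matrix.mulVecLin_apply, Matrix.mulVec_mulVec, h1,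
      Matrix.mulVec_mulVec]
    rfl

variable [Fintype σ] [DecidableEq σ]

theorem mulVec_C_eq_sum {ι κ : Type*} [Fintype κ] {M : Matrix ι κ (MvPolynomial σ k)}
    (hM : ∀ a b, (M a b).IsHomogeneous 1) (z : κ → k) (a : ι) :
    M.mulVec (fun b => C (z b)) a =
      ∑ l, C ((M.map (eval (Pi.single l 1))).mulVec z a) * X l := by
  simp only [Matrix.mulVec, dotProduct, Matrix.map_apply, map_sum, map_mul, Finset.sum_mul]
  rw [Finset.sum_comm]
  refine Finset.sum_congr rfl fun b _ => ?_
  conv_lhs => rw [(hM a b).eq_sum_eval, Finset.sum_mul]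
  exact Finset.sum_congr rfl fun l _ => by ring

theorem eval_add_of_isHomogeneous {f : MvPolynomial σ k} (hf : f.IsHomogeneous 1) (w w' : σ → k) :
    eval (w + w') f = eval w f + eval w' f := by
  rw [hf.eq_sum_eval]
  simp [mul_add, Finset.sum_add_distrib]

theorem FreeComplex.evalAt_add {G : FreeComplex (MvPolynomial σ k)} {i : ℕ}
    (hG : ∀ a b, (G.d i a b).IsHomogeneous 1) (w w' : σ → k) :
    G.evalAt (w + w') i = G.evalAt w i + G.evalAt w' i := by
  ext a b
  exact eval_add_of_isHomogeneous (hG a b) w w'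

theorem FreeComplex.evalAt_mul_evalAt_comm {G : FreeComplex (MvPolynomial σ k)} {i : ℕ}
    (hG : ∀ a b, (G.d i a b).IsHomogeneous 1) (hG' : ∀ a b, (G.d (i + 1) a b).IsHomogeneous 1)
    (w w' : σ → k) :
    G.evalAt w i * G.evalAt w' (i + 1) = - (G.evalAt w' i * G.evalAt w (i + 1)) := by
  have h := G.evalAt_mul_evalAt (w + w') i
  rw [evalAt_add hG, evalAt_add hG', Matrix.add_mul, Matrix.mul_add, Matrix.mul_add,
    G.evalAt_mul_evalAt, G.evalAt_mul_evalAt, zero_add, add_zero] at h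
  exact eq_neg_of_add_eq_zero_left h

/-- Subspaces that are stable under the coefficients of the differentials of a linear complex
span a subcomplex. -/
theorem finrank_mem_rankSequences {G : FreeComplex (MvPolynomial σ k)}
    (hG : ∀ i a b, (G.d i a b).IsHomogeneous 1) (U : ∀ i, Submodule k (G.ι i → k))
    (hU : ∀ i l, ∀ v ∈ U (i + 1), (G.evalAt (Pi.single l 1) i).mulVec v ∈ U i) :
    (fun i => Module.finrank k (U i)) ∈ rankSequences k G := by
  classical
  let b := fun i => Module.finBasis k (U i)
  have hleft : ∀ i, ∃ g : (G.ι i → k) →ₗ[k] U i, g ∘ₗ (U i).subtype = LinearMap.id := fun i =>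
    (U i).subtype.exists_leftInverse_of_injective (Submodule.ker_subtype _)
  choose g hg using hleft
  let φ : ∀ i, Matrix (G.ι i) (Fin (Module.finrank k (U i))) k := fun i =>
    Matrix.of fun a j => (b i j : G.ι i → k) a
  let ρ : ∀ i, Matrix (Fin (Module.finrank k (U i))) (G.ι i) k := fun i =>
    LinearMap.toMatrix' ((b i).equivFun.toLinearMap ∘ₗ g i)
  have hρv : ∀ i v, (ρ i).mulVec v = (b i).equivFun (g i v) := fun i v => by
    rw [← Matrix.toLin'_apply, Matrix.toLin'_toMatrix']; rfl
  have hφv : ∀ i v, (φ i).mulVec v = ((b i).equivFun.symm v : G.ι i → k) := fun i v => by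
    rw [Module.Basis.equivFun_symm_apply, Submodule.coe_sum]
    ext a
    simp [Matrix.mulVec, dotProduct, φ, mul_comm]
  have hgU : ∀ i (v : U i), g i v = v := fun i v => DFunLike.congr_fun (hg i) v
  have hρφ : ∀ i, ρ i * φ i = 1 := by
    intro i
    refine Matrix.ext_of_mulVec_single fun j => ?_
    rw [← Matrix.mulVec_mulVec, hφv, hρv, hgU, LinearEquiv.apply_symm_apply, Matrix.one_mulVec]
  have hφρ : ∀ i, ∀ v ∈ U i, (φ i).mulVec ((ρ i).mulVec v) = v := by
    intro i v hv
    rw [hρv, hφv, hgU i ⟨v, hv⟩, LinearEquiv.symm_apply_apply]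
  let Φ : ∀ i, Matrix (G.ι i) (Fin (Module.finrank k (U i))) (MvPolynomial σ k) :=
    fun i => (φ i).map C
  let P : ∀ i, Matrix (Fin (Module.finrank k (U i))) (G.ι i) (MvPolynomial σ k) :=
    fun i => (ρ i).map C
  have hP : ∀ i, P i * Φ i = 1 := fun i => by
    simp only [P, Φ]
    rw [← Matrix.map_mul, hρφ, Matrix.map_one _ (map_zero _) (map_one _)]
  have hx : ∀ i, Φ i * (P i * (G.d i * Φ (i + 1))) = G.d i * Φ (i + 1) := by
    intro i
    rw [← Matrix.mul_assoc]
    have h1 : Φ i * P i = (φ i * ρ i).map C := (Matrix.map_mul).symm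
    rw [h1]
    refine Matrix.ext fun a j => ?_
    have h2 : ∀ a', (G.d i * Φ (i + 1)) a' j =
        ∑ l, C ((G.evalAt (Pi.single l 1) i).mulVec (fun a => φ (i + 1) a j) a') * X l :=
      fun a' => mulVec_C_eq_sum (hG i) (fun a => φ (i + 1) a j) a'
    have h3 : ∀ l, (φ i * ρ i).mulVec
        ((G.evalAt (Pi.single l 1) i).mulVec fun a => φ (i + 1) a j) =
        (G.evalAt (Pi.single l 1) i).mulVec fun a => φ (i + 1) a j := fun l => by
      rw [← Matrix.mulVec_mulVec]
      exact hφρ i _ (hU i l _ (b (i + 1) j).2)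
    rw [Matrix.mul_apply, h2]
    simp only [h2]
    simp only [Finset.mul_sum]
    rw [Finset.sum_comm]
    refine Finset.sum_congr rfl fun l _ => ?_
    conv_rhs => rw [← h3 l]
    rw [Matrix.mulVec, dotProduct, map_sum, Finset.sum_mul]
    exact Finset.sum_congr rfl fun a' _ => by rw [Matrix.map_apply, map_mul, mul_assoc]
  refine ⟨fun i => P i * (G.d i * Φ (i + 1)), φ, ρ, fun i => ?_, hρφ, hx⟩
  have h1 : ∀ M : Matrix (Fin (Module.finrank k (U i))) (Fin (Module.finrank k (U (i + 2))))
      (MvPolynomial σ k), Φ i * M = 0 → M = 0 := fun M hM => by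
    rw [← Matrix.one_mul M, ← hP, Matrix.mul_assoc, hM, Matrix.mul_zero]
  apply h1
  rw [← Matrix.mul_assoc, hx, Matrix.mul_assoc, hx, ← Matrix.mul_assoc, G.d_comp_d, Matrix.zero_mul]

end LinearComplex

/-! ### Embedding into a cofree module over the exterior algebra -/

section ContractionEmbedding

open MvPolynomial

variable {k : Type*} [Field k] {c : ℕ} (G : FreeComplex (MvPolynomial (Fin c) k))

/-- The coefficients of `X l` in the differentials of positive degree of a linear complex, as an
operator on the product of the terms. -/
noncomputable def FreeComplex.coefficientOperator (l : Fin c) :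
    Module.End k (∀ i, G.ι (i + 1) → k) :=
  LinearMap.pi fun i => (G.evalAt (Pi.single l 1) (i + 1)).mulVecLin ∘ₗ LinearMap.proj (i + 1)

theorem FreeComplex.coefficientOperator_apply (l : Fin c) (x : ∀ i, G.ι (i + 1) → k) (i : ℕ) :
    G.coefficientOperator l x i = (G.evalAt (Pi.single l 1) (i + 1)).mulVec (x (i + 1)) := rfl

theorem FreeComplex.coefficientOperator_single (l : Fin c) (i : ℕ) (v : G.ι (i + 2) → k) :
    G.coefficientOperator l (Pi.single (i + 1) v) =
      Pi.single i ((G.evalAt (Pi.single l 1) (i + 1)).mulVec v) := by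
  funext j
  rw [coefficientOperator_apply]
  by_cases h : j = i
  · subst h; rw [Pi.single_eq_same, Pi.single_eq_same]
  · rw [Pi.single_eq_of_ne h, Pi.single_eq_of_ne (by omega), Matrix.mulVec_zero]

theorem FreeComplex.coefficientOperator_mul_self (l : Fin c) :
    G.coefficientOperator l * G.coefficientOperator l = 0 := by
  refine LinearMap.ext fun x => funext fun i => ?_
  rw [Module.End.mul_apply, coefficientOperator_apply, coefficientOperator_apply,
    Matrix.mulVec_mulVec, evalAt_mul_evalAt, Matrix.zero_mulVec]
  rfl

variable {G}

theorem FreeComplex.coefficientOperator_mul (hG : ∀ i a b, (G.d (i + 1) a b).IsHomogeneous 1)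
    (l m : Fin c) : G.coefficientOperator l * G.coefficientOperator m =
      - (G.coefficientOperator m * G.coefficientOperator l) := by
  refine LinearMap.ext fun x => funext fun i => ?_
  rw [LinearMap.neg_apply, Pi.neg_apply, Module.End.mul_apply, Module.End.mul_apply]
  simp only [coefficientOperator_apply]
  rw [Matrix.mulVec_mulVec, Matrix.mulVec_mulVec, evalAt_mul_evalAt_comm (hG i) (hG (i + 1)),
    Matrix.neg_mulVec]

variable (G)

/-- The row of the differential of degree zero at `o`, on constant vectors. -/
noncomputable def FreeComplex.augmentation (o : G.ι 0) : (G.ι 1 → k) →ₗ[k] MvPolynomial (Fin c) k :=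
  Fintype.linearCombination k (G.d 0 o)

theorem FreeComplex.augmentation_apply (o : G.ι 0) (v : G.ι 1 → k) :
    G.augmentation o v = (G.d 0).mulVec (fun b => C (v b)) o := by
  rw [augmentation, Fintype.linearCombination_apply]
  exact Finset.sum_congr rfl fun b _ => by rw [smul_eq_C_mul, mul_comm]

/-- The embedding of a linear complex in the cofree module over the exterior algebra. -/
noncomputable def FreeComplex.cofreeEmbedding (o : G.ι 0) :
    (∀ i, G.ι (i + 1) → k) →ₗ[k] (Finset (Fin c) → MvPolynomial (Fin c) k) :=
  LinearMap.pi fun J => G.augmentation o ∘ₗ LinearMap.proj 0 ∘ₗ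
    operatorProduct G.coefficientOperator J

theorem FreeComplex.cofreeEmbedding_apply (o : G.ι 0) (x : ∀ i, G.ι (i + 1) → k)
    (J : Finset (Fin c)) : G.cofreeEmbedding o x J =
      G.augmentation o (operatorProduct G.coefficientOperator J x 0) := rfl

variable {G}

theorem FreeComplex.cofreeEmbedding_coefficientOperator
    (hG : ∀ i a b, (G.d (i + 1) a b).IsHomogeneous 1) (o : G.ι 0) (l : Fin c)
    (x : ∀ i, G.ι (i + 1) → k) (J : Finset (Fin c)) :
    G.cofreeEmbedding o (G.coefficientOperator l x) J =
      if l ∈ J then 0 else posSign k (insert l J) l • G.cofreeEmbedding o x (insert l J) := by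
  rw [cofreeEmbedding_apply, ← Module.End.mul_apply, operatorProduct_mul
    G.coefficientOperator_mul_self (coefficientOperator_mul hG)]
  split_ifs
  · rw [LinearMap.zero_apply, Pi.zero_apply, map_zero]
  · rw [LinearMap.smul_apply, Pi.smul_apply, map_smul, cofreeEmbedding_apply]

theorem FreeComplex.operatorProduct_apply_eq_zero (J : Finset (Fin c)) :
    ∀ (x : ∀ i, G.ι (i + 1) → k) (i j : ℕ), j + #J = i → x i = 0 →
      operatorProduct G.coefficientOperator J x j = 0 := by
  induction J using Finset.induction_on_max with
  | empty => rintro x i j rfl hx; rw [operatorProduct_empty]; exact hx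
  | insert m J hm ih =>
    intro x i j hij hx
    rw [card_insert_of_notMem fun h => (hm m h).false] at hij
    rw [operatorProduct_insert _ hm, Module.End.mul_apply, coefficientOperator_apply,
      ih x i (j + 1) (by omega) hx, Matrix.mulVec_zero]

theorem FreeComplex.cofreeEmbedding_single_of_card_ne (o : G.ι 0) {i : ℕ} (v : G.ι (i + 1) → k)
    {J : Finset (Fin c)} (hJ : #J ≠ i) : G.cofreeEmbedding o (Pi.single i v) J = 0 := by
  rw [cofreeEmbedding_apply, operatorProduct_apply_eq_zero _ _ _ _ (zero_add _)
    (Pi.single_eq_of_ne hJ _), map_zero]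

/-- By exactness and minimality no nonzero constant vector is a cycle. In degree one the component
at `∅` is `d 0` itself; in higher degrees the coefficient operators map `v` to vectors that vanish
by induction, so `v` is a cycle. -/
theorem FreeComplex.cofreeEmbedding_single_injective (hG : ∀ i a b, (G.d (i + 1) a b).IsHomogeneous 1)
    (hac : G.IsAcyclic) (hmin : G.IsMinimal) (o : G.ι 0) (ho : ∀ a, a = o) {i : ℕ}
    (v : G.ι (i + 1) → k) (hv : G.cofreeEmbedding o (Pi.single i v) = 0) : v = 0 := by
  have key : ∀ i (v : G.ι (i + 1) → k), (G.d i).mulVec (fun b => C (v b)) = 0 → v = 0 :=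
    fun i v h => by
      obtain ⟨w, hw⟩ := hac i _ h
      exact eq_zero_of_mulVec_C_eq_zero hmin ⟨1, w, by simp, by rw [hw, one_smul]⟩
  induction i with
  | zero =>
    refine key 0 v (funext fun a => ?_)
    rw [ho a, ← augmentation_apply]
    have := congrFun hv ∅
    rw [cofreeEmbedding_apply, operatorProduct_empty, Module.End.one_apply, Pi.single_eq_same] at this
    exact this
  | succ i ih =>
    have h1 : ∀ l, (G.evalAt (Pi.single l 1) (i + 1)).mulVec v = 0 := by
      intro l
      apply ih
      rw [← coefficientOperator_single]
      funext J
      rw [cofreeEmbedding_coefficientOperator hG, hv]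
      simp
    refine key (i + 1) v (funext fun a => ?_)
    rw [mulVec_C_eq_sum (hG i)]
    refine Finset.sum_eq_zero fun l _ => ?_
    have := congrFun (h1 l) a
    rw [evalAt] at this
    rw [this]
    simp

/-- This is `d 0 * d 1 = 0` written in the coefficients of `d 1`. -/
theorem FreeComplex.sum_X_mul_augmentation (hG : ∀ i a b, (G.d (i + 1) a b).IsHomogeneous 1)
    (o : G.ι 0) (w : G.ι 2 → k) :
    ∑ l, X l * G.augmentation o ((G.evalAt (Pi.single l 1) 1).mulVec w) = 0 := by
  have h1 : (G.d 0).mulVec ((G.d 1).mulVec fun b => C (w b)) = 0 := by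
    rw [Matrix.mulVec_mulVec, G.d_comp_d, Matrix.zero_mulVec]
  refine Eq.trans ?_ (congrFun h1 o)
  have h2 : ∀ b, (G.d 1).mulVec (fun b => C (w b)) b =
      ∑ l, C ((G.evalAt (Pi.single l 1) 1).mulVec w b) * X l := fun b => mulVec_C_eq_sum (hG 0) w b
  simp only [augmentation_apply, Matrix.mulVec, dotProduct] at h2 ⊢
  simp only [h2, Finset.mul_sum]
  rw [Finset.sum_comm]
  exact Finset.sum_congr rfl fun b _ => Finset.sum_congr rfl fun l _ => by ring

theorem operatorProduct_mul_comm {X : Type*} [AddCommGroup X] [Module k X]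
    {D : Fin c → Module.End k X} (h1 : ∀ l m, D l * D m = - (D m * D l)) (J : Finset (Fin c))
    (l : Fin c) : operatorProduct D J * D l = (-1 : k) ^ #J • (D l * operatorProduct D J) := by
  induction J using Finset.induction_on_max with
  | empty => rw [operatorProduct_empty]; simp
  | insert m J hm ih =>
    rw [operatorProduct_insert D hm, mul_assoc, ih, card_insert_of_notMem fun h => (hm m h).false,
      mul_smul_comm, ← mul_assoc, ← mul_assoc, h1 m l, pow_succ]
    simp

theorem FreeComplex.sum_X_mul_cofreeEmbedding (hG : ∀ i a b, (G.d (i + 1) a b).IsHomogeneous 1)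
    (o : G.ι 0) (x : ∀ i, G.ι (i + 1) → k) (J : Finset (Fin c)) :
    ∑ l, X l * G.cofreeEmbedding o (G.coefficientOperator l x) J = 0 := by
  have h1 : ∀ l, G.cofreeEmbedding o (G.coefficientOperator l x) J = (-1 : k) ^ #J •
      G.augmentation o ((G.evalAt (Pi.single l 1) 1).mulVec
        (operatorProduct G.coefficientOperator J x 1)) := by
    intro l
    rw [cofreeEmbedding_apply, ← Module.End.mul_apply,
      operatorProduct_mul_comm (coefficientOperator_mul hG), LinearMap.smul_apply, Pi.smul_apply,
      map_smul, Module.End.mul_apply, coefficientOperator_apply]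
  simp only [h1, mul_smul_comm]
  rw [← Finset.smul_sum, sum_X_mul_augmentation hG, smul_zero]

theorem FreeComplex.cofreeEmbedding_isHomogeneous {p : ℕ} (o : G.ι 0)
    (h0 : ∀ b, (G.d 0 o b).IsHomogeneous p) (x : ∀ i, G.ι (i + 1) → k) (J : Finset (Fin c)) :
    (G.cofreeEmbedding o x J).IsHomogeneous p := by
  rw [cofreeEmbedding_apply, augmentation, Fintype.linearCombination_apply]
  exact Submodule.sum_mem (homogeneousSubmodule (Fin c) k p) fun b _ =>
    Submodule.smul_mem _ _ (h0 b)

/-- If all coefficients at the lexicographically smaller monomials vanish, the coefficient at `u`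
is supported on sets of indices smaller than the largest index in `u`. -/
theorem FreeComplex.coeff_cofreeEmbedding_eq_zero (hG : ∀ i a b, (G.d (i + 1) a b).IsHomogeneous 1)
    (o : G.ι 0) (x : ∀ i, G.ι (i + 1) → k) (u : Fin c →₀ ℕ)
    (hu : ∀ v : Fin c →₀ ℕ, toLex v < toLex u → ∀ J, coeff v (G.cofreeEmbedding o x J) = 0)
    {J : Finset (Fin c)} {l₀ : Fin c} (hl₀ : l₀ ∈ J) (hul₀ : ∀ l, l₀ < l → u l = 0) :
    coeff u (G.cofreeEmbedding o x J) = 0 := by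
  -- Compare coefficients at `u + e_{l₀}` in the relation for `J.erase l₀`. The index `l₀` yields
  -- the desired coefficient up to sign; any other contributing `l` occurs in `u`, so `l < l₀`, and
  -- it yields a coefficient at a monomial lexicographically smaller than `u`.
  have h1 := congrArg (coeff (u + Finsupp.single l₀ 1))
    (sum_X_mul_cofreeEmbedding hG o x (J.erase l₀))
  rw [coeff_sum, Finset.sum_eq_single l₀, add_comm u, coeff_X_mul,
    cofreeEmbedding_coefficientOperator hG, if_neg (notMem_erase l₀ J), insert_erase hl₀,
    coeff_smul, coeff_zero, smul_eq_mul] at h1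
  · refine (mul_eq_zero.1 h1).resolve_left ?_
    exact pow_ne_zero _ (neg_ne_zero.2 one_ne_zero)
  · intro l _ hl
    rw [coeff_X_mul']
    split_ifs with hls
    · have hul : u l ≠ 0 := by
        have := Finsupp.mem_support_iff.1 hls
        rwa [Finsupp.add_apply, Finsupp.single_eq_of_ne hl, add_zero] at this
      have hll₀ : l < l₀ := lt_of_le_of_ne (not_lt.1 fun h => hul (hul₀ l h)) hl
      rw [cofreeEmbedding_coefficientOperator hG]
      split_ifs
      · exact coeff_zero _
      · rw [coeff_smul, hu, smul_zero]
        refine Finsupp.Lex.lt_iff.2 ⟨l, fun j hj => ?_, ?_⟩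
        · change (u + Finsupp.single l₀ 1 - Finsupp.single l 1 : Fin c →₀ ℕ) j = u j
          have h2 : j ≠ l₀ := (hj.trans hll₀).ne
          simp [h2, hj.ne]
        · change (u + Finsupp.single l₀ 1 - Finsupp.single l 1 : Fin c →₀ ℕ) l < u l
          have h2 : l ≠ l₀ := hll₀.ne
          simp [h2]
          omega
    · rfl
  · intro h; exact absurd (mem_univ _) h

end ContractionEmbedding

/-! ### Leading coefficients and Koszul subcomplexes -/

section GradedPieces

open MvPolynomial

variable {k : Type*} [Field k] {c : ℕ} {G : FreeComplex (MvPolynomial (Fin c) k)}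

variable (G) in
/-- The coefficients at the monomial `u` of the embedding in the cofree module. -/
noncomputable def FreeComplex.monomialCoeff (o : G.ι 0) (u : Fin c →₀ ℕ) :
    (∀ i, G.ι (i + 1) → k) →ₗ[k] (Finset (Fin c) → k) :=
  LinearMap.pi fun J => lcoeff k u ∘ₗ LinearMap.proj J ∘ₗ G.cofreeEmbedding o

theorem FreeComplex.monomialCoeff_apply (o : G.ι 0) (u : Fin c →₀ ℕ) (x : ∀ i, G.ι (i + 1) → k)
    (J : Finset (Fin c)) : G.monomialCoeff o u x J = coeff u (G.cofreeEmbedding o x J) := rfl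

theorem FreeComplex.monomialCoeff_coefficientOperator
    (hG : ∀ i a b, (G.d (i + 1) a b).IsHomogeneous 1) (o : G.ι 0) (u : Fin c →₀ ℕ) (l : Fin c)
    (x : ∀ i, G.ι (i + 1) → k) (J : Finset (Fin c)) :
    G.monomialCoeff o u (G.coefficientOperator l x) J =
      if l ∈ J then 0 else posSign k (insert l J) l * G.monomialCoeff o u x (insert l J) := by
  rw [monomialCoeff_apply, cofreeEmbedding_coefficientOperator hG]
  split_ifs
  · exact coeff_zero _
  · rw [coeff_smul]; rfl

variable (G) in
/-- The leading coefficients at `u` of the elements of `U`, with respect to the reversed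
lexicographic order of the monomials in `S`. -/
noncomputable def FreeComplex.leadingSpace (o : G.ι 0) (S : Finset (Lex (Fin c →₀ ℕ)))
    (u : Lex (Fin c →₀ ℕ)) (i : ℕ) (U : Submodule k (G.ι (i + 1) → k)) :
    Submodule k (Finset (Fin c) → k) :=
  (U ⊓ ⨅ v ∈ {v ∈ S | v < u}, LinearMap.ker (G.monomialCoeff o (ofLex v) ∘ₗ
    LinearMap.single k (fun i => G.ι (i + 1) → k) i)).map
      (G.monomialCoeff o (ofLex u) ∘ₗ LinearMap.single k (fun i => G.ι (i + 1) → k) i)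

variable (c) in
/-- The exponent vectors of degree `p`. -/
noncomputable def monomialsOfDegree (p : ℕ) : Finset (Lex (Fin c →₀ ℕ)) :=
  (univ.finsuppAntidiag p).map toLex.toEmbedding

theorem mem_monomialsOfDegree {p : ℕ} {u : Lex (Fin c →₀ ℕ)} :
    u ∈ monomialsOfDegree c p ↔ (ofLex u).degree = p := by
  simp [monomialsOfDegree, Finsupp.degree_eq_sum]

theorem FreeComplex.monomialCoeff_eq_zero_of_degree {p : ℕ} (o : G.ι 0)
    (h0 : ∀ b, (G.d 0 o b).IsHomogeneous p) (x : ∀ i, G.ι (i + 1) → k) {u : Fin c →₀ ℕ}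
    (hu : u.degree ≠ p) : G.monomialCoeff o u x = 0 := by
  funext J
  rw [monomialCoeff_apply]
  exact (cofreeEmbedding_isHomogeneous o h0 x J).coeff_eq_zero hu

/-- The filtration ends in zero: the embedding is injective with values in forms of degree `p`, so a
vector whose coefficients at all these monomials vanish is zero. -/
theorem FreeComplex.sum_finrank_leadingSpace {p : ℕ}
    (hG : ∀ i a b, (G.d (i + 1) a b).IsHomogeneous 1) (hac : G.IsAcyclic) (hmin : G.IsMinimal)
    (o : G.ι 0) (ho : ∀ a, a = o) (h0 : ∀ b, (G.d 0 o b).IsHomogeneous p) (i : ℕ)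
    (U : Submodule k (G.ι (i + 1) → k)) :
    ∑ u ∈ monomialsOfDegree c p,
      Module.finrank k (G.leadingSpace o (monomialsOfDegree c p) u i U) = Module.finrank k U := by
  have h1 := sum_finrank_graded (fun u : Lex (Fin c →₀ ℕ) => G.monomialCoeff o (ofLex u) ∘ₗ
    LinearMap.single k (fun i => G.ι (i + 1) → k) i) U (monomialsOfDegree c p)
  have h2 : U ⊓ ⨅ v ∈ monomialsOfDegree c p, LinearMap.ker (G.monomialCoeff o (ofLex v) ∘ₗ
      LinearMap.single k (fun i => G.ι (i + 1) → k) i) = ⊥ := by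
    rw [eq_bot_iff]
    rintro v ⟨-, hv⟩
    simp only [SetLike.mem_coe, Submodule.mem_iInf, LinearMap.mem_ker, LinearMap.comp_apply,
      LinearMap.coe_single] at hv
    refine cofreeEmbedding_single_injective hG hac hmin o ho v ?_
    funext J
    ext u
    by_cases hu : u.degree = p
    · exact congrFun (hv (toLex u) (mem_monomialsOfDegree.2 hu)) J
    · exact congrFun (monomialCoeff_eq_zero_of_degree o h0 _ hu) J
  rw [h2, finrank_bot, add_zero] at h1
  exact h1

variable (k) in
/-- Restriction of functions on subsets of `Fin c` to the basis of the Koszul complex on the first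
`m` variables. -/
noncomputable def restrictToKoszul {m : ℕ} (hm : m ≤ c) (i : ℕ) :
    (Finset (Fin c) → k) →ₗ[k] ((variableKoszul k m).ι i → k) :=
  LinearMap.funLeft k k fun J : ↥(powersetCard i (univ : Finset (Fin m))) =>
    J.1.map (Fin.castLEEmb hm)

theorem restrictToKoszul_apply {m : ℕ} (hm : m ≤ c) (i : ℕ) (F : Finset (Fin c) → k)
    (J : ↥(powersetCard i (univ : Finset (Fin m)))) :
    restrictToKoszul k hm i F J = F (J.1.map (Fin.castLEEmb hm)) := rfl

theorem posSign_map_castLE {m : ℕ} (hm : m ≤ c) (T : Finset (Fin m)) (s : Fin m) :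
    posSign k (T.map (Fin.castLEEmb hm)) (Fin.castLEEmb hm s) = posSign k T s := by
  rw [posSign, posSign, Finset.filter_map, card_map]
  rfl

/-- The same rule as in `FreeComplex.monomialCoeff_coefficientOperator`, which is what makes leading
spaces stable under the Koszul differential. -/
theorem variableKoszul_evalAt_mulVec {m : ℕ} (l : Fin m) (i : ℕ) (F : Finset (Fin m) → k)
    (J : ↥(powersetCard i (univ : Finset (Fin m)))) :
    ((variableKoszul k m).evalAt (Pi.single l 1) i).mulVec
      (fun T : ↥(powersetCard (i + 1) (univ : Finset (Fin m))) => F T.1) J =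
      if l ∈ J.1 then 0 else posSign k (insert l J.1) l * F (insert l J.1) := by
  have hJ := (mem_powersetCard.1 J.2).2
  have h1 : ∀ T : Finset (Fin m), eval (Pi.single l (1 : k))
      (koszulEntry (fun i => (X i : MvPolynomial (Fin m) k)) J.1 T) =
      if l ∈ T ∧ J.1 = T.erase l then posSign k T l else 0 := by
    intro T
    rw [koszulEntry, map_sum]
    have h2 : ∀ s ∈ T, eval (Pi.single l (1 : k)) (if J.1 = T.erase s then
        posSign (MvPolynomial (Fin m) k) T s * X s else 0) =
        if s = l then (if J.1 = T.erase l then posSign k T l else 0) else 0 := by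
      intro s _
      by_cases hs : s = l
      · subst hs
        rw [if_pos rfl]
        split_ifs
        · rw [map_mul, posSign_map, eval_X, Pi.single_eq_same, mul_one]
        · exact map_zero _
      · rw [if_neg hs]
        split_ifs
        · rw [map_mul, eval_X, Pi.single_eq_of_ne hs, mul_zero]
        · exact map_zero _
    rw [Finset.sum_congr rfl h2, Finset.sum_ite_eq']
    by_cases hl : l ∈ T <;> simp [hl]
  have h3 : ((variableKoszul k m).evalAt (Pi.single l 1) i).mulVec
      (fun T : ↥(powersetCard (i + 1) (univ : Finset (Fin m))) => F T.1) J =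
      ∑ T ∈ powersetCard (i + 1) (univ : Finset (Fin m)),
        (if l ∈ T ∧ J.1 = T.erase l then posSign k T l else 0) * F T := by
    rw [← Finset.sum_coe_sort (powersetCard (i + 1) (univ : Finset (Fin m)))
      fun T => (if l ∈ T ∧ J.1 = T.erase l then posSign k T l else 0) * F T]
    simp only [← h1]
    rfl
  rw [h3]
  split_ifs with hl
  · refine Finset.sum_eq_zero fun T _ => ?_
    rw [if_neg, zero_mul]
    rintro ⟨-, h⟩
    rw [h] at hl
    exact notMem_erase l T hl
  · rw [Finset.sum_eq_single (insert l J.1)]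
    · rw [if_pos ⟨mem_insert_self _ _, (erase_insert hl).symm⟩]
    · intro T _ hT
      rw [if_neg, zero_mul]
      rintro ⟨hlT, h⟩
      exact hT (by rw [h, insert_erase hlT])
    · intro h
      exact absurd (mem_powersetCard.2 ⟨subset_univ _, by rw [card_insert_of_notMem hl, hJ]⟩) h

/-- The leading coefficients at a monomial form a subcomplex of a Koszul complex. -/
theorem FreeComplex.finrank_leadingSpace_mem {p : ℕ}
    (hG : ∀ i a b, (G.d (i + 1) a b).IsHomogeneous 1) (o : G.ι 0)
    (h0 : ∀ b, (G.d 0 o b).IsHomogeneous p) (U : ∀ i, Submodule k (G.ι (i + 1) → k))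
    (hU : ∀ i w, ∀ v ∈ U (i + 1), (G.evalAt w (i + 1)).mulVec v ∈ U i)
    (u : Lex (Fin c →₀ ℕ)) {m : ℕ} (hm : m ≤ c) (hum : ∀ l : Fin c, m < l.1 → ofLex u l = 0) :
    (fun i => Module.finrank k (G.leadingSpace o (monomialsOfDegree c p) u i (U i))) ∈
      rankSequences k (variableKoszul k m) := by
  set S := monomialsOfDegree c p
  have hmem : ∀ i F, F ∈ G.leadingSpace o S u i (U i) ↔ ∃ v ∈ U i,
      (∀ w ∈ S, w < u → G.monomialCoeff o (ofLex w) (Pi.single i v) = 0) ∧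
      G.monomialCoeff o (ofLex u) (Pi.single i v) = F := by
    intro i F
    simp only [leadingSpace, Submodule.mem_map, Submodule.mem_inf, Submodule.mem_iInf, mem_filter,
      LinearMap.mem_ker, LinearMap.comp_apply, LinearMap.coe_single, and_assoc, and_imp]
  -- Leading coefficients are supported on `i`-element subsets of the first `m` indices, so
  -- restriction to the Koszul basis loses nothing.
  have hsupp : ∀ i, ∀ F ∈ G.leadingSpace o S u i (U i), ∀ J, F J ≠ 0 →
      #J = i ∧ ∀ l ∈ J, l.1 < m := by
    intro i F hF J hJ
    obtain ⟨v, -, hv, rfl⟩ := (hmem i F).1 hF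
    refine ⟨?_, fun l hl => ?_⟩
    · by_contra hne
      exact hJ (by rw [monomialCoeff_apply, cofreeEmbedding_single_of_card_ne o v hne, coeff_zero])
    · by_contra hlm
      refine hJ (coeff_cofreeEmbedding_eq_zero hG o _ (ofLex u) (fun w hw J => ?_) hl
        fun l' hl' => hum l' ((not_lt.1 hlm).trans_lt hl'))
      by_cases hwp : w.degree = p
      · exact congrFun (hv (toLex w) (mem_monomialsOfDegree.2 hwp) hw) J
      · exact congrFun (monomialCoeff_eq_zero_of_degree o h0 _ hwp) J
  have hrank : ∀ i, Module.finrank k ((G.leadingSpace o S u i (U i)).map (restrictToKoszul k hm i)) =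
      Module.finrank k (G.leadingSpace o S u i (U i)) := by
    intro i
    rw [← LinearMap.range_domRestrict]
    refine LinearMap.finrank_range_of_inj ?_
    rw [← LinearMap.ker_eq_bot, LinearMap.ker_eq_bot']
    rintro ⟨F, hF⟩ hF0
    refine Subtype.ext (funext fun J => ?_)
    by_contra hJ
    obtain ⟨hJi, hJm⟩ := hsupp i F hF J hJ
    let J' : Finset (Fin m) := univ.filter fun l => Fin.castLEEmb hm l ∈ J
    have hJ' : J'.map (Fin.castLEEmb hm) = J := by
      ext l
      simp only [J', mem_map, mem_filter, mem_univ, true_and]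
      constructor
      · rintro ⟨l', hl', rfl⟩; exact hl'
      · intro hl
        exact ⟨⟨l.1, hJm l hl⟩, hl, rfl⟩
    have hJ'i : J' ∈ powersetCard i (univ : Finset (Fin m)) :=
      mem_powersetCard.2 ⟨subset_univ _, by rw [← card_map (Fin.castLEEmb hm), hJ', hJi]⟩
    have h1 := congrFun hF0 ⟨J', hJ'i⟩
    rw [LinearMap.domRestrict_apply, restrictToKoszul_apply] at h1
    simp only [hJ'] at h1
    exact hJ h1
  have key := finrank_mem_rankSequences (G := variableKoszul k m) (fun i a b => ?_)
    (fun i => (G.leadingSpace o S u i (U i)).map (restrictToKoszul k hm i)) ?_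
  · simpa only [hrank] using key
  · change (koszulEntry (fun i => (X i : MvPolynomial (Fin m) k)) _ _).IsHomogeneous 1
    refine IsHomogeneous.sum _ _ _ fun s _ => ?_
    split_ifs
    · rw [posSign_mem k, algebraMap_eq]
      exact isHomogeneous_C_mul_X _ _
    · exact isHomogeneous_zero _ _ _
  · rintro i l _ ⟨F, hF, rfl⟩
    obtain ⟨v, hvU, hv, rfl⟩ := (hmem _ F).1 hF
    let l' := Fin.castLEEmb hm l
    have hD := G.coefficientOperator_single l' i v
    refine ⟨G.monomialCoeff o (ofLex u) (Pi.single i ((G.evalAt (Pi.single l' 1) (i + 1)).mulVec v)),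
      (hmem _ _).2 ⟨_, hU i _ v hvU, fun w hw hwu => ?_, rfl⟩, ?_⟩
    · funext J
      rw [← hD, monomialCoeff_coefficientOperator hG, hv w hw hwu]
      simp
    · refine funext fun (J : ↥(powersetCard i (univ : Finset (Fin m)))) => ?_
      refine Eq.trans ?_ (variableKoszul_evalAt_mulVec l i
        (fun T => G.monomialCoeff o (ofLex u) (Pi.single (i + 1) v) (T.map (Fin.castLEEmb hm)))
        J).symm
      rw [restrictToKoszul_apply, ← hD, monomialCoeff_coefficientOperator hG, map_insert,
        ← posSign_map_castLE hm, map_insert]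
      simp only [l', mem_map']

end GradedPieces

/-! ### Counting monomials by their last variable -/

section Counting

/-- Monomials are sorted by the last variable that occurs. Positivity of `p` excludes the monomial
1, which has none. -/
theorem sum_monomials_eq {M : Type*} [AddCommMonoid M] {c p : ℕ} (hp : 1 ≤ p)
    (f : (Fin c →₀ ℕ) → M) :
    ∑ u ∈ (univ : Finset (Fin c)).finsuppAntidiag p, f u = ∑ m ∈ range c,
      ∑ u ∈ ({l : Fin c | l.1 < m + 1} : Finset (Fin c)).finsuppAntidiag p \
        ({l : Fin c | l.1 < m} : Finset (Fin c)).finsuppAntidiag p, f u := by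
  have key : ∀ t, ∑ u ∈ ({l : Fin c | l.1 < t} : Finset (Fin c)).finsuppAntidiag p, f u =
      ∑ m ∈ range t,
      ∑ u ∈ ({l : Fin c | l.1 < m + 1} : Finset (Fin c)).finsuppAntidiag p \
        ({l : Fin c | l.1 < m} : Finset (Fin c)).finsuppAntidiag p, f u := by
    intro t
    induction t with
    | zero =>
      rw [range_zero, sum_empty]
      have : ({l : Fin c | l.1 < 0} : Finset (Fin c)) = ∅ := by simp
      rw [this, finsuppAntidiag_empty_of_ne_zero (by omega), sum_empty]
    | succ t ih =>
      rw [sum_range_succ, ← ih]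
      have hsub : ({l : Fin c | l.1 < t} : Finset (Fin c)) ⊆
          ({l : Fin c | l.1 < t + 1} : Finset (Fin c)) := by
        intro l hl
        simp only [mem_filter, mem_univ, true_and] at hl ⊢
        omega
      exact (sum_sdiff (f := f) (finsuppAntidiag_mono hsub p)).symm.trans (add_comm _ _)
  have huniv : ({l : Fin c | l.1 < c} : Finset (Fin c)) = univ := by
    ext l
    simp
  rw [← key c, huniv]

/-- Pascal's rule, applied to the numbers of monomials of degree `p` in `m + 1` and in `m`
variables. -/
theorem card_monomials_sdiff {c p m : ℕ} (hp : 1 ≤ p) (hm : m < c) :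
    #(({l : Fin c | l.1 < m + 1} : Finset (Fin c)).finsuppAntidiag p \
        ({l : Fin c | l.1 < m} : Finset (Fin c)).finsuppAntidiag p) =
      (m + p - 1).choose (p - 1) := by
  have hcard : ∀ t ≤ c, #({l : Fin c | l.1 < t} : Finset (Fin c)) = t := by
    intro t ht
    rw [Fin.card_filter_val_lt, min_eq_right ht]
  rw [card_sdiff_of_subset, card_finsuppAntidiag_nat_eq_choose, card_finsuppAntidiag_nat_eq_choose,
    hcard _ hm, hcard _ hm.le]
  · obtain ⟨p, rfl⟩ := Nat.exists_eq_add_of_le' hp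
    have h1 : m + 1 + (p + 1) - 1 = (m + p) + 1 := by omega
    have h2 : m + (p + 1) - 1 = m + p := by omega
    rw [h1, h2, Nat.choose_succ_succ, Nat.add_sub_cancel, Nat.add_sub_cancel]
  · refine finsuppAntidiag_mono ?_ p
    intro l hl
    simp only [mem_filter, mem_univ, true_and] at hl ⊢
    omega

theorem koszulSum_eq (k : Type*) [Field k] {p q : ℕ} (hp : 1 ≤ p) (hpq : p ≤ q) :
    koszulSum k p q = ∑ m ∈ range (q - p + 1), ∑ _i ∈ range ((m + p - 1).choose (p - 1)),
      rankSequences (MvPolynomial (Fin m) k) (variableKoszul k m) := by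
  rw [koszulSum, ← sum_range_reflect]
  refine sum_congr rfl fun j hj => ?_
  rw [mem_range] at hj
  have h1 : q - (q - p + 1 - 1 - j) - 1 = j + p - 1 := by omega
  have h2 : q - p - (q - p + 1 - 1 - j) = j := by omega
  rw [h1, h2]

theorem sum_mem_sum_range {M ι : Type*} [AddCommMonoid M] {T : Finset ι} {n : ℕ} (hn : #T = n)
    {f : ι → M} {A : Set M} (hf : ∀ u ∈ T, f u ∈ A) : ∑ u ∈ T, f u ∈ ∑ _i ∈ range n, A := by
  have h1 : ∑ _i ∈ range n, A = ∑ _u ∈ T, A := by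
    rw [sum_const, sum_const, card_range, hn]
  rw [h1]
  exact (Set.mem_finsetSum _ _ _).2 ⟨f, fun {u} hu => hf u hu, rfl⟩

open MvPolynomial in
-- Each rank is the sum over the monomials `u` of the dimensions of the leading spaces. With indices
-- counted from 0, the monomials with last variable of index `m` contribute rank sequences of the
-- Koszul complex on the `m` variables before it.
theorem FreeComplex.tail_mem_koszulSum {k : Type*} [Field k] {c p q : ℕ} (hp : 1 ≤ p) (hpq : p ≤ q)
    (hc : c = q - p + 1) {G : FreeComplex (MvPolynomial (Fin c) k)}
    (hG : ∀ i a b, (G.d (i + 1) a b).IsHomogeneous 1) (hac : G.IsAcyclic) (hmin : G.IsMinimal)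
    (o : G.ι 0) (ho : ∀ a, a = o) (h0 : ∀ b, (G.d 0 o b).IsHomogeneous p) {r : ℕ → ℕ}
    (hr : r ∈ rankSequences k G) : (fun i => r (i + 1)) ∈ koszulSum k p q := by
  obtain ⟨U, hUr, hU⟩ := exists_submodules_of_mem_rankSequences hr
  let s : (Fin c →₀ ℕ) → ℕ → ℕ := fun u i =>
    Module.finrank k (G.leadingSpace o (monomialsOfDegree c p) (toLex u) i (U (i + 1)))
  have h1 : (fun i => r (i + 1)) = ∑ u ∈ (univ : Finset (Fin c)).finsuppAntidiag p, s u := by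
    funext i
    rw [Finset.sum_apply, ← hUr, ← sum_finrank_leadingSpace hG hac hmin o ho h0, monomialsOfDegree,
      sum_map]
    rfl
  rw [h1, sum_monomials_eq hp, koszulSum_eq k hp hpq, ← hc]
  refine (Set.mem_finsetSum _ _ _).2 ⟨_, fun {m} hm => ?_, rfl⟩
  rw [mem_range] at hm
  refine sum_mem_sum_range (card_monomials_sdiff hp hm) fun u hu => ?_
  refine rankSequences_subset_rankSequences _ (finrank_leadingSpace_mem hG o h0
    (fun i => U (i + 1)) (fun i => hU (i + 1)) (toLex u) hm.le fun l hl => ?_)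
  have h2 := (mem_finsuppAntidiag.1 (mem_sdiff.1 hu).1).2
  by_contra hne
  have h3 := h2 (Finsupp.mem_support_iff.2 hne)
  simp only [mem_filter, mem_univ, true_and] at h3
  omega

end Counting

/-! ### Tails for the power matrix and minimal free resolutions -/

section PowerMatrixTails

open MvPolynomial

theorem tail_mem_koszulSum_powerMatrix {k : Type*} [Field k] {p q : ℕ} (hp : 1 ≤ p) (hpq : p ≤ q)
    {r : ℕ → ℕ} (hr : r ∈ rankSequences k (eagonNorthcott (powerMatrix k (q - p + 1) p))) :
    (fun i => r (i + 1)) ∈ koszulSum k p q := by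
  have hhom := eagonNorthcott_isHomogeneous (powerMatrix_isHomogeneous k (n := q - p + 1) (d := p))
  refine FreeComplex.tail_mem_koszulSum hp hpq rfl (fun i => hhom (i + 1))
    (eagonNorthcott_isAcyclic_of_linear (by omega) (powerMatrix_isHomogeneous k)
      (powerMatrix_hasParameters k _ p))
    (enDifferential_isMinimal hp fun i j =>
      constantCoeff_eq_zero_of_isHomogeneous one_ne_zero (powerMatrix_isHomogeneous k i j))
    () (fun _ => rfl) (fun b => ?_) hr
  have := hhom 0 () b
  rwa [enDegree, mul_one] at this

/-- The zeroth homology of the Eagon–Northcott complex. -/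
noncomputable def eagonNorthcottQuotientEquiv {R : Type*} [CommRing R] {p q : ℕ}
    (Z : Matrix (Fin p) (Fin q) R) :
    (((eagonNorthcott Z).ι 0 → R) ⧸ LinearMap.range ((eagonNorthcott Z).d 0).mulVecLin) ≃ₗ[R]
      (R ⧸ maximalMinorIdeal Z) :=
  Submodule.Quotient.equiv _ _ (LinearEquiv.funUnique Unit R R) (by
    refine (congrArg _ (range_enDifferential_zero Z)).trans ?_
    exact Submodule.map_comap_eq_of_surjective (LinearEquiv.funUnique Unit R R).surjective _)

/-- Only the target of the comparison map must have homogeneous differentials, so ungraded minimal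
resolutions are covered as well. -/
theorem rankSequences_subset_of_isMinimalFreeResolution {k : Type*} [Field k] {n p q : ℕ}
    {Z : Matrix (Fin p) (Fin q) (MvPolynomial (Fin n) k)} (hac : (eagonNorthcott Z).IsAcyclic)
    {e : ℕ → ℕ} (hhom : (eagonNorthcott Z).IsHomogeneous e)
    {G : FreeComplex (MvPolynomial (Fin n) k)}
    (hG : IsMinimalFreeResolution G (maximalMinorIdeal Z)) :
    rankSequences (MvPolynomial (Fin n) k) G ⊆ rankSequences k (eagonNorthcott Z) := by
  obtain ⟨hexact, ⟨f⟩, hmin⟩ := hG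
  have hGac : G.IsAcyclic := fun i z hz => by
    have h1 : z ∈ LinearMap.ker (G.d i).mulVecLin := hz
    rw [hexact] at h1
    exact h1
  obtain ⟨β, ρ, hβ, hρ⟩ := exists_comparison hGac hac hmin
    (f.trans (eagonNorthcottQuotientEquiv Z).symm)
  exact rankSequences_subset_of_comparison hhom β ρ hβ hρ

end PowerMatrixTails

theorem mainTheorem3 {k : Type*} [Field k] (n p q : ℕ) (hp : 1 ≤ p) (hpq : p ≤ q)
    (Z : Matrix (Fin p) (Fin q) (MvPolynomial (Fin n) k))
    (hmin : ∀ i j, MvPolynomial.constantCoeff (Z i j) = 0)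
    (hcodim : (maximalMinorIdeal Z).height = ((q - p + 1 : ℕ) : ℕ∞))
    (hCM : IsCohenMacaulay (MvPolynomial (Fin n) k ⧸ maximalMinorIdeal Z)) :
    -- subcomplexes given by matrices over `k`
    (rankSequences k (eagonNorthcott Z) ⊆
        rankSequences k (eagonNorthcott (powerMatrix k (q - p + 1) p)) ∧
      ∀ r ∈ rankSequences k (eagonNorthcott Z),
        (r 0 = 0 ∨ r 0 = 1) ∧ (fun i => r (i + 1)) ∈ koszulSum k p q) ∧
    -- arbitrary subcomplexes, when the entries of `Z` are forms of one degree
    (∀ e : ℕ, (∀ i j, (Z i j).IsHomogeneous e) →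
      rankSequences (MvPolynomial (Fin n) k) (eagonNorthcott Z) ⊆
        rankSequences (MvPolynomial (Fin (q - p + 1)) k)
          (eagonNorthcott (powerMatrix k (q - p + 1) p)) ∧
      (∀ r ∈ rankSequences (MvPolynomial (Fin n) k) (eagonNorthcott Z),
        (r 0 = 0 ∨ r 0 = 1) ∧ (fun i => r (i + 1)) ∈ koszulSum k p q) ∧
      ∀ G : FreeComplex (MvPolynomial (Fin n) k),
        IsMinimalFreeResolution G (maximalMinorIdeal Z) →
        ∀ r ∈ rankSequences (MvPolynomial (Fin n) k) G,
          (r 0 = 0 ∨ r 0 = 1) ∧ (fun i => r (i + 1)) ∈ koszulSum k p q) := by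
  have hc : 1 ≤ q - p + 1 := by omega
  have hq : q = q - p + 1 + p - 1 := by omega
  obtain ⟨gs, hgs, hpar⟩ := exists_hasParameters_of_height hcodim.ge
  rw [Fintype.card_fin] at hgs
  -- The length of `gs` is a truncated difference; it is a true one because the minors vanish at the
  -- origin, whose ideal has height at most `n`.
  have hlen : gs.length + (q - p + 1) ≤ n := by
    have h1 : maximalMinorIdeal Z ≤ originIdeal (Fin n) k := by
      refine Ideal.span_le.2 ?_
      rintro _ ⟨T, hT, rfl⟩
      exact mem_originIdeal.2
        (enDifferential_isMinimal hp hmin 0 () ⟨(0, T), mem_enBasis (by simp) hT⟩)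
    have h2 := (Ideal.height_mono h1).trans height_originIdeal_le
    rw [hcodim, Fintype.card_fin] at h2
    have h3 : q - p + 1 ≤ n := by exact_mod_cast h2
    omega
  have hsub := rankSequences_subset_powerMatrix hp hc hq Z hmin hpar hlen
  have htail : ∀ r ∈ rankSequences k (eagonNorthcott Z),
      (r 0 = 0 ∨ r 0 = 1) ∧ (fun i => r (i + 1)) ∈ koszulSum k p q := fun r hr =>
    ⟨rankSequences_zero_le_one hr (card_eagonNorthcott_zero Z),
      tail_mem_koszulSum_powerMatrix hp hpq (hsub hr)⟩
  refine ⟨⟨hsub, htail⟩, fun e he => ?_⟩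
  have hle : rankSequences (MvPolynomial (Fin n) k) (eagonNorthcott Z) ⊆
      rankSequences k (eagonNorthcott Z) :=
    (eagonNorthcott_isHomogeneous he).rankSequences_subset
  refine ⟨(hle.trans hsub).trans (rankSequences_subset_rankSequences _),
    fun r hr => htail r (hle hr), fun G hG r hr => htail r ?_⟩
  exact rankSequences_subset_of_isMinimalFreeResolution
    (eagonNorthcott_isAcyclic hpq he hpar hlen) (eagonNorthcott_isHomogeneous he) hG hr
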